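/- Let $X_1,X_2,\dots$ be i.i.d. random variables with $X_i\ge 1$ and distribution function $F$. Put $F^-(u)=\inf\{x: F(x)\ge u\}$ and $U(y)=F^-(1-1/y)$. Assume that there are $\gamma>0$, $\rho<0$ and a measurable function $A$ with $A(t)\to 0$ as $t\to\infty$ such that $$\lim_{t\to\infty}\frac{U(tx)/U(t)-x^{\gamma}}{A(t)}=x^{\gamma}\,\frac{x^{\rho}-1}{\rho}\qquad\text{for all } x>0 .$$ (In particular $1-F$ is regularly varying with index $-1/\gamma$.) For each $n$ divide the first $k_nm_n$ variables into $k_n$ consecutive blocks of $m=m_n=\lfloor n/k_n\rfloor$ variables each, and let $X^{(i)}_{m,1}\ge\dots\ge X^{(i)}_{m,m}$ be the order statistics of the $i$-th block. Let $r\ge1$ be a fixed integer, and let $p=p_n\in(0,1)$. Assume that, as $n\to\infty$, $$k_n\to\infty,\quad m_n\to\infty,\quad k_n^{1/2}A(m_n)\to 0,\quad m_np_n\to0,\quad \log(m_np_n)=o(k_n^{1/2}).$$ Let $x_p=F^-(1-p)$, $y_0=\log x_p$, $a(m,r,p)=\sum_{j=r+1}^m\frac1j+\log p$ and, for $1\le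 j\le r$, $1\le i\le k_n$, $$z^{(i)}_j(y)=j\bigl(\log X^{(i)}_{m,j}-\log X^{(i)}_{m,j+1}\bigr)-\frac{1}{a(m,r,p)}\bigl(\log X^{(i)}_{m,r+1}-y\bigr).$$ Let $$EL(y)=\sup\Bigl\{\prod_{i=1}^{k_n}\prod_{j=1}^r q^{(i)}_j:\ q^{(i)}_j\ge0,\ \sum_{i,j}q^{(i)}_j=1,\ \sum_{i,j}q^{(i)}_jz^{(i)}_j(y)=0\Bigr\}$$ (equal to $0$ if there is no such $q$), let $l(y)=(rk_n)^{rk_n}EL(y)$ be the empirical likelihood ratio, and let $\mathcal L(y)=-2\log l(y)$, with $\mathcal L(y)=\infty$ if $l(y)=0$. (If $\lambda$ solves $\sum_{i,j} z^{(i)}_j(y)/(1+\lambda z^{(i)}_j(y))=0$ with all $1+\lambda z^{(i)}_j(y)>0$, then $\mathcal L(y)=2\sum_{i,j}\log(1+\lambda z^{(i)}_j(y))$.) Then $$\mathcal L(y_0)\xrightarrow{d}\chi^2_1\qquad(n\to\infty),$$ where $\chi^2_1$ is the chi-squared distribution with one degree of freedom. -/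

import Mathlib

open MeasureTheory ProbabilityTheory Filter Topology Asymptotics

noncomputable section

namespace BlockQuantile

/-- The generalized (left-continuous) inverse `F⁻(u) = inf {x : F(x) ≥ u}`. -/
def genInv (F : ℝ → ℝ) (u : ℝ) : ℝ := sInf {x : ℝ | u ≤ F x}

/-- The distribution function `F` of the law `μ`. -/
def distFun (μ : Measure ℝ) (x : ℝ) : ℝ := cdf μ x

/-- The tail quantile function `U(y) = F⁻(1 - 1/y)`. -/
def tailU (μ : Measure ℝ) (y : ℝ) : ℝ := genInv (distFun μ) (1 - 1 / y)

/-- The high quantile `x_p = F⁻(1 - p)`. -/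
def highQuantile (μ : Measure ℝ) (p : ℝ) : ℝ := genInv (distFun μ) (1 - p)

/-- The second-order condition: `(U(tx)/U(t) - x^γ) / A(t) → x^γ (x^ρ - 1)/ρ` as `t → ∞`, for every
`x > 0`. (The limit is nonzero for `x ≠ 1`, so `A(t) ≠ 0` for all large `t`.) -/
def SecondOrder (μ : Measure ℝ) (γ ρ : ℝ) (A : ℝ → ℝ) : Prop :=
  ∀ x : ℝ, 0 < x →
    Tendsto (fun t : ℝ => (tailU μ (t * x) / tailU μ t - x ^ γ) / A t) atTop
      (𝓝 (x ^ γ * ((x ^ ρ - 1) / ρ)))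

/-- The `j`-th largest of the numbers `x 0, …, x (m-1)`, for `1 ≤ j ≤ m` (and `0` otherwise). -/
def orderStat {m : ℕ} (x : Fin m → ℝ) (j : ℕ) : ℝ :=
  if h : 1 ≤ j ∧ j ≤ m then x (Tuple.sort x ⟨m - j, by omega⟩) else 0

/-- `X_{m,j}^{(i)}`: the `j`-th largest observation in the `i`-th block of length `m` of a sample
`x 0, x 1, …`; the blocks are numbered `i = 0, 1, …` and block `i` is `x (i m), …, x (i m + m - 1)`. -/
def blockStat (x : ℕ → ℝ) (m i j : ℕ) : ℝ :=
  orderStat (fun l : Fin m => x (i * m + l)) j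

/-- `a(m, r, p) = ∑_{j=r+1}^m 1/j + log p`. -/
def aConst (m r : ℕ) (p : ℝ) : ℝ := ∑ j ∈ Finset.Icc (r + 1) m, (1 : ℝ) / j + Real.log p

/-- `z_j^{(i)}(y) = j (log X_{m,j}^{(i)} - log X_{m,j+1}^{(i)}) - a(m,r,p)⁻¹ (log X_{m,r+1}^{(i)} - y)`. -/
def zStat (x : ℕ → ℝ) (m r : ℕ) (p y : ℝ) (i j : ℕ) : ℝ :=
  j * (Real.log (blockStat x m i j) - Real.log (blockStat x m i (j + 1)))
    - (aConst m r p)⁻¹ * (Real.log (blockStat x m i (r + 1)) - y)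

/-- The empirical likelihood of the data points `z` for mean zero: the supremum of `∏ q_i` over the
probability vectors `q` with `∑ q_i z_i = 0`; it is `0` if there is no such `q`. -/
def empLik {ι : Type*} [Fintype ι] (z : ι → ℝ) : ℝ :=
  sSup {L : ℝ | ∃ q : ι → ℝ,
    (∀ i, 0 ≤ q i) ∧ ∑ i, q i = 1 ∧ ∑ i, q i * z i = 0 ∧ L = ∏ i, q i}

/-- The empirical likelihood ratio: `empLik z` divided by the maximum `N^{-N}` of `∏ q_i` over all
probability vectors, where `N` is the number of data points. -/
def empLikRatio {ι : Type*} [Fintype ι] (z : ι → ℝ) : ℝ :=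
  (Fintype.card ι : ℝ) ^ Fintype.card ι * empLik z

/-- The empirical log-likelihood ratio statistic `-2 log (empLikRatio z)`, which is `+∞` if the
ratio vanishes. -/
def logLikRatio {ι : Type*} [Fintype ι] (z : ι → ℝ) : EReal :=
  if 0 < empLikRatio z then ((-2 * Real.log (empLikRatio z) : ℝ) : EReal) else ⊤

/-- The statistic in Lagrange multiplier form: if `λ` solves `∑ z_i / (1 + λ z_i) = 0` and all
weights are positive, then the statistic is `2 ∑ log (1 + λ z_i)`. -/
theorem logLikRatio_eq_of_multiplier {ι : Type*} [Fintype ι] [Nonempty ι] (z : ι → ℝ) (lam : ℝ)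
    (hpos : ∀ i, 0 < 1 + lam * z i) (hlam : ∑ i, z i / (1 + lam * z i) = 0) :
    logLikRatio z = ((2 * ∑ i, Real.log (1 + lam * z i) : ℝ) : EReal) := by
  classical
  set N : ℕ := Fintype.card ι with hN
  have hN0 : (0 : ℝ) < N := by exact_mod_cast Fintype.card_pos
  set w : ι → ℝ := fun i => 1 + lam * z i with hw
  have hwpos : ∀ i, 0 < w i := hpos
  have hsum : ∑ i, (w i)⁻¹ = N := by
    have h1 : ∀ i, (w i)⁻¹ = 1 - lam * (z i / (1 + lam * z i)) := by
      intro i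
      have := (hpos i).ne'
      simp only [hw]
      field_simp
      ring
    simp only [h1, Finset.sum_sub_distrib, ← Finset.mul_sum, hlam]
    simp [hN]
  have hmax : IsGreatest {L : ℝ | ∃ q : ι → ℝ,
      (∀ i, 0 ≤ q i) ∧ ∑ i, q i = 1 ∧ ∑ i, q i * z i = 0 ∧ L = ∏ i, q i}
      (∏ i, ((N : ℝ)⁻¹ * (w i)⁻¹)) := by
    refine ⟨⟨fun i => (N : ℝ)⁻¹ * (w i)⁻¹, fun i => ?_, ?_, ?_, rfl⟩, ?_⟩
    · exact (mul_pos (inv_pos.2 hN0) (inv_pos.2 (hwpos i))).le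
    · rw [← Finset.mul_sum, hsum]
      exact inv_mul_cancel₀ hN0.ne'
    · have : ∀ i, (N : ℝ)⁻¹ * (w i)⁻¹ * z i = (N : ℝ)⁻¹ * (z i / (1 + lam * z i)) := by
        intro i
        simp only [hw]
        ring
      simp only [this, ← Finset.mul_sum, hlam, mul_zero]
    · rintro L ⟨q, hq0, hq1, hqz, rfl⟩
      have hqw : ∑ i, q i * w i = 1 := by
        have : ∀ i, q i * w i = q i + lam * (q i * z i) := by
          intro i
          simp only [hw]
          ring
        simp only [this, Finset.sum_add_distrib, ← Finset.mul_sum, hq1, hqz]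
        simp
      have hamgm := Real.geom_mean_le_arith_mean_weighted Finset.univ (fun _ : ι => (N : ℝ)⁻¹)
        (fun i => q i * w i) (fun _ _ => (inv_pos.2 hN0).le)
        (by simp [hN]) (fun i _ => mul_nonneg (hq0 i) (hwpos i).le)
      rw [← Finset.mul_sum, hqw, mul_one,
        Real.finsetProd_rpow _ _ (fun i _ => mul_nonneg (hq0 i) (hwpos i).le)] at hamgm
      have hP0 : 0 ≤ ∏ i, q i * w i :=
        Finset.prod_nonneg fun i _ => mul_nonneg (hq0 i) (hwpos i).le
      have hle : ∏ i, q i * w i ≤ ((N : ℝ)⁻¹) ^ N := by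
        have h2 := pow_le_pow_left₀ (Real.rpow_nonneg hP0 _) hamgm N
        rwa [Real.rpow_inv_natCast_pow hP0 Fintype.card_ne_zero] at h2
      have hW : 0 < ∏ i, (w i)⁻¹ := Finset.prod_pos fun i _ => inv_pos.2 (hwpos i)
      calc ∏ i, q i = (∏ i, q i * w i) * ∏ i, (w i)⁻¹ := by
            rw [← Finset.prod_mul_distrib]
            refine Finset.prod_congr rfl fun i _ => ?_
            rw [mul_assoc, mul_inv_cancel₀ (hwpos i).ne', mul_one]
        _ ≤ ((N : ℝ)⁻¹) ^ N * ∏ i, (w i)⁻¹ := mul_le_mul_of_nonneg_right hle hW.le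
        _ = ∏ i, ((N : ℝ)⁻¹ * (w i)⁻¹) := by
            rw [Finset.prod_mul_distrib, Finset.prod_const, Finset.card_univ]
  have hEL : empLik z = ∏ i, ((N : ℝ)⁻¹ * (w i)⁻¹) := hmax.csSup_eq
  have hR : empLikRatio z = ∏ i, (w i)⁻¹ := by
    unfold empLikRatio
    rw [hEL, Finset.prod_mul_distrib, Finset.prod_const, Finset.card_univ, ← hN, ← mul_assoc,
      ← mul_pow, mul_inv_cancel₀ hN0.ne', one_pow, one_mul]
  have hRpos : 0 < empLikRatio z := by
    rw [hR]
    exact Finset.prod_pos fun i _ => inv_pos.2 (hwpos i)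
  unfold logLikRatio
  rw [if_pos hRpos, hR, Real.log_prod (fun i _ => (inv_pos.2 (hwpos i)).ne')]
  simp only [Real.log_inv, Finset.sum_neg_distrib, hw]
  congr 1
  ring

/-- The statistic `𝓛(y)` built from the points `z_j^{(i)}(y)`, `1 ≤ j ≤ r`, of `k` blocks of
length `m` of the sample `x`. -/
def elStat (x : ℕ → ℝ) (k m r : ℕ) (p y : ℝ) : EReal :=
  logLikRatio (fun ij : Fin k × Fin r => zStat x m r p y ij.1 (ij.2 + 1))

/-- The chi-squared distribution with one degree of freedom: the law of the square of a standard
normal variable. -/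
def chiSqOne : Measure ℝ := (gaussianReal 0 1).map (fun x => x ^ 2)

end BlockQuantile

end

/-! Everything is transferred to independent standard exponential variables `e`. By the quantile
transform a sample point is `U(exp E)` with `E` exponential, and by Rényi's representation
(`map_sortVec_eq_map_renyiMap`) the logarithm of the `j`-th largest Pareto variable of a block
becomes `∑_{q=j}^m e_q / q`. Since `ρ < 0`, the second-order condition makes `log U(y) - γ log y`
converge to a constant with error of order `A`, and Potter bounds make this uniform
(`exists_abs_log_sub_le`). Therefore `z_j = γ ((e_j - 1) - a⁻¹ ∑_{q=r+1}^m (e_q - 1)/q) + O(|A(m)|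
(1 + (m/Y)^K))`, where `Y` is the `(r+1)`-th largest Pareto variable of the block
(`abs_modelPoint_sub_le`); the constant `a` is exactly what centres both exponential terms.

Both corrections are negligible after summation over the blocks and division by `√k`. The block
average has variance at most `a⁻²`, because `∑_{q>r} q⁻² ≤ 1`, and `a ≤ 1 + log(mp) → -∞`. The
inverse moments of `Y/m` are bounded in `m`, so the remainder has mean of order `|A(m)|`, and `√k
A(m) → 0`. Hence `S = ∑ z` and `V = ∑ z²` satisfy `S/(γ√(rk)) → N(0,1)` in law and `V/k → rγ²` in
probability, and `max |z| = o(√k)` in probability.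

On the empirical likelihood side, when `max |z| · |S|` is small compared with `V`, the Lagrange
multiplier is close to `S/V` and a Taylor expansion gives `-2 log` ratio `= S²/V + o(1)`
(`exists_logLikRatio_eq_abs_sub_le`, `tendsto_logLikRatio_sub_sq`). The limit is thus the square of
a standard normal variable. The true statistic and its exponential model have the same law at each
large stage (`map_elStat_eq_map_modelStat`), so the limit carries over. Convergence in probability
is handled throughout as convergence along the filter `whp`. -/

noncomputable section

namespace BlockQuantile

/-! ### Empirical likelihood: measurability and quadratic expansion. -/

section EmpiricalLikelihood

variable {ι : Type*} [Fintype ι]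

theorem empLik_nonneg (z : ι → ℝ) : 0 ≤ empLik z := by
  refine Real.sSup_nonneg ?_
  rintro L ⟨q, hq, -, -, rfl⟩
  exact Finset.prod_nonneg fun i _ => hq i

/-- The set is the projection of a closed set along the simplex of weights, which is compact, and
such a projection is a closed map. -/
theorem isClosed_setOf_exists_weights (c : ℝ) :
    IsClosed {z : ι → ℝ | ∃ q : ι → ℝ,
      (∀ i, 0 ≤ q i) ∧ ∑ i, q i = 1 ∧ ∑ i, q i * z i = 0 ∧ c ≤ ∏ i, q i} := by
  have hcl : IsClosed ({w : stdSimplex ℝ ι × (ι → ℝ) | ∑ i, (w.1 : ι → ℝ) i * w.2 i = 0} ∩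
      {w : stdSimplex ℝ ι × (ι → ℝ) | c ≤ ∏ i, (w.1 : ι → ℝ) i}) := by
    have h1 : ∀ i, Continuous fun w : stdSimplex ℝ ι × (ι → ℝ) => (w.1 : ι → ℝ) i := fun i =>
      (continuous_apply i).comp (continuous_subtype_val.comp continuous_fst)
    have h2 : ∀ i, Continuous fun w : stdSimplex ℝ ι × (ι → ℝ) => w.2 i := fun i =>
      (continuous_apply i).comp continuous_snd
    refine (isClosed_eq ?_ continuous_const).inter (isClosed_le continuous_const ?_)
    · exact continuous_finsetSum _ fun i _ => (h1 i).mul (h2 i)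
    · exact continuous_finsetProd _ fun i _ => h1 i
  convert isClosedMap_snd_of_compactSpace _ hcl using 1
  ext z
  constructor
  · rintro ⟨q, h0, h1, h2, h3⟩
    exact ⟨(⟨q, h0, h1⟩, z), ⟨h2, h3⟩, rfl⟩
  · rintro ⟨⟨⟨q, h0, h1⟩, z'⟩, ⟨h2, h3⟩, rfl⟩
    exact ⟨q, h0, h1, h2, h3⟩

/-- For `c ≥ 0` the set where the supremum exceeds `c` is a countable union of the closed sets above
at levels `c + 1/(n+1)`, so attainment of the supremum is not needed. For `c < 0` it is everything,
the default value `sSup ∅ = 0` included. -/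
theorem measurable_empLik : Measurable (empLik : (ι → ℝ) → ℝ) := by
  refine measurable_of_Ioi fun c => ?_
  rcases lt_or_ge c 0 with hc | hc
  · convert MeasurableSet.univ
    ext z
    simpa using hc.trans_le (empLik_nonneg z)
  · have : (empLik : (ι → ℝ) → ℝ) ⁻¹' Set.Ioi c = ⋃ n : ℕ, {z : ι → ℝ | ∃ q : ι → ℝ,
        (∀ i, 0 ≤ q i) ∧ ∑ i, q i = 1 ∧ ∑ i, q i * z i = 0 ∧
          c + 1 / ((n : ℝ) + 1) ≤ ∏ i, q i} := by
      ext z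
      simp only [Set.mem_preimage, Set.mem_Ioi, Set.mem_iUnion, Set.mem_ofPred_eq]
      have hbdd : BddAbove {L : ℝ | ∃ q : ι → ℝ,
          (∀ i, 0 ≤ q i) ∧ ∑ i, q i = 1 ∧ ∑ i, q i * z i = 0 ∧ L = ∏ i, q i} := by
        refine ⟨1, ?_⟩
        rintro L ⟨q, h0, h1, -, rfl⟩
        refine Finset.prod_le_one (fun i _ => h0 i) fun i _ => ?_
        rw [← h1]
        exact Finset.single_le_sum (fun j _ => h0 j) (Finset.mem_univ i)
      constructor
      · intro h
        have hne : {L : ℝ | ∃ q : ι → ℝ,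
          (∀ i, 0 ≤ q i) ∧ ∑ i, q i = 1 ∧ ∑ i, q i * z i = 0 ∧ L = ∏ i, q i}.Nonempty := by
          by_contra hne
          rw [Set.not_nonempty_iff_eq_empty] at hne
          rw [empLik, hne, Real.sSup_empty] at h
          linarith
        obtain ⟨L, ⟨q, h0, h1, h2, rfl⟩, hL⟩ := exists_lt_of_lt_csSup hne h
        obtain ⟨n, hn⟩ := exists_nat_one_div_lt (sub_pos.2 hL)
        exact ⟨n, q, h0, h1, h2, by linarith⟩
      · rintro ⟨n, q, h0, h1, h2, h3⟩
        have h4 : (0 : ℝ) < 1 / ((n : ℝ) + 1) := by positivity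
        exact lt_of_lt_of_le (by linarith) (le_csSup hbdd ⟨q, h0, h1, h2, rfl⟩)
    rw [this]
    exact MeasurableSet.iUnion fun n => (isClosed_setOf_exists_weights _).measurableSet

theorem measurable_logLikRatio : Measurable (logLikRatio : (ι → ℝ) → EReal) := by
  have h : Measurable (empLikRatio : (ι → ℝ) → ℝ) := measurable_empLik.const_mul _
  unfold logLikRatio
  refine Measurable.ite (measurableSet_lt measurable_const h) ?_ measurable_const
  exact ((Real.measurable_log.comp h).const_mul _).coe_real_ereal

/-- Intermediate value theorem on `[0, 2S/V]`. The hypothesis `4MS ≤ V` keeps `|l z_i| ≤ 1/2` there.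
The score equals `S ≥ 0` at `0`; at the right end `1/(1 + w) ≥ 2/3` bounds it by `S - (2S/V)(2/3)V =
-S/3`. -/
theorem exists_multiplier_of_sum_nonneg (z : ι → ℝ) {M : ℝ} (hM : ∀ i, |z i| ≤ M)
    (hS : 0 ≤ ∑ i, z i) (hV : 0 < ∑ i, z i ^ 2) (h : 4 * M * |∑ i, z i| ≤ ∑ i, z i ^ 2) :
    ∃ l : ℝ, |l| ≤ 2 * |∑ i, z i| / ∑ i, z i ^ 2 ∧ ∑ i, z i / (1 + l * z i) = 0 := by
  set S := ∑ i, z i with hSd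
  set V := ∑ i, z i ^ 2 with hVd
  rw [abs_of_nonneg hS] at h ⊢
  have hl0 : 0 ≤ 2 * S / V := by positivity
  have hM2 : 2 * S / V * M ≤ 1 / 2 := by
    rw [div_mul_eq_mul_div, div_le_iff₀ hV]
    linarith
  have hb : ∀ l ∈ Set.Icc 0 (2 * S / V), ∀ i, |l * z i| ≤ 1 / 2 := by
    intro l hl i
    rw [abs_mul, abs_of_nonneg hl.1]
    exact (mul_le_mul hl.2 (hM i) (abs_nonneg _) hl0).trans hM2
  have hpos : ∀ l ∈ Set.Icc 0 (2 * S / V), ∀ i, 1 / 2 ≤ 1 + l * z i := fun l hl i => by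
    linarith [(abs_le.1 (hb l hl i)).1]
  have hcont : ContinuousOn (fun l : ℝ => ∑ i, z i / (1 + l * z i)) (Set.Icc 0 (2 * S / V)) := by
    refine continuousOn_finsetSum _ fun i _ => ContinuousOn.div continuousOn_const (by fun_prop) ?_
    intro l hl
    linarith [hpos l hl i]
  have hend : ∑ i, z i / (1 + 2 * S / V * z i) ≤ 0 := by
    have hmem : 2 * S / V ∈ Set.Icc 0 (2 * S / V) := ⟨hl0, le_rfl⟩
    have h1 : ∀ i, z i / (1 + 2 * S / V * z i) ≤ z i - 2 * S / V * (2 / 3 * z i ^ 2) := by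
      intro i
      have hp := hpos _ hmem i
      have hp2 := (abs_le.1 (hb _ hmem i)).2
      set w := 2 * S / V * z i with hw
      have : z i / (1 + w) = z i - 2 * S / V * (z i ^ 2 / (1 + w)) := by
        have : (1 + w) ≠ 0 := by linarith
        field_simp
        rw [hw]
        field_simp
        ring
      rw [this]
      have h3 : 2 / 3 * z i ^ 2 ≤ z i ^ 2 / (1 + w) := by
        rw [le_div_iff₀ (by linarith)]
        nlinarith [sq_nonneg (z i)]
      have := mul_le_mul_of_nonneg_left h3 hl0
      linarith
    refine (Finset.sum_le_sum fun i _ => h1 i).trans ?_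
    rw [Finset.sum_sub_distrib, ← Finset.mul_sum, ← Finset.mul_sum, ← hSd, ← hVd]
    have : 2 * S / V * (2 / 3 * V) = 4 / 3 * S := by field_simp; ring
    rw [this]
    linarith
  have hstart : 0 ≤ ∑ i, z i / (1 + 0 * z i) := by simpa using hS
  obtain ⟨l, hl, hl2⟩ := intermediate_value_Icc' hl0 hcont ⟨hend, hstart⟩
  exact ⟨l, by rw [abs_of_nonneg hl.1]; exact hl.2, hl2⟩

theorem exists_multiplier (z : ι → ℝ) {M : ℝ} (hM : ∀ i, |z i| ≤ M)
    (hV : 0 < ∑ i, z i ^ 2) (h : 4 * M * |∑ i, z i| ≤ ∑ i, z i ^ 2) :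
    ∃ l : ℝ, |l| ≤ 2 * |∑ i, z i| / ∑ i, z i ^ 2 ∧ ∑ i, z i / (1 + l * z i) = 0 := by
  rcases le_total 0 (∑ i, z i) with hS | hS
  · exact exists_multiplier_of_sum_nonneg z hM hS hV h
  · obtain ⟨l, h1, h2⟩ := exists_multiplier_of_sum_nonneg (fun i => -z i) (M := M)
      (by simpa using hM) (by simpa using hS) (by simpa using hV) (by simpa using h)
    refine ⟨-l, by simpa using h1, ?_⟩
    simp only [neg_div, Finset.sum_neg_distrib, neg_eq_zero] at h2
    simpa using h2

theorem abs_log_one_add_sub_le {x : ℝ} (hx : |x| ≤ 1 / 2) :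
    |Real.log (1 + x) - (x - x ^ 2 / 2)| ≤ 2 * |x| ^ 3 := by
  have h := Real.abs_log_sub_add_sum_range_le (x := -x) (by rw [abs_neg]; linarith) 2
  rw [abs_neg, sub_neg_eq_add] at h
  have h2 : |x| ^ 3 / (1 - |x|) ≤ 2 * |x| ^ 3 := by
    rw [div_le_iff₀ (by linarith)]
    nlinarith [pow_nonneg (abs_nonneg x) 3]
  refine le_trans (le_of_eq ?_) (h.trans h2)
  congr 1
  simp [Finset.sum_range_succ]
  ring

/-- The quadratic approximation of the empirical log-likelihood ratio statistic. -/
theorem exists_logLikRatio_eq_abs_sub_le (z : ι → ℝ) {M : ℝ} (hM : ∀ i, |z i| ≤ M)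
    (hV : 0 < ∑ i, z i ^ 2) (h : 4 * M * |∑ i, z i| ≤ ∑ i, z i ^ 2) :
    ∃ L : ℝ, logLikRatio z = (L : EReal) ∧
      |L - (∑ i, z i) ^ 2 / ∑ i, z i ^ 2| ≤
        48 * ((∑ i, z i) ^ 2 / ∑ i, z i ^ 2) * (M * |∑ i, z i| / ∑ i, z i ^ 2) := by
  obtain ⟨l, hl, hl0⟩ := exists_multiplier z hM hV h
  have hne : Nonempty ι := by
    by_contra hne
    rw [not_nonempty_iff] at hne
    simp at hV
  have hM0 : 0 ≤ M := (abs_nonneg _).trans (hM hne.some)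
  set S := ∑ i, z i with hSd
  set V := ∑ i, z i ^ 2 with hVd
  have hlM : |l| * M ≤ 1 / 2 := by
    refine (mul_le_mul_of_nonneg_right hl hM0).trans ?_
    rw [div_mul_eq_mul_div, div_le_iff₀ hV]
    linarith
  have hb : ∀ i, |l * z i| ≤ 1 / 2 := fun i => by
    rw [abs_mul]
    exact (mul_le_mul_of_nonneg_left (hM i) (abs_nonneg _)).trans hlM
  have hhalf : ∀ i, 1 / 2 ≤ 1 + l * z i := fun i => by linarith [(abs_le.1 (hb i)).1]
  have hpos : ∀ i, 0 < 1 + l * z i := fun i => by linarith [hhalf i]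
  refine ⟨_, logLikRatio_eq_of_multiplier z l hpos hl0, ?_⟩
  have hcube : ∑ i, |z i| ^ 3 ≤ M * V := by
    rw [hVd, Finset.mul_sum]
    refine Finset.sum_le_sum fun i _ => ?_
    rw [pow_succ', sq_abs]
    exact mul_le_mul_of_nonneg_right (hM i) (sq_nonneg _)
  have hT : |2 * ∑ i, Real.log (1 + l * z i) - (2 * l * S - l ^ 2 * V)| ≤ 4 * |l| ^ 3 * (M * V) := by
    have : 2 * ∑ i, Real.log (1 + l * z i) - (2 * l * S - l ^ 2 * V)
        = ∑ i, 2 * (Real.log (1 + l * z i) - (l * z i - (l * z i) ^ 2 / 2)) := by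
      rw [hSd, hVd, Finset.mul_sum, Finset.mul_sum, Finset.mul_sum, ← Finset.sum_sub_distrib,
        ← Finset.sum_sub_distrib]
      exact Finset.sum_congr rfl fun i _ => by ring
    rw [this]
    refine (Finset.abs_sum_le_sum_abs _ _).trans ?_
    refine le_trans ?_ (mul_le_mul_of_nonneg_left hcube (by positivity))
    rw [Finset.mul_sum]
    refine Finset.sum_le_sum fun i _ => ?_
    have := abs_log_one_add_sub_le (hb i)
    rw [abs_mul, abs_two]
    rw [abs_mul l (z i), mul_pow |l|] at this
    linarith
  -- Expanding `z/(1 + lz) = z - l z² + l² z³/(1 + lz)` in the score equation shows that `l` is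
  -- `S/V` up to a cubic term.
  have hS2 : |l * V - S| ≤ l ^ 2 * (2 * (M * V)) := by
    have : l * V - S = l ^ 2 * ∑ i, z i ^ 3 / (1 + l * z i) - ∑ i, z i / (1 + l * z i) := by
      rw [hSd, hVd, Finset.mul_sum, Finset.mul_sum, ← Finset.sum_sub_distrib,
        ← Finset.sum_sub_distrib]
      refine Finset.sum_congr rfl fun i _ => ?_
      have := (hpos i).ne'
      field_simp
      ring
    rw [this, hl0, sub_zero, abs_mul, abs_sq]
    refine mul_le_mul_of_nonneg_left ?_ (sq_nonneg _)
    refine (Finset.abs_sum_le_sum_abs _ _).trans ?_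
    refine le_trans ?_ (mul_le_mul_of_nonneg_left hcube (by norm_num))
    rw [Finset.mul_sum]
    refine Finset.sum_le_sum fun i _ => ?_
    rw [abs_div, abs_of_pos (hpos i), abs_pow, div_le_iff₀ (hpos i)]
    nlinarith [hhalf i, pow_nonneg (abs_nonneg (z i)) 3]
  set a := |S| / V with ha
  have ha0 : 0 ≤ a := by positivity
  have hla : |l| ≤ 2 * a := by rw [ha, ← mul_div_assoc]; exact hl
  have hSa : |S| = a * V := by rw [ha]; field_simp
  have hMa : 4 * (M * a) ≤ 1 := by
    rw [hSa] at h
    have : (4 * (M * a)) * V ≤ 1 * V := by linarith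
    exact le_of_mul_le_mul_right this hV
  have hSV : S ^ 2 / V = a ^ 2 * V := by
    rw [← sq_abs, hSa]; field_simp
  have hMS : M * |S| / V = M * a := by rw [hSa]; field_simp
  rw [hSV, hMS]
  -- Completing the square: `2lS - l²V = S²/V - (lV - S)²/V`. The Taylor error contributes 32 and
  -- the square 16 to the constant 48.
  have e1 : 2 * ∑ i, Real.log (1 + l * z i) - a ^ 2 * V
      = (2 * ∑ i, Real.log (1 + l * z i) - (2 * l * S - l ^ 2 * V)) - (l * V - S) ^ 2 / V := by
    rw [← hSV]; field_simp; ring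
  have l3 : |l| ^ 3 ≤ 8 * a ^ 3 := by
    have := pow_le_pow_left₀ (abs_nonneg l) hla 3
    nlinarith
  have l2 : l ^ 2 ≤ 4 * a ^ 2 := by
    have := pow_le_pow_left₀ (abs_nonneg l) hla 2
    rw [sq_abs] at this
    nlinarith
  have hMV : 0 ≤ M * V := by positivity
  have b1 : |l * V - S| ≤ 8 * a ^ 2 * (M * V) :=
    hS2.trans (by nlinarith [mul_le_mul_of_nonneg_right l2 hMV])
  have b2 : (l * V - S) ^ 2 / V ≤ 16 * (a ^ 2 * V) * (M * a) := by
    rw [div_le_iff₀ hV, ← sq_abs]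
    have h5 := pow_le_pow_left₀ (abs_nonneg _) b1 2
    refine h5.trans ?_
    have : (8 * a ^ 2 * (M * V)) ^ 2 = 16 * (a ^ 2 * V) * (M * a) * V * (4 * (M * a)) := by ring
    rw [this]
    exact mul_le_of_le_one_right (by positivity) hMa
  have b3 : 4 * |l| ^ 3 * (M * V) ≤ 32 * (a ^ 2 * V) * (M * a) := by
    have := mul_le_mul_of_nonneg_right l3 hMV
    nlinarith
  rw [e1]
  refine (abs_sub _ _).trans ?_
  rw [abs_of_nonneg (by positivity : 0 ≤ (l * V - S) ^ 2 / V)]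
  linarith

end EmpiricalLikelihood

/-! ### Regular variation: uniform control of `log U` and of `A`. -/

section RegularVariation

/-- Uniform boundedness in Karamata's uniform convergence theorem, in additive form. -/
theorem exists_abs_add_sub_le_two {f : ℝ → ℝ} (hf : Measurable f)
    (h : ∀ v, Tendsto (fun u => f (u + v) - f u) atTop (𝓝 0)) :
    ∃ u₀, ∀ u ≥ u₀, ∀ v ∈ Set.Icc (0 : ℝ) 1, |f (u + v) - f u| ≤ 2 := by
  by_contra hcon
  push Not at hcon
  choose u hu v hv huv using fun n : ℕ => hcon n
  have hu_top : Tendsto u atTop atTop := tendsto_atTop_mono hu tendsto_natCast_atTop_atTop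
  have huv_top : Tendsto (fun n => u n + v n) atTop atTop :=
    tendsto_atTop_mono (fun n => by linarith [hu n, (hv n).1]) tendsto_natCast_atTop_atTop
  -- Each fixed `w ∈ [0,2]` eventually has small increment, so the increasing sets of points that
  -- are good from stage `n` on exhaust `[0,2]`, and their measures tend to 2.
  have key : ∀ s : ℕ → ℝ, Tendsto s atTop atTop →
      Tendsto (fun n => volume (⋂ m ≥ n, (Set.Icc (0 : ℝ) 2 ∩ {w | |f (s m + w) - f (s m)| ≤ 1})))
        atTop (𝓝 2) ∧ ∀ m, MeasurableSet (Set.Icc (0 : ℝ) 2 ∩ {w | |f (s m + w) - f (s m)| ≤ 1}) := by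
    intro s hs
    have hmeas : ∀ m, MeasurableSet (Set.Icc (0 : ℝ) 2 ∩ {w | |f (s m + w) - f (s m)| ≤ 1}) := by
      intro m
      refine measurableSet_Icc.inter (measurableSet_le ?_ measurable_const)
      exact ((hf.comp (measurable_const_add _)).sub_const _).abs
    refine ⟨?_, hmeas⟩
    have hmono : Monotone fun n =>
        ⋂ m ≥ n, (Set.Icc (0 : ℝ) 2 ∩ {w | |f (s m + w) - f (s m)| ≤ 1}) := fun a b hab =>
      Set.biInter_subset_biInter_left fun m hm => le_trans hab hm
    have hlim := tendsto_measure_iUnion_atTop (μ := (volume : Measure ℝ)) hmono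
    have hun : (⋃ n, ⋂ m ≥ n, (Set.Icc (0 : ℝ) 2 ∩ {w | |f (s m + w) - f (s m)| ≤ 1}))
        = Set.Icc (0 : ℝ) 2 := by
      ext w
      simp only [Set.mem_iUnion, Set.mem_iInter]
      constructor
      · rintro ⟨n, hn⟩
        exact (hn n le_rfl).1
      · intro hw
        have h1 := (h w).comp hs
        have h2 := (tendsto_order.1 h1.abs).2 1 (by simp)
        obtain ⟨n, hn⟩ := eventually_atTop.1 h2
        exact ⟨n, fun m hm => ⟨hw, (hn m hm).le⟩⟩
    rw [hun, Real.volume_Icc] at hlim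
    simpa [Function.comp_def] using hlim
  obtain ⟨hV, hVm⟩ := key u hu_top
  obtain ⟨hW, hWm⟩ := key _ huv_top
  have h32 : (3 / 2 : ENNReal) < 2 := by
    rw [ENNReal.div_lt_iff (by simp) (by simp)]
    norm_num
  obtain ⟨n, hn1, hn2⟩ := (((tendsto_order.1 hV).1 _ h32).and ((tendsto_order.1 hW).1 _ h32)).exists
  set V := ⋂ m ≥ n, (Set.Icc (0 : ℝ) 2 ∩ {w | |f (u m + w) - f (u m)| ≤ 1}) with hVd
  set W := ⋂ m ≥ n, (Set.Icc (0 : ℝ) 2 ∩ {w | |f (u m + v m + w) - f (u m + v m)| ≤ 1}) with hWd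
  have hVms : MeasurableSet V := MeasurableSet.biInter (Set.to_countable _) fun m _ => hVm m
  have hW' : volume ((fun w => -v n + w) ⁻¹' W) = volume W :=
    measure_preimage_add volume (-v n) W
  -- The good set at `u n` and the translate by `v n` of the one at `u n + v n` lie in `[0,3]` and
  -- each has measure above `3/2`, so they meet. A common point links `f (u n)` and `f (u n + v n)`
  -- with two errors at most 1.
  have hnd : ¬ Disjoint V ((fun w => -v n + w) ⁻¹' W) := by
    intro hd
    have h1 : volume (V ∪ (fun w => -v n + w) ⁻¹' W) ≤ volume (Set.Icc (0 : ℝ) 3) := by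
      refine measure_mono (Set.union_subset ?_ ?_)
      · intro w hw
        have := (Set.mem_iInter₂.1 hw n le_rfl).1
        exact ⟨this.1, by linarith [this.2]⟩
      · intro w hw
        have := (Set.mem_iInter₂.1 hw n le_rfl).1
        exact ⟨by linarith [this.1, (hv n).1], by linarith [this.2, (hv n).2]⟩
    rw [measure_union' hd hVms, hW', Real.volume_Icc] at h1
    have h3 : (3 / 2 : ENNReal) + 3 / 2 < volume V + volume W := ENNReal.add_lt_add hn1 hn2
    rw [ENNReal.add_halves] at h3
    have := h3.trans_le h1
    simp at this
  obtain ⟨w, hw1, hw2⟩ := Set.not_disjoint_iff.1 hnd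
  have a1 : |f (u n + w) - f (u n)| ≤ 1 := (Set.mem_iInter₂.1 hw1 n le_rfl).2
  have a2 : |f (u n + v n + (-v n + w)) - f (u n + v n)| ≤ 1 :=
    (Set.mem_iInter₂.1 hw2 n le_rfl).2
  rw [show u n + v n + (-v n + w) = u n + w by ring] at a2
  have a3 := huv n
  rw [abs_le] at a1 a2
  rw [lt_abs] at a3
  rcases a3 with a3 | a3 <;> linarith [a1.1, a1.2, a2.1, a2.2]

/-- Unit steps are chained, each costing at most `δ`; the leftover fractional step costs at most 2
by the uniform bound. -/
theorem exists_abs_add_sub_le {f : ℝ → ℝ} (hf : Measurable f)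
    (h : ∀ v, Tendsto (fun u => f (u + v) - f u) atTop (𝓝 0)) {δ : ℝ} (hδ : 0 < δ) :
    ∃ u₀, ∀ u ≥ u₀, ∀ v ≥ 0, |f (u + v) - f u| ≤ δ * v + 2 := by
  obtain ⟨u₁, h1⟩ := exists_abs_add_sub_le_two hf h
  obtain ⟨u₂, h2⟩ := eventually_atTop.1 ((tendsto_order.1 (h 1).abs).2 δ (by simpa using hδ))
  have key : ∀ j : ℕ, ∀ u ≥ max u₁ u₂, ∀ v : ℝ, j ≤ v → v ≤ j + 1 →
      |f (u + v) - f u| ≤ δ * j + 2 := by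
    intro j
    induction j with
    | zero =>
      intro u hu v hv hv'
      have := h1 u (le_of_max_le_left hu) v ⟨by simpa using hv, by simpa using hv'⟩
      simpa using this
    | succ j ih =>
      intro u hu v hv hv'
      push_cast at hv hv' ⊢
      have i1 := ih (u + 1) (by linarith) (v - 1) (by linarith) (by linarith)
      have i2 := h2 u (le_of_max_le_right hu)
      rw [show u + 1 + (v - 1) = u + v by ring] at i1
      rw [abs_le] at i1 ⊢
      rw [abs_lt] at i2
      constructor <;> linarith [i1.1, i1.2, i2.1, i2.2]
  refine ⟨max u₁ u₂, fun u hu v hv => ?_⟩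
  have h3 := Nat.floor_le hv
  refine (key ⌊v⌋₊ u hu v h3 (Nat.lt_floor_add_one v).le).trans ?_
  nlinarith

/-- Potter-type bounds for a measurable regularly varying function of negative index. -/
theorem exists_potter_bounds {A : ℝ → ℝ} (hAm : Measurable A) {ρ : ℝ} (hρ : ρ < 0)
    (hA0 : ∀ᶠ t in atTop, A t ≠ 0)
    (hRV : ∀ x, 0 < x → Tendsto (fun t => A (t * x) / A t) atTop (𝓝 (x ^ ρ))) :
    ∃ (C t₀ : ℝ) (K : ℕ), 1 ≤ C ∧ 1 ≤ t₀ ∧ (∀ t ≥ t₀, A t ≠ 0) ∧ ∀ t ≥ t₀, ∀ x ≥ 1,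
      |A (t * x)| ≤ C * |A t| ∧ |A t| ≤ C * x ^ K * |A (t * x)| := by
  obtain ⟨t₁, ht₁⟩ := eventually_atTop.1 hA0
  -- `Real.log` ignores signs, so this is `log |A|` and no sign condition on `A` is needed.
  set f : ℝ → ℝ := fun u => Real.log (A (Real.exp u)) - ρ * u with hf
  have hfm : Measurable f := by fun_prop
  have hlim : ∀ v, Tendsto (fun u => f (u + v) - f u) atTop (𝓝 0) := by
    intro v
    have h1 := (hRV (Real.exp v) (Real.exp_pos v)).comp Real.tendsto_exp_atTop
    have h2 := h1.log (Real.rpow_pos_of_pos (Real.exp_pos v) ρ).ne'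
    rw [Real.log_rpow (Real.exp_pos v), Real.log_exp] at h2
    have h3 := h2.sub_const (ρ * v)
    rw [sub_self] at h3
    refine h3.congr' ?_
    have e1 := Real.tendsto_exp_atTop.eventually (eventually_ge_atTop t₁)
    have e2 := (tendsto_atTop_add_const_right atTop v tendsto_id).eventually e1
    filter_upwards [e1, e2] with u h4 h5
    rw [id] at h5
    simp only [hf, Function.comp_apply]
    rw [← Real.exp_add, Real.log_div (ht₁ _ h5) (ht₁ _ h4)]
    ring
  -- With slack `δ = -ρ` the exponent of `|A(tx)/A(t)|` lies between `2ρ` and `0`; hence `C = e²`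
  -- and any integer `K ≥ -2ρ`.
  obtain ⟨u₀, hu₀⟩ := exists_abs_add_sub_le hfm hlim (neg_pos.2 hρ)
  obtain ⟨K, hK⟩ := exists_nat_ge (2 * -ρ)
  refine ⟨Real.exp 2, max (max 1 t₁) (Real.exp u₀), K, by simp,
    (le_max_left _ _).trans (le_max_left _ _),
    fun t ht => ht₁ t (le_trans ((le_max_right _ _).trans (le_max_left _ _)) ht), ?_⟩
  intro t ht x hx
  have ht0 : 1 ≤ t := le_trans ((le_max_left _ _).trans (le_max_left _ _)) ht
  have ht1 : t₁ ≤ t := le_trans ((le_max_right _ _).trans (le_max_left _ _)) ht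
  have htu : u₀ ≤ Real.log t :=
    (Real.le_log_iff_exp_le (by linarith)).2 (le_trans (le_max_right _ _) ht)
  have hb := hu₀ _ htu (Real.log x) (Real.log_nonneg hx)
  have hx0 : 0 < x := by linarith
  have htx : t ≤ t * x := le_mul_of_one_le_right (by linarith) hx
  simp only [hf, Real.exp_add, Real.exp_log (by linarith : 0 < t), Real.exp_log hx0] at hb
  have p1 : 0 < |A t| := abs_pos.2 (ht₁ t ht1)
  have p2 : 0 < |A (t * x)| := abs_pos.2 (ht₁ _ (ht1.trans htx))
  rw [← Real.log_abs (A (t * x)), ← Real.log_abs (A t), abs_le] at hb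
  have hlx := Real.log_nonneg hx
  have hxK : x ^ K = Real.exp (K * Real.log x) := by
    rw [mul_comm, Real.exp_mul, Real.exp_log hx0, Real.rpow_natCast]
  rw [← Real.exp_log p1, ← Real.exp_log p2, hxK, ← Real.exp_add, ← Real.exp_add,
    ← Real.exp_add]
  constructor
  · rw [Real.exp_le_exp]
    linarith [hb.2]
  · rw [Real.exp_le_exp]
    nlinarith [hb.1, mul_le_mul_of_nonneg_right hK hlx]

/-- With `w = U(tx)/(U(t) x^γ) - 1 = O(A) → 0`, the logarithmic increment is `log(1 + w) = w +
o(A)`. -/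
theorem tendsto_log_sub_log_div {U A : ℝ → ℝ} {γ ρ : ℝ} (hU0 : ∀ t, 1 < t → 0 < U t)
    (hA : Tendsto A atTop (𝓝 0)) (hA0 : ∀ᶠ t in atTop, A t ≠ 0) {x : ℝ} (hx : 0 < x)
    (h : Tendsto (fun t : ℝ => (U (t * x) / U t - x ^ γ) / A t) atTop
      (𝓝 (x ^ γ * ((x ^ ρ - 1) / ρ)))) :
    Tendsto (fun t => ((Real.log (U (t * x)) - γ * Real.log (t * x))
      - (Real.log (U t) - γ * Real.log t)) / A t) atTop (𝓝 ((x ^ ρ - 1) / ρ)) := by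
  have hxγ : 0 < x ^ γ := Real.rpow_pos_of_pos hx γ
  set w : ℝ → ℝ := fun t => U (t * x) / U t / x ^ γ - 1 with hw
  have hwA : Tendsto (fun t => w t / A t) atTop (𝓝 ((x ^ ρ - 1) / ρ)) := by
    have := h.div_const (x ^ γ)
    rw [mul_div_cancel_left₀ _ hxγ.ne'] at this
    refine this.congr fun t => ?_
    simp only [hw]
    rw [div_right_comm, sub_div, div_self hxγ.ne']
  have hw0 : Tendsto w atTop (𝓝 0) := by
    have := hwA.mul hA
    rw [mul_zero] at this
    refine this.congr' ?_
    filter_upwards [hA0] with t ht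
    exact div_mul_cancel₀ _ ht
  have hwO : w =O[atTop] A :=
    isBigO_of_div_tendsto_nhds (hA0.mono fun t ht h0 => absurd h0 ht) _ hwA
  have hder : HasDerivAt (fun y => Real.log (1 + y)) 1 0 := by
    have h1 : HasDerivAt (fun y : ℝ => 1 + y) 1 0 := (hasDerivAt_id 0).const_add 1
    simpa using h1.log (by norm_num)
  have hlo : (fun t => Real.log (1 + w t) - w t) =o[atTop] w := by
    have := (hasDerivAt_iff_isLittleO.1 hder).comp_tendsto hw0
    simpa [Function.comp_def] using this
  have hl := (hlo.trans_isBigO hwO).tendsto_div_nhds_zero.add hwA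
  rw [zero_add] at hl
  refine hl.congr' ?_
  filter_upwards [eventually_gt_atTop 1, eventually_gt_atTop (1 / x)] with t ht1 htx
  have htx' : 1 < t * x := by rwa [div_lt_iff₀ hx] at htx
  have hp := hU0 _ htx'
  have hp2 := hU0 _ ht1
  rw [← add_div, sub_add_cancel]
  congr 1
  simp only [hw, add_sub_cancel]
  rw [Real.log_div (div_pos hp hp2).ne' hxγ.ne', Real.log_div hp.ne' hp2.ne', Real.log_rpow hx,
    Real.log_mul (by linarith) hx.ne']
  ring

/-- The increment of `g` from `tx` to `2tx` can be normalized by `A(t)` or by `A(tx)`. The quotient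
of the two limits is `x^ρ`, the second limit being nonzero as `ρ < 0`. -/
theorem tendsto_auxiliary_ratio {g A : ℝ → ℝ} {ρ : ℝ} (hρ : ρ < 0)
    (h : ∀ x, 0 < x → Tendsto (fun t => (g (t * x) - g t) / A t) atTop (𝓝 ((x ^ ρ - 1) / ρ)))
    (hA0 : ∀ᶠ t in atTop, A t ≠ 0) {x : ℝ} (hx : 0 < x) :
    Tendsto (fun t => A (t * x) / A t) atTop (𝓝 (x ^ ρ)) := by
  have h2 : ((2 : ℝ) ^ ρ - 1) / ρ ≠ 0 := by
    have := Real.rpow_lt_one_of_one_lt_of_neg (by norm_num : (1 : ℝ) < 2) hρ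
    exact div_ne_zero (by linarith) hρ.ne
  have htx : Tendsto (fun t : ℝ => t * x) atTop atTop := tendsto_id.atTop_mul_const hx
  have q1 := (h (x * 2) (by positivity)).sub (h x hx)
  have q2 := (h 2 (by norm_num)).comp htx
  have e : (((x * 2) ^ ρ - 1) / ρ - (x ^ ρ - 1) / ρ) / (((2 : ℝ) ^ ρ - 1) / ρ) = x ^ ρ := by
    rw [Real.mul_rpow hx.le (by norm_num), div_eq_iff h2]
    ring
  have q3 := q1.div q2 h2
  rw [e] at q3
  refine q3.congr' ?_
  filter_upwards [htx.eventually hA0, hA0, q2.eventually_ne h2] with t h3 h4 h5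
  simp only [Function.comp_apply, Pi.div_apply] at h5 ⊢
  rw [← sub_div, ← mul_assoc]
  have h6 : g (t * x * 2) - g (t * x) ≠ 0 := fun h7 => h5 (by rw [h7, zero_div])
  rw [show g (t * x * 2) - g t - (g (t * x) - g t) = g (t * x * 2) - g (t * x) by ring]
  field_simp

/-- Since `2^ρ < 1`, `|A|` decays geometrically along `t 2^j`, so the dyadic increments of `g` are
summable with sum `O(|A t|)`. The limit does not depend on `t` because `g(sx) - g(s) → 0` for fixed
`x`. -/
theorem exists_abs_sub_const_le {g A : ℝ → ℝ} {ρ : ℝ} (hρ : ρ < 0)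
    (hA : Tendsto A atTop (𝓝 0)) (hA0 : ∀ᶠ t in atTop, A t ≠ 0)
    (h : ∀ x, 0 < x → Tendsto (fun t => (g (t * x) - g t) / A t) atTop (𝓝 ((x ^ ρ - 1) / ρ))) :
    ∃ c C t₀ : ℝ, 1 ≤ t₀ ∧ ∀ t ≥ t₀, |g t - c| ≤ C * |A t| := by
  have h2r : (2 : ℝ) ^ ρ < 1 := Real.rpow_lt_one_of_one_lt_of_neg (by norm_num) hρ
  have h2p : (0 : ℝ) < 2 ^ ρ := Real.rpow_pos_of_pos (by norm_num) ρ
  obtain ⟨l, hl1, hl2⟩ := exists_between h2r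
  set C₁ : ℝ := |((2 : ℝ) ^ ρ - 1) / ρ| + 1 with hC₁
  have e1 := (tendsto_order.1 (h 2 (by norm_num)).abs).2 C₁ (by rw [hC₁]; linarith)
  have e2 := (tendsto_order.1 (tendsto_auxiliary_ratio hρ h hA0 (by norm_num : (0 : ℝ) < 2)).abs).2 l
    (by rwa [abs_of_pos h2p])
  obtain ⟨t₀, ht₀⟩ := eventually_atTop.1 ((e1.and e2).and (hA0.and (eventually_ge_atTop 1)))
  have h1t : 1 ≤ t₀ := (ht₀ t₀ le_rfl).2.2
  have hs1 : ∀ t ≥ t₀, |g (t * 2) - g t| ≤ C₁ * |A t| := fun t ht => by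
    have := (ht₀ t ht).1.1
    rw [abs_div, div_lt_iff₀ (abs_pos.2 (ht₀ t ht).2.1)] at this
    exact this.le
  have hs2 : ∀ t ≥ t₀, |A (t * 2)| ≤ l * |A t| := fun t ht => by
    have := (ht₀ t ht).1.2
    rw [abs_div, div_lt_iff₀ (abs_pos.2 (ht₀ t ht).2.1)] at this
    exact this.le
  have hge : ∀ t ≥ t₀, ∀ j : ℕ, t₀ ≤ t * 2 ^ j := fun t ht j =>
    ht.trans (le_mul_of_one_le_right (by linarith) (one_le_pow₀ (by norm_num)))
  have hAj : ∀ t ≥ t₀, ∀ j : ℕ, |A (t * 2 ^ j)| ≤ |A t| * l ^ j := by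
    intro t ht j
    induction j with
    | zero => simp
    | succ j ih =>
      have := hs2 _ (hge t ht j)
      rw [pow_succ, ← mul_assoc, pow_succ]
      nlinarith [mul_le_mul_of_nonneg_left ih (h2p.le.trans hl1.le)]
  have hC0 : 0 ≤ C₁ := by positivity
  have hdist : ∀ t ≥ t₀, ∀ j : ℕ,
      dist (g (t * 2 ^ j)) (g (t * 2 ^ (j + 1))) ≤ C₁ * |A t| * l ^ j := by
    intro t ht j
    rw [dist_comm, Real.dist_eq, pow_succ, ← mul_assoc]
    refine (hs1 _ (hge t ht j)).trans ?_
    rw [mul_assoc]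
    exact mul_le_mul_of_nonneg_left (hAj t ht j) hC0
  have hex : ∀ t ≥ t₀, ∃ c, Tendsto (fun j : ℕ => g (t * 2 ^ j)) atTop (𝓝 c) := fun t ht =>
    cauchySeq_tendsto_of_complete (cauchySeq_of_le_geometric l _ hl2 (hdist t ht))
  have htop : ∀ t ≥ t₀, Tendsto (fun j : ℕ => t * 2 ^ j) atTop atTop := fun t ht =>
    (tendsto_pow_atTop_atTop_of_one_lt (by norm_num)).const_mul_atTop (by linarith)
  obtain ⟨c, hc⟩ := hex t₀ le_rfl
  refine ⟨c, C₁ / (1 - l), t₀, h1t, fun t ht => ?_⟩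
  obtain ⟨c', hc'⟩ := hex t ht
  have hx : 0 < t / t₀ := div_pos (by linarith) (by linarith)
  have hz : Tendsto (fun s => g (s * (t / t₀)) - g s) atTop (𝓝 0) := by
    have := (h _ hx).mul hA
    rw [mul_zero] at this
    refine this.congr' ?_
    filter_upwards [hA0] with s hs
    exact div_mul_cancel₀ _ hs
  have hcc : c' = c := by
    have h3 := hz.comp (htop t₀ le_rfl)
    have h4 := hc'.sub hc
    have h5 : (fun j : ℕ => g (t * 2 ^ j) - g (t₀ * 2 ^ j))
        = (fun s => g (s * (t / t₀)) - g s) ∘ fun j : ℕ => t₀ * 2 ^ j := by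
      ext j
      simp only [Function.comp_apply]
      congr 2
      field_simp
    rw [h5] at h4
    linarith [tendsto_nhds_unique h4 h3]
  rw [hcc] at hc'
  have := dist_le_of_le_geometric_of_tendsto₀ l _ hl2 (hdist t ht) hc'
  rw [pow_zero, mul_one, Real.dist_eq] at this
  refine this.trans (le_of_eq ?_)
  ring

/-- Under the second-order condition, `log U` is `γ log y + c` up to an error of the order of `A`,
uniformly. -/
theorem exists_abs_log_sub_le {U A : ℝ → ℝ} {γ ρ : ℝ} (hρ : ρ < 0)
    (hU0 : ∀ t, 1 < t → 0 < U t) (hAm : Measurable A) (hA : Tendsto A atTop (𝓝 0))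
    (hU : ∀ x : ℝ, 0 < x → Tendsto (fun t : ℝ => (U (t * x) / U t - x ^ γ) / A t) atTop
      (𝓝 (x ^ γ * ((x ^ ρ - 1) / ρ)))) :
    ∃ (c C t₀ : ℝ) (K : ℕ), 1 ≤ C ∧ 1 ≤ t₀ ∧
      (∀ m ≥ t₀, ∀ y ≥ t₀,
        |Real.log (U y) - γ * Real.log y - c| ≤ C * |A m| * (1 + (m / y) ^ K)) ∧
      ∀ m ≥ t₀, 1 ≤ C * m ^ K * |A m| := by
  -- Division by zero yields zero, while the limit at `x = 2` is nonzero.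
  have hA0 : ∀ᶠ t in atTop, A t ≠ 0 := by
    have h2 : (2 : ℝ) ^ γ * (((2 : ℝ) ^ ρ - 1) / ρ) ≠ 0 := by
      have := Real.rpow_lt_one_of_one_lt_of_neg (by norm_num : (1 : ℝ) < 2) hρ
      exact mul_ne_zero (Real.rpow_pos_of_pos (by norm_num) _).ne'
        (div_ne_zero (by linarith) hρ.ne)
    filter_upwards [(hU 2 (by norm_num)).eventually_ne h2] with t ht h0
    rw [h0, div_zero] at ht
    exact ht rfl
  set g : ℝ → ℝ := fun t => Real.log (U t) - γ * Real.log t with hg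
  have hlim : ∀ x, 0 < x →
      Tendsto (fun t => (g (t * x) - g t) / A t) atTop (𝓝 ((x ^ ρ - 1) / ρ)) := fun x hx =>
    tendsto_log_sub_log_div hU0 hA hA0 hx (hU x hx)
  obtain ⟨c, C₁, t₁, ht₁, hc⟩ := exists_abs_sub_const_le hρ hA hA0 hlim
  obtain ⟨C₂, t₂, K, hC₂, ht₂, hne, hb⟩ := exists_potter_bounds hAm hρ hA0
    fun x hx => tendsto_auxiliary_ratio hρ hlim hA0 hx
  set t₀ := max t₁ t₂ with ht₀
  have hp0 : 0 < |A t₀| := abs_pos.2 (hne _ (le_max_right _ _))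
  have hC1 : C₂ * |C₁| ≤ max (C₂ * max |C₁| 1) (C₂ / |A t₀|) :=
    (mul_le_mul_of_nonneg_left (le_max_left _ _) (by linarith)).trans (le_max_left _ _)
  refine ⟨c, max (C₂ * max |C₁| 1) (C₂ / |A t₀|), t₀, K, ?_, ht₁.trans (le_max_left _ _), ?_, ?_⟩
  · refine le_trans ?_ (le_max_left _ _)
    exact one_le_mul_of_one_le_of_one_le hC₂ (le_max_right _ _)
  · intro m hm y hy
    have hy1 : 1 ≤ y := ht₁.trans ((le_max_left _ _).trans hy)
    have hm1 : 1 ≤ m := ht₁.trans ((le_max_left _ _).trans hm)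
    have hy0 : 0 < y := by linarith
    have hm0 : 0 < m := by linarith
    -- Replaces the error at the random point `y` by the error at the block length `m`: the upper
    -- Potter bound serves for `m ≤ y`, the lower one for `y ≤ m`.
    have h1 : |A y| ≤ C₂ * |A m| * (1 + (m / y) ^ K) := by
      have hr : 0 ≤ (m / y) ^ K := by positivity
      have hCA : 0 ≤ C₂ * |A m| := by positivity
      rcases le_total m y with hmy | hmy
      · have := (hb m ((le_max_right _ _).trans hm) (y / m) ((one_le_div (by linarith)).2 hmy)).1
        rw [mul_div_cancel₀ _ (by linarith : m ≠ 0)] at this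
        nlinarith
      · have := (hb y ((le_max_right _ _).trans hy) (m / y) ((one_le_div (by linarith)).2 hmy)).2
        rw [mul_div_cancel₀ _ (by linarith : y ≠ 0)] at this
        nlinarith
    calc |g y - c| ≤ C₁ * |A y| := hc y ((le_max_left _ _).trans hy)
      _ ≤ |C₁| * |A y| := mul_le_mul_of_nonneg_right (le_abs_self _) (abs_nonneg _)
      _ ≤ |C₁| * (C₂ * |A m| * (1 + (m / y) ^ K)) := mul_le_mul_of_nonneg_left h1 (abs_nonneg _)
      _ = C₂ * |C₁| * (|A m| * (1 + (m / y) ^ K)) := by ring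
      _ ≤ max (C₂ * max |C₁| 1) (C₂ / |A t₀|) * (|A m| * (1 + (m / y) ^ K)) :=
        mul_le_mul_of_nonneg_right hC1 (by positivity)
      _ = _ := by ring
  · intro m hm
    have ht1 : 1 ≤ t₀ := ht₁.trans (le_max_left _ _)
    have hm0 : 0 < m := by linarith
    -- The lower Potter bound between `t₀` and `m`: `|A|` decays at most polynomially. This later
    -- converts `m⁻ᴷ` into `|A m|`.
    have h1 := (hb t₀ (le_max_right _ _) (m / t₀) ((one_le_div (by linarith)).2 hm)).2
    rw [mul_div_cancel₀ _ (by linarith : t₀ ≠ 0)] at h1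
    have h2 : (m / t₀) ^ K ≤ m ^ K :=
      pow_le_pow_left₀ (div_nonneg hm0.le (by linarith)) (div_le_self hm0.le ht1) K
    have h3 : 1 ≤ C₂ / |A t₀| * m ^ K * |A m| := by
      rw [div_mul_eq_mul_div, div_mul_eq_mul_div, one_le_div hp0]
      refine h1.trans ?_
      gcongr
    refine h3.trans ?_
    have : 0 ≤ m ^ K := by positivity
    gcongr
    exact le_max_right _ _

end RegularVariation

/-! ### Generalized inverse and quantile transform. -/

section QuantileTransform

variable (μ : Measure ℝ)

/-- Right-continuity of the distribution function puts the infimum in the set; `0 < u < 1` makes the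
set bounded below and nonempty. -/
theorem genInv_le_iff {u : ℝ} (hu0 : 0 < u) (hu1 : u < 1) (x : ℝ) :
    genInv (distFun μ) u ≤ x ↔ u ≤ distFun μ x := by
  have hbdd : BddBelow {x : ℝ | u ≤ distFun μ x} := by
    obtain ⟨b, hb⟩ := eventually_atBot.1 ((tendsto_order.1 (tendsto_cdf_atBot μ)).2 u hu0)
    refine ⟨b, fun x hx => ?_⟩
    by_contra hxb
    exact absurd (hb x (not_le.1 hxb).le) (not_lt.2 hx)
  have hne : {x : ℝ | u ≤ distFun μ x}.Nonempty := by
    obtain ⟨b, hb⟩ := ((tendsto_order.1 (tendsto_cdf_atTop μ)).1 u hu1).exists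
    exact ⟨b, hb.le⟩
  constructor
  · intro h
    have key : u ≤ distFun μ (genInv (distFun μ) u) := by
      have hc : ContinuousWithinAt (cdf μ) (Set.Ioi (genInv (distFun μ) u)) _ :=
        ((cdf μ).right_continuous _).mono Set.Ioi_subset_Ici_self
      refine ge_of_tendsto hc ?_
      filter_upwards [self_mem_nhdsWithin] with y hy
      obtain ⟨w, hw, hwy⟩ := exists_lt_of_csInf_lt hne hy
      exact le_trans hw ((monotone_cdf μ) hwy.le)
    exact key.trans (monotone_cdf μ h)
  · intro h
    exact csInf_le hbdd h

theorem genInv_of_nonpos {u : ℝ} (hu : u ≤ 0) : genInv (distFun μ) u = 0 := by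
  have : {x : ℝ | u ≤ distFun μ x} = Set.univ :=
    Set.eq_univ_of_forall fun x => hu.trans (cdf_nonneg μ x)
  rw [genInv, this, Real.sInf_univ]

variable [IsProbabilityMeasure μ]

theorem one_le_genInv (hμ : ∀ᵐ x ∂μ, 1 ≤ x) {u : ℝ} (hu0 : 0 < u) (hu1 : u < 1) :
    1 ≤ genInv (distFun μ) u := by
  by_contra hlt
  rw [not_le] at hlt
  have h1 := (genInv_le_iff μ hu0 hu1 _).1 le_rfl
  have h2 : μ (Set.Iic (genInv (distFun μ) u)) = 0 := by
    refine measure_mono_null (fun x hx => ?_) (ae_iff.1 hμ)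
    exact not_le.2 (lt_of_le_of_lt hx hlt)
  have h3 : distFun μ (genInv (distFun μ) u) = 0 := by
    rw [distFun, cdf_eq_real, measureReal_def, h2, ENNReal.toReal_zero]
  linarith

theorem one_le_tailU (hμ : ∀ᵐ x ∂μ, 1 ≤ x) {t : ℝ} (ht : 1 < t) : 1 ≤ tailU μ t := by
  have h0 : 0 < 1 / t := by positivity
  have h1 : 1 / t < 1 := by rw [div_lt_one (by linarith)]; exact ht
  exact one_le_genInv μ hμ (by linarith) (by linarith)

theorem one_sub_one_div_exp (e : ℝ) : 1 - 1 / Real.exp e = 1 - Real.exp (-e) := by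
  rw [Real.exp_neg, one_div]

/-- Monotone on the whole line: for `e ≤ 0` the default value `sInf univ = 0` lies below the true
quantiles, which are at least 1. Sorting thus commutes with this map for every vector. -/
theorem monotone_tailU_exp (hμ : ∀ᵐ x ∂μ, 1 ≤ x) : Monotone fun e => tailU μ (Real.exp e) := by
  intro a b hab
  simp only [tailU, one_sub_one_div_exp]
  have hlt : ∀ e : ℝ, 1 - Real.exp (-e) < 1 := fun e => by linarith [Real.exp_pos (-e)]
  rcases le_or_gt a 0 with ha | ha
  · rw [genInv_of_nonpos μ (by linarith [Real.one_le_exp (neg_nonneg.2 ha)])]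
    rcases le_or_gt b 0 with hb | hb
    · rw [genInv_of_nonpos μ (by linarith [Real.one_le_exp (neg_nonneg.2 hb)])]
    · refine zero_le_one.trans (one_le_genInv μ hμ ?_ (hlt b))
      linarith [Real.exp_lt_one_iff.2 (neg_lt_zero.2 hb)]
  · have h1 := Real.exp_lt_one_iff.2 (neg_lt_zero.2 ha)
    have h2 := Real.exp_le_exp.2 (neg_le_neg hab)
    rw [genInv_le_iff μ (by linarith) (hlt a)]
    have := (genInv_le_iff μ (u := 1 - Real.exp (-b)) (by linarith) (hlt b) _).1 le_rfl
    linarith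

theorem expMeasure_Iic {x : ℝ} (hx : 0 ≤ x) :
    expMeasure 1 (Set.Iic x) = ENNReal.ofReal (1 - Real.exp (-x)) := by
  have := isProbabilityMeasure_expMeasure zero_lt_one
  rw [← ofReal_cdf, cdf_expMeasure_eq zero_lt_one, if_pos hx, one_mul]

theorem ae_expMeasure_pos : ∀ᵐ e ∂(expMeasure 1), 0 < e := by
  have := expMeasure_Iic le_rfl
  rw [neg_zero, Real.exp_zero, sub_self, ENNReal.ofReal_zero] at this
  rw [ae_iff]
  refine measure_mono_null (fun x hx => ?_) this
  exact not_lt.1 hx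

/-- The quantile transform of a standard exponential variable. -/
theorem map_tailU_exp (hμ : ∀ᵐ x ∂μ, 1 ≤ x) :
    (expMeasure 1).map (fun e => tailU μ (Real.exp e)) = μ := by
  have := isProbabilityMeasure_expMeasure zero_lt_one
  have hm := (monotone_tailU_exp μ hμ).measurable
  have := Measure.isProbabilityMeasure_map (μ := expMeasure 1) hm.aemeasurable
  refine Measure.ext_of_Iic _ _ fun x => ?_
  rw [Measure.map_apply hm measurableSet_Iic, ← ofReal_cdf μ]
  have hiff : ∀ e : ℝ, 0 < e →
      (tailU μ (Real.exp e) ≤ x ↔ 1 - Real.exp (-e) ≤ distFun μ x) := fun e he => by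
    rw [tailU, one_sub_one_div_exp]
    refine genInv_le_iff μ ?_ (by linarith [Real.exp_pos (-e)]) x
    linarith [Real.exp_lt_one_iff.2 (neg_lt_zero.2 he)]
  -- If `F(x) < 1`, the event is `e ≤ -log(1 - F(x))`; if `F(x) = 1`, it has full measure.
  rcases (cdf_le_one μ x).lt_or_eq with h1 | h1
  · have h0 := cdf_nonneg μ x
    have hy : 0 ≤ -Real.log (1 - cdf μ x) := by
      have := Real.log_nonpos (by linarith : 0 ≤ 1 - cdf μ x) (by linarith)
      linarith
    have he := expMeasure_Iic hy
    rw [neg_neg, Real.exp_log (by linarith), sub_sub_cancel] at he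
    rw [← he]
    refine measure_congr ?_
    filter_upwards [ae_expMeasure_pos] with e he
    refine propext ((hiff e he).trans ?_)
    change _ ↔ e ≤ -Real.log (1 - cdf μ x)
    rw [le_neg, Real.log_le_iff_le_exp (by linarith), distFun]
    constructor <;> intro h <;> linarith
  · rw [h1, ENNReal.ofReal_one, ← measure_univ (μ := expMeasure 1)]
    refine measure_congr ?_
    filter_upwards [ae_expMeasure_pos] with e he
    refine propext ⟨fun _ => trivial, fun _ => (hiff e he).2 ?_⟩
    rw [distFun, h1]
    linarith [Real.exp_pos (-e)]

end QuantileTransform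

/-! ### Sorting a vector and the law of the sorted sample. -/

section SortedVector

variable {m : ℕ}

/-- The increasing rearrangement of a vector. -/
def sortVec (x : Fin m → ℝ) : Fin m → ℝ := x ∘ Tuple.sort x

/-- The rearrangement is independent of how ties are broken, so any sorting permutation may stand
for `Tuple.sort`. -/
theorem sortVec_eq_of_monotone {x : Fin m → ℝ} {σ : Equiv.Perm (Fin m)} (h : Monotone (x ∘ σ)) :
    sortVec x = x ∘ σ :=
  (Tuple.comp_sort_eq_comp_iff_monotone.2 h).symm

theorem sortVec_comp {V : ℝ → ℝ} (hV : Monotone V) (x : Fin m → ℝ) :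
    sortVec (V ∘ x) = V ∘ sortVec x :=
  sortVec_eq_of_monotone (σ := Tuple.sort x) (hV.comp (Tuple.monotone_sort x))

theorem isClosed_setOf_monotone : IsClosed {x : Fin m → ℝ | Monotone x} := by
  have : {x : Fin m → ℝ | Monotone x} = ⋂ (i) (j) (_ : i ≤ j), {x : Fin m → ℝ | x i ≤ x j} := by
    ext x
    simp [Monotone]
  rw [this]
  exact isClosed_iInter fun i => isClosed_iInter fun j => isClosed_iInter fun _ =>
    isClosed_le (continuous_apply i) (continuous_apply j)

theorem measurable_comp_perm (σ : Equiv.Perm (Fin m)) :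
    Measurable fun x : Fin m → ℝ => x ∘ σ :=
  measurable_pi_lambda _ fun i => measurable_pi_apply (σ i)

theorem sortVec_preimage (B : Set (Fin m → ℝ)) :
    sortVec ⁻¹' B = ⋃ σ : Equiv.Perm (Fin m), (fun x : Fin m → ℝ => x ∘ σ) ⁻¹'
      ({x | Monotone x} ∩ B) := by
  ext x
  simp only [Set.mem_preimage, Set.mem_iUnion]
  constructor
  · exact fun h => ⟨Tuple.sort x, Tuple.monotone_sort x, h⟩
  · rintro ⟨σ, h1, h2⟩
    rwa [sortVec_eq_of_monotone h1]

theorem measurable_sortVec : Measurable (sortVec : (Fin m → ℝ) → Fin m → ℝ) := by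
  intro B hB
  rw [sortVec_preimage]
  exact MeasurableSet.iUnion fun σ =>
    measurable_comp_perm σ (isClosed_setOf_monotone.measurableSet.inter hB)

theorem map_comp_perm_pi (ν : Measure ℝ) [IsProbabilityMeasure ν] (σ : Equiv.Perm (Fin m)) :
    (Measure.pi fun _ : Fin m => ν).map (fun x => x ∘ σ) = Measure.pi fun _ => ν := by
  have := Measure.map_infinitePi_infinitePi_of_inj (P := fun _ : Fin m => ν) (f := σ) σ.injective
  rwa [Measure.infinitePi_eq_pi] at this

/-- The law of the increasing rearrangement of an i.i.d. sample without ties. -/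
theorem map_sortVec_pi (ν : Measure ℝ) [IsProbabilityMeasure ν]
    (hν : ∀ i j : Fin m, i ≠ j → ∀ᵐ x ∂(Measure.pi fun _ : Fin m => ν), x i ≠ x j) :
    (Measure.pi fun _ : Fin m => ν).map sortVec =
      (Fintype.card (Equiv.Perm (Fin m)) : ENNReal) •
        (Measure.pi fun _ : Fin m => ν).restrict {x | Monotone x} := by
  have hinj : ∀ᵐ x ∂(Measure.pi fun _ : Fin m => ν), Function.Injective x := by
    have : ∀ᵐ x ∂(Measure.pi fun _ : Fin m => ν), ∀ i j, i ≠ j → x i ≠ x j := by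
      rw [ae_all_iff]; intro i
      rw [ae_all_iff]; intro j
      by_cases hij : i = j
      · simp [hij]
      · filter_upwards [hν i j hij] with x hx _ using hx
    filter_upwards [this] with x hx i j hij
    by_contra h
    exact hx i j h hij
  ext B hB
  have hmB : MeasurableSet ({x : Fin m → ℝ | Monotone x} ∩ B) :=
    isClosed_setOf_monotone.measurableSet.inter hB
  -- The preimage splits over permutations: without ties the pieces are almost everywhere disjoint,
  -- and exchangeability gives them equal measure.
  rw [Measure.map_apply measurable_sortVec hB, sortVec_preimage, measure_iUnion₀, tsum_fintype]
  · simp only [Measure.smul_apply, smul_eq_mul, Measure.restrict_apply hB]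
    rw [Finset.sum_congr rfl fun σ _ => by
      rw [← Measure.map_apply (measurable_comp_perm σ) hmB, map_comp_perm_pi ν σ]]
    rw [Finset.sum_const, nsmul_eq_mul, Finset.card_univ, Set.inter_comm B]
  · intro σ τ hστ
    refine measure_mono_null ?_ (ae_iff.1 hinj)
    rintro x ⟨h1, h2⟩ hx
    refine hστ (Equiv.ext fun i => hx ?_)
    have := (sortVec_eq_of_monotone h1.1).symm.trans (sortVec_eq_of_monotone h2.1)
    exact congrFun this i
  · exact fun σ => (measurable_comp_perm σ hmB).nullMeasurableSet

end SortedVector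

/-! ### Rényi's representation of exponential order statistics. -/

section Renyi

variable {m : ℕ}

theorem integral_exponentialPDFReal_indicator {s : Set ℝ} (hs : MeasurableSet s) :
    Integrable (s.indicator (exponentialPDFReal 1)) ∧
      ENNReal.ofReal (∫ x, s.indicator (exponentialPDFReal 1) x) = expMeasure 1 s := by
  have h0 : ∀ x, 0 ≤ exponentialPDFReal 1 x := exponentialPDFReal_nonneg zero_lt_one
  have hint : Integrable (exponentialPDFReal 1) := by
    refine ⟨(measurable_exponentialPDFReal 1).aestronglyMeasurable, ?_⟩
    rw [hasFiniteIntegral_iff_ofReal (Eventually.of_forall h0)]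
    have := lintegral_exponentialPDF_eq_one zero_lt_one
    unfold exponentialPDF at this
    rw [this]
    exact ENNReal.one_lt_top
  refine ⟨hint.indicator hs, ?_⟩
  have h1 : expMeasure 1 s = ∫⁻ x in s, exponentialPDF 1 x := by
    change (volume.withDensity (exponentialPDF 1)) s = _
    rw [withDensity_apply _ hs]
  rw [h1, integral_indicator hs,
    ofReal_integral_eq_lintegral_ofReal hint.integrableOn (Eventually.of_forall h0)]
  rfl

theorem pi_expMeasure_eq_withDensity :
    Measure.pi (fun _ : Fin m => expMeasure 1) = (volume : Measure (Fin m → ℝ)).withDensity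
      (fun x => ENNReal.ofReal (∏ i, exponentialPDFReal 1 (x i))) := by
  have := isProbabilityMeasure_expMeasure zero_lt_one
  refine Measure.pi_eq fun s hs => ?_
  rw [withDensity_apply _ (MeasurableSet.univ_pi hs),
    ← lintegral_indicator (MeasurableSet.univ_pi hs)]
  have h1 : ∀ x : Fin m → ℝ, (Set.pi Set.univ s).indicator
      (fun x => ENNReal.ofReal (∏ i, exponentialPDFReal 1 (x i))) x
      = ENNReal.ofReal (∏ i, (s i).indicator (exponentialPDFReal 1) (x i)) := by
    intro x
    by_cases hx : x ∈ Set.pi Set.univ s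
    · rw [Set.indicator_of_mem hx]
      congr 1
      exact Finset.prod_congr rfl fun i _ => (Set.indicator_of_mem (hx i trivial) _).symm
    · rw [Set.indicator_of_notMem hx]
      obtain ⟨i, hi⟩ : ∃ i, x i ∉ s i := by
        by_contra hcon
        push Not at hcon
        exact hx fun i _ => hcon i
      rw [Finset.prod_eq_zero (Finset.mem_univ i) (Set.indicator_of_notMem hi _),
        ENNReal.ofReal_zero]
  simp_rw [h1]
  have hnn : ∀ i x, 0 ≤ (s i).indicator (exponentialPDFReal 1) x := fun i x =>
    Set.indicator_nonneg (fun x _ => exponentialPDFReal_nonneg zero_lt_one x) x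
  rw [← ofReal_integral_eq_lintegral_ofReal, integral_fintype_prod_volume_eq_prod
    (fun i : Fin m => (s i).indicator (exponentialPDFReal 1)),
    ENNReal.ofReal_prod_of_nonneg fun i _ => integral_nonneg (hnn i)]
  · exact Finset.prod_congr rfl fun i _ => (integral_exponentialPDFReal_indicator (hs i)).2
  · exact Integrable.fintype_prod fun i => (integral_exponentialPDFReal_indicator (hs i)).1
  · exact Eventually.of_forall fun x => Finset.prod_nonneg fun i _ => hnn i _

theorem prod_exponentialPDFReal (x : Fin m → ℝ) :
    ∏ i, exponentialPDFReal 1 (x i) = if ∀ i, 0 ≤ x i then Real.exp (-∑ i, x i) else 0 := by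
  have h1 : ∀ y : ℝ, exponentialPDFReal 1 y = if 0 ≤ y then Real.exp (-y) else 0 := by
    intro y
    simp [exponentialPDFReal, gammaPDFReal]
  simp only [h1]
  split_ifs with h
  · rw [← Finset.sum_neg_distrib, Real.exp_sum]
    exact Finset.prod_congr rfl fun i _ => if_pos (h i)
  · push Not at h
    obtain ⟨i, hi⟩ := h
    exact Finset.prod_eq_zero (Finset.mem_univ i) (if_neg (not_le.2 hi))

/-- The matrix taking normalized exponential spacings to the ordered sample, in Rényi's
representation. -/
def renyiMatrix (m : ℕ) : Matrix (Fin m) (Fin m) ℝ :=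
  Matrix.of fun i l => if l ≤ i then ((m : ℝ) - l)⁻¹ else 0

/-- Rényi's representation of the increasing order statistics of an exponential sample. -/
def renyiMap (m : ℕ) : (Fin m → ℝ) →ₗ[ℝ] (Fin m → ℝ) := Matrix.toLin' (renyiMatrix m)

theorem sub_val_pos (l : Fin m) : (0 : ℝ) < (m : ℝ) - l := by
  have : ((l : ℕ) : ℝ) < m := by exact_mod_cast l.2
  linarith

theorem renyiMap_apply (e : Fin m → ℝ) (i : Fin m) :
    renyiMap m e i = ∑ l ∈ Finset.Iic i, e l / ((m : ℝ) - l) := by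
  rw [renyiMap, Matrix.toLin'_apply, Matrix.mulVec, dotProduct, ← Finset.filter_ge_eq_Iic,
    Finset.sum_filter]
  refine Finset.sum_congr rfl fun l _ => ?_
  simp only [renyiMatrix, Matrix.of_apply]
  split_ifs
  · rw [div_eq_inv_mul]
  · rw [zero_mul]

theorem det_renyiMap_ne_zero : LinearMap.det (renyiMap m) ≠ 0 := by
  rw [renyiMap, LinearMap.det_toLin', Matrix.det_of_isLowerTriangular]
  · refine Finset.prod_ne_zero_iff.2 fun i _ => ?_
    simpa [renyiMatrix] using (sub_val_pos i).ne'
  · intro i j hij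
    have : i < j := hij
    simp [renyiMatrix, not_le.2 this]

/-- The term `e l / (m - l)` occurs in exactly `m - l` partial sums. Hence the exponent of the joint
density is preserved. -/
theorem sum_renyiMap (e : Fin m → ℝ) : ∑ i, renyiMap m e i = ∑ l, e l := by
  simp_rw [renyiMap_apply, ← Finset.filter_ge_eq_Iic, Finset.sum_filter]
  rw [Finset.sum_comm]
  refine Finset.sum_congr rfl fun l _ => ?_
  rw [← Finset.sum_filter, Finset.sum_const, Finset.filter_le_eq_Ici, Fin.card_Ici, nsmul_eq_mul,
    Nat.cast_sub l.2.le]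
  field_simp [(sub_val_pos l).ne']

/-- Up to positive factors, `e` consists of the first coordinate and successive increments of the
image, so the support of the density maps onto the cone of nonnegative increasing vectors. -/
theorem nonneg_iff_renyiMap (e : Fin m → ℝ) :
    (∀ i, 0 ≤ e i) ↔ (∀ i, 0 ≤ renyiMap m e i) ∧ Monotone (renyiMap m e) := by
  constructor
  · intro h
    have h' : ∀ l, 0 ≤ e l / ((m : ℝ) - l) := fun l => div_nonneg (h l) (sub_val_pos l).le
    refine ⟨fun i => ?_, fun i j hij => ?_⟩
    · rw [renyiMap_apply]
      exact Finset.sum_nonneg fun l _ => h' l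
    · rw [renyiMap_apply, renyiMap_apply]
      exact Finset.sum_le_sum_of_subset_of_nonneg (Finset.Iic_subset_Iic.2 hij) fun l _ _ => h' l
  · rintro ⟨h1, h2⟩ i
    have hIic : Finset.Iic i = insert i (Finset.Iio i) := by
      ext j; simp [le_iff_eq_or_lt]
    have hi : renyiMap m e i = e i / ((m : ℝ) - i) + ∑ l ∈ Finset.Iio i, e l / ((m : ℝ) - l) := by
      rw [renyiMap_apply, hIic, Finset.sum_insert (by simp)]
    have hnn : 0 ≤ e i / ((m : ℝ) - i) := by
      by_cases h0 : (i : ℕ) = 0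
      · have : Finset.Iio i = ∅ := by
          ext j
          simp only [Finset.mem_Iio, Fin.lt_def, h0]
          simp
        rw [this, Finset.sum_empty, add_zero] at hi
        rw [← hi]
        exact h1 i
      · have hlt : (i : ℕ) - 1 < m := by omega
        have : Finset.Iio i = Finset.Iic ⟨(i : ℕ) - 1, hlt⟩ := by
          ext j
          simp only [Finset.mem_Iio, Finset.mem_Iic, Fin.lt_def, Fin.le_def]
          omega
        rw [this, ← renyiMap_apply] at hi
        have h3 := h2 (show (⟨(i : ℕ) - 1, hlt⟩ : Fin m) ≤ i by simp [Fin.le_def])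
        linarith
    have := mul_nonneg hnn (sub_val_pos i).le
    rwa [div_mul_cancel₀ _ (sub_val_pos i).ne'] at this

theorem measurable_renyiMap : Measurable (renyiMap m) :=
  (renyiMap m).continuous_of_finiteDimensional.measurable

/-- Linear change of variables: sum and support of the exponential density correspond under the map,
so only the constant Jacobian and the restriction to increasing vectors remain. -/
theorem map_renyiMap_pi :
    (Measure.pi fun _ : Fin m => expMeasure 1).map (renyiMap m) =
      ENNReal.ofReal |(LinearMap.det (renyiMap m))⁻¹| •
        (Measure.pi fun _ : Fin m => expMeasure 1).restrict {x | Monotone x} := by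
  have hD : Measurable fun x : Fin m → ℝ =>
      ENNReal.ofReal (∏ i, exponentialPDFReal 1 (x i)) := by
    refine ENNReal.measurable_ofReal.comp (Finset.measurable_fun_prod _ fun i _ => ?_)
    exact (measurable_exponentialPDFReal 1).comp (measurable_pi_apply i)
  ext B hB
  have hBM := hB.inter (isClosed_setOf_monotone (m := m)).measurableSet
  rw [Measure.map_apply measurable_renyiMap hB, Measure.smul_apply, smul_eq_mul,
    Measure.restrict_apply hB, pi_expMeasure_eq_withDensity,
    withDensity_apply _ (measurable_renyiMap hB), withDensity_apply _ hBM,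
    ← lintegral_indicator (measurable_renyiMap hB), ← lintegral_indicator hBM]
  have h := lintegral_map (μ := (volume : Measure (Fin m → ℝ))) (hD.indicator hBM)
    (measurable_renyiMap (m := m))
  rw [Measure.map_linearMap_addHaar_eq_smul_addHaar _ det_renyiMap_ne_zero,
    lintegral_smul_measure, smul_eq_mul] at h
  rw [h]
  refine lintegral_congr fun e => ?_
  have hiff := nonneg_iff_renyiMap e
  by_cases hB : renyiMap m e ∈ B
  · rw [Set.indicator_of_mem (show e ∈ renyiMap m ⁻¹' B from hB)]
    by_cases hM : Monotone (renyiMap m e)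
    · rw [Set.indicator_of_mem (show renyiMap m e ∈ B ∩ {x | Monotone x} from ⟨hB, hM⟩),
        prod_exponentialPDFReal, prod_exponentialPDFReal, sum_renyiMap]
      simp only [hiff, hM, and_true]
    · rw [Set.indicator_of_notMem (fun h => hM h.2), prod_exponentialPDFReal, if_neg,
        ENNReal.ofReal_zero]
      exact fun h => hM (hiff.1 h).2
  · rw [Set.indicator_of_notMem (show e ∉ renyiMap m ⁻¹' B from hB),
      Set.indicator_of_notMem fun h => hB h.1]

theorem ae_pi_expMeasure_ne (i j : Fin m) (hij : i ≠ j) :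
    ∀ᵐ x ∂(Measure.pi fun _ : Fin m => expMeasure 1), x i ≠ x j := by
  rw [pi_expMeasure_eq_withDensity]
  refine (withDensity_absolutelyContinuous _ _).ae_le ?_
  set s : Submodule ℝ (Fin m → ℝ) :=
    LinearMap.ker (LinearMap.proj (R := ℝ) (φ := fun _ : Fin m => ℝ) i - LinearMap.proj j) with hs
  have hne : s ≠ ⊤ := by
    intro h
    have : (Pi.single i 1 : Fin m → ℝ) ∈ s := h ▸ Submodule.mem_top
    simp [hs, LinearMap.mem_ker, hij.symm] at this
  refine measure_mono_null (fun x hx => ?_) (Measure.addHaar_submodule volume s hne)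
  have hx' : x i = x j := not_not.1 hx
  simp [hs, LinearMap.mem_ker, hx']

/-- Rényi's representation: the ordered exponential sample has the law of the partial sums of
independent exponential variables divided by `m, m - 1, …, 1`. -/
theorem map_sortVec_eq_map_renyiMap :
    (Measure.pi fun _ : Fin m => expMeasure 1).map sortVec =
      (Measure.pi fun _ : Fin m => expMeasure 1).map (renyiMap m) := by
  have := isProbabilityMeasure_expMeasure zero_lt_one
  have h1 := map_sortVec_pi (m := m) (expMeasure 1) ae_pi_expMeasure_ne
  have h2 := map_renyiMap_pi (m := m)
  have p1 := Measure.isProbabilityMeasure_map (μ := Measure.pi fun _ : Fin m => expMeasure 1)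
    (measurable_sortVec (m := m)).aemeasurable
  have p2 := Measure.isProbabilityMeasure_map (μ := Measure.pi fun _ : Fin m => expMeasure 1)
    (measurable_renyiMap (m := m)).aemeasurable
  have q1 := p1.measure_univ
  have q2 := p2.measure_univ
  rw [h1, Measure.smul_apply, smul_eq_mul] at q1
  rw [h2, Measure.smul_apply, smul_eq_mul] at q2
  -- Both laws are multiples of the same restricted measure and have mass one, so the factors agree
  -- without evaluating the determinant.
  rw [h1, h2, ENNReal.eq_inv_of_mul_eq_one_left q1, ENNReal.eq_inv_of_mul_eq_one_left q2]

end Renyi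

/-! ### Equality in law of the statistic and its exponential model. -/

section Coupling

/-- The statistic as a function of the increasing rearrangements of the blocks. -/
def sortedStat {k m : ℕ} (r : ℕ) (p y : ℝ) (s : Fin k → Fin m → ℝ) : EReal :=
  let o (i : Fin k) (j : ℕ) : ℝ := if h : 1 ≤ j ∧ j ≤ m then s i ⟨m - j, by omega⟩ else 0
  logLikRatio fun ij : Fin k × Fin r =>
    ((ij.2 + 1 : ℕ) : ℝ) * (Real.log (o ij.1 (ij.2 + 1)) - Real.log (o ij.1 (ij.2 + 1 + 1)))
      - (aConst m r p)⁻¹ * (Real.log (o ij.1 (r + 1)) - y)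

theorem elStat_eq_sortedStat (x : ℕ → ℝ) (k m r : ℕ) (p y : ℝ) :
    elStat x k m r p y =
      sortedStat r p y fun (i : Fin k) => sortVec fun l : Fin m => x (i * m + l) := rfl

theorem measurable_sortedStat {k m : ℕ} (r : ℕ) (p y : ℝ) :
    Measurable (sortedStat (k := k) (m := m) r p y) := by
  have ho : ∀ (i : Fin k) (j : ℕ), Measurable fun s : Fin k → Fin m → ℝ =>
      if h : 1 ≤ j ∧ j ≤ m then s i ⟨m - j, by omega⟩ else 0 := by
    intro i j
    split_ifs with h
    · exact (measurable_pi_apply _).comp (measurable_pi_apply i)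
    · exact measurable_const
  refine measurable_logLikRatio.comp (measurable_pi_lambda _ fun ij => ?_)
  exact (((ho _ _).log.sub (ho _ _).log).const_mul _).sub (((ho _ _).log.sub_const _).const_mul _)

/-- The logarithm of the `j`-th largest standard Pareto variable of block `i`, in terms of
independent exponential variables. -/
def renyiSum (e : ℕ × ℕ → ℝ) (m i j : ℕ) : ℝ := ∑ q ∈ Finset.Icc j m, e (i, q) / q

/-- The data points of the statistic in Rényi's representation. -/
def modelPoint (V : ℝ → ℝ) (e : ℕ × ℕ → ℝ) (m r : ℕ) (p y : ℝ) (i j : ℕ) : ℝ :=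
  j * (Real.log (V (renyiSum e m i j)) - Real.log (V (renyiSum e m i (j + 1))))
    - (aConst m r p)⁻¹ * (Real.log (V (renyiSum e m i (r + 1))) - y)

/-- The statistic in Rényi's representation. -/
def modelStat (V : ℝ → ℝ) (e : ℕ × ℕ → ℝ) (k m r : ℕ) (p y : ℝ) : EReal :=
  logLikRatio fun ij : Fin k × Fin r => modelPoint V e m r p y ij.1 (ij.2 + 1)

theorem renyiMap_eq_renyiSum (e : ℕ × ℕ → ℝ) {m j : ℕ} (i : ℕ) (hj : 1 ≤ j) (hjm : j ≤ m) :
    renyiMap m (fun l => e (i, m - l)) ⟨m - j, by omega⟩ = renyiSum e m i j := by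
  rw [renyiMap_apply, renyiSum]
  refine Finset.sum_bij' (fun l _ => m - (l : ℕ))
    (fun q hq => ⟨m - q, by have := Finset.mem_Icc.1 hq; omega⟩) ?_ ?_ ?_ ?_ ?_
  · intro l hl
    have h1 : (l : ℕ) ≤ m - j := Fin.le_def.1 (Finset.mem_Iic.1 hl)
    exact Finset.mem_Icc.2 ⟨by omega, by omega⟩
  · intro q hq
    have := Finset.mem_Icc.1 hq
    refine Finset.mem_Iic.2 ?_
    rw [Fin.le_def]
    simp only
    omega
  · intro l hl
    ext
    simp only
    have := l.2
    omega
  · intro q hq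
    have := Finset.mem_Icc.1 hq
    simp only
    omega
  · intro l hl
    rw [Nat.cast_sub l.2.le]

/-- The condition `r + 1 ≤ m` keeps every order statistic in range, away from the default value 0.
-/
theorem modelStat_eq_sortedStat (V : ℝ → ℝ) (e : ℕ × ℕ → ℝ) (k : ℕ) {m r : ℕ} (hrm : r + 1 ≤ m)
    (p y : ℝ) :
    modelStat V e k m r p y =
      sortedStat r p y fun i : Fin k => V ∘ renyiMap m fun l => e (i, m - l) := by
  have ho : ∀ (i : Fin k) (j : ℕ) (hj : 1 ≤ j) (hjm : j ≤ m),
      (if h : 1 ≤ j ∧ j ≤ m then (V ∘ renyiMap m fun l => e (i, m - l)) ⟨m - j, by omega⟩ else 0)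
        = V (renyiSum e m i j) := by
    intro i j hj hjm
    rw [dif_pos ⟨hj, hjm⟩, Function.comp_apply, renyiMap_eq_renyiSum e i hj hjm]
  unfold modelStat sortedStat
  congr 1
  ext ij
  have := ij.2.2
  simp only [modelPoint]
  rw [ho _ _ (by omega) (by omega), ho _ _ (by omega) (by omega), ho _ _ (by omega) hrm]

variable {Ω ι : Type*} [MeasurableSpace Ω] {P : Measure Ω}

theorem hasLaw_blocks {μ : Measure ℝ} [IsProbabilityMeasure μ] {X : ι → Ω → ℝ}
    (hlaw : ∀ i, HasLaw (X i) μ P) (hindep : iIndepFun X P) {k m : ℕ} (g : Fin k → Fin m → ι)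
    (hg : Function.Injective fun q : Fin k × Fin m => g q.1 q.2) :
    HasLaw (fun ω i l => X (g i l) ω)
      (Measure.pi fun _ : Fin k => Measure.pi fun _ : Fin m => μ) P := by
  have h1 := (hindep.precomp hg).hasLaw_pi fun q : Fin k × Fin m => hlaw (g q.1 q.2)
  have h2 : HasLaw (MeasurableEquiv.curry (Fin k) (Fin m) ℝ)
      (Measure.pi fun _ : Fin k => Measure.pi fun _ : Fin m => μ)
      (Measure.pi fun _ : Fin k × Fin m => μ) := by
    refine ⟨(MeasurableEquiv.measurable _).aemeasurable, ?_⟩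
    have := Measure.infinitePi_map_curry (fun (_ : Fin k) (_ : Fin m) => μ)
    simpa only [Measure.infinitePi_eq_pi] using this
  exact h2.comp h1

/-- In each block the sample is the quantile transform of exponentials, the transform commutes with
sorting, and the sorted exponentials have Rényi's law; blocks are then combined as a product. -/
theorem map_sortVec_blocks {μ : Measure ℝ} [IsProbabilityMeasure μ] (hμ : ∀ᵐ x ∂μ, 1 ≤ x)
    (k m : ℕ) :
    (Measure.pi fun _ : Fin k => Measure.pi fun _ : Fin m => μ).map (fun b i => sortVec (b i)) =
      (Measure.pi fun _ : Fin k => Measure.pi fun _ : Fin m => expMeasure 1).map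
        (fun b i => (fun e => tailU μ (Real.exp e)) ∘ renyiMap m (b i)) := by
  have := isProbabilityMeasure_expMeasure zero_lt_one
  set V : ℝ → ℝ := fun e => tailU μ (Real.exp e) with hV
  have hVmono : Monotone V := monotone_tailU_exp μ hμ
  have hVm : Measurable V := hVmono.measurable
  have hVc : Measurable fun x : Fin m → ℝ => V ∘ x :=
    measurable_pi_lambda _ fun i => hVm.comp (measurable_pi_apply i)
  have hVr : Measurable fun x : Fin m → ℝ => V ∘ renyiMap m x := hVc.comp measurable_renyiMap
  have hmu : (expMeasure 1).map V = μ := map_tailU_exp μ hμ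
  have hpi : (Measure.pi fun _ : Fin m => expMeasure 1).map (fun x => V ∘ x)
      = Measure.pi fun _ : Fin m => μ := by
    have : SigmaFinite ((expMeasure 1).map V) := by rw [hmu]; infer_instance
    have h := Measure.pi_map_pi (μ := fun _ : Fin m => expMeasure 1) (f := fun _ => V)
      fun _ => hVm.aemeasurable
    simp only [hmu] at h
    exact h
  have hblock : (Measure.pi fun _ : Fin m => μ).map sortVec
      = (Measure.pi fun _ : Fin m => expMeasure 1).map (fun x => V ∘ renyiMap m x) := by
    rw [← hpi, Measure.map_map measurable_sortVec hVc]
    have h1 : sortVec ∘ (fun x : Fin m → ℝ => V ∘ x) = (fun x => V ∘ x) ∘ sortVec :=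
      funext fun x => sortVec_comp hVmono x
    rw [h1, ← Measure.map_map hVc measurable_sortVec, map_sortVec_eq_map_renyiMap,
      Measure.map_map hVc measurable_renyiMap]
    rfl
  have p1 := Measure.isProbabilityMeasure_map (μ := Measure.pi fun _ : Fin m => μ)
    (measurable_sortVec (m := m)).aemeasurable
  have p2 := Measure.isProbabilityMeasure_map (μ := Measure.pi fun _ : Fin m => expMeasure 1)
    hVr.aemeasurable
  rw [Measure.pi_map_pi (f := fun _ : Fin k => sortVec) fun _ => measurable_sortVec.aemeasurable,
    Measure.pi_map_pi (f := fun _ : Fin k => fun x : Fin m → ℝ => V ∘ renyiMap m x)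
      fun _ => hVr.aemeasurable, hblock]

theorem aemeasurable_elStat {μ : Measure ℝ} [IsProbabilityMeasure μ] {X : ℕ → Ω → ℝ}
    (hlaw : ∀ i, HasLaw (X i) μ P) (k m r : ℕ) (p y : ℝ) :
    AEMeasurable (fun ω => elStat (fun l => X l ω) k m r p y) P := by
  simp_rw [elStat_eq_sortedStat]
  refine (measurable_sortedStat r p y).comp_aemeasurable ?_
  refine aemeasurable_pi_lambda _ fun i => measurable_sortVec.comp_aemeasurable ?_
  exact aemeasurable_pi_lambda _ fun l => (hlaw _).aemeasurable

/-- The law of the statistic does not change when the sample is replaced by Rényi's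
representation. -/
theorem map_elStat_eq_map_modelStat {Ω' : Type*} [MeasurableSpace Ω'] {Q : Measure Ω'}
    {μ : Measure ℝ} [IsProbabilityMeasure μ] (hμ : ∀ᵐ x ∂μ, 1 ≤ x)
    {X : ℕ → Ω → ℝ} (hlaw : ∀ i, HasLaw (X i) μ P) (hindep : iIndepFun X P)
    {ε : ℕ × ℕ → Ω' → ℝ} (hε : ∀ q, HasLaw (ε q) (expMeasure 1) Q) (hεi : iIndepFun ε Q)
    (k : ℕ) {m r : ℕ} (hrm : r + 1 ≤ m) (p y : ℝ) :
    P.map (fun ω => elStat (fun l => X l ω) k m r p y) =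
      Q.map (fun ω => modelStat (fun e => tailU μ (Real.exp e)) (fun q => ε q ω) k m r p y) := by
  have := isProbabilityMeasure_expMeasure zero_lt_one
  simp_rw [elStat_eq_sortedStat, modelStat_eq_sortedStat _ _ k hrm]
  have hX := hasLaw_blocks hlaw hindep (fun (i : Fin k) (l : Fin m) => (i : ℕ) * m + l) (by
    rintro ⟨i, l⟩ ⟨i', l'⟩ h
    simp only at h
    have hm : 0 < m := by omega
    have h1 := congrArg (· / m) h
    have h2 := congrArg (· % m) h
    simp only [Nat.mul_add_mod_of_lt l.2, Nat.mul_add_mod_of_lt l'.2] at h2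
    simp only [Nat.add_comm _ (l : ℕ), Nat.add_comm _ (l' : ℕ), Nat.add_mul_div_right _ _ hm,
      Nat.div_eq_of_lt l.2, Nat.div_eq_of_lt l'.2, zero_add] at h1
    rw [Prod.mk.injEq, Fin.ext_iff, Fin.ext_iff]
    refine ⟨h1, ?_⟩
    rw [h1] at h
    omega)
  -- The reversed index `m - l` is Rényi's divisor, so `ε (i, q)` is the normalized spacing between
  -- ranks `q` and `q + 1`, whatever `m` is.
  have hE := hasLaw_blocks hε hεi (fun (i : Fin k) (l : Fin m) => ((i : ℕ), m - (l : ℕ))) (by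
    rintro ⟨i, l⟩ ⟨i', l'⟩ h
    simp only [Prod.mk.injEq] at h
    rw [Prod.mk.injEq, Fin.ext_iff, Fin.ext_iff]
    exact ⟨h.1, by omega⟩)
  have hs : Measurable fun (b : Fin k → Fin m → ℝ) i => sortVec (b i) :=
    measurable_pi_lambda _ fun i => measurable_sortVec.comp (measurable_pi_apply i)
  have hr : Measurable fun (b : Fin k → Fin m → ℝ) i =>
      (fun e => tailU μ (Real.exp e)) ∘ renyiMap m (b i) := by
    refine measurable_pi_lambda _ fun i => measurable_pi_lambda _ fun l => ?_
    exact (monotone_tailU_exp μ hμ).measurable.comp ((measurable_pi_apply l).comp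
      (measurable_renyiMap.comp (measurable_pi_apply i)))
  have hst := measurable_sortedStat (k := k) (m := m) r p y
  calc _ = (P.map fun ω (i : Fin k) (l : Fin m) => X ((i : ℕ) * m + l) ω).map
        (sortedStat r p y ∘ fun b i => sortVec (b i)) := by
        rw [AEMeasurable.map_map_of_aemeasurable (hst.comp hs).aemeasurable hX.aemeasurable]
        rfl
    _ = (Q.map fun ω (i : Fin k) (l : Fin m) => ε ((i : ℕ), m - (l : ℕ)) ω).map
        (sortedStat r p y ∘ fun b i => (fun e => tailU μ (Real.exp e)) ∘ renyiMap m (b i)) := by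
        rw [hX.map_eq, hE.map_eq, ← Measure.map_map hst hs, ← Measure.map_map hst hr,
          map_sortVec_blocks hμ]
    _ = _ := by
        rw [AEMeasurable.map_map_of_aemeasurable (hst.comp hr).aemeasurable hE.aemeasurable]
        rfl

end Coupling

/-! ### Convergence in probability as convergence along a filter. -/

section WithHighProbability

variable {Ω : Type*} [MeasurableSpace Ω] (P : Measure Ω)

/-- The filter on `ℕ × Ω` of the events whose probability at stage `n` tends to one. -/
def whp : Filter (ℕ × Ω) where
  sets := {S | Tendsto (fun n => P {ω | (n, ω) ∉ S}) atTop (𝓝 0)}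
  univ_sets := by simp
  sets_of_superset {S T} hS hST := by
    refine tendsto_of_tendsto_of_tendsto_of_le_of_le tendsto_const_nhds hS (fun _ => zero_le)
      fun n => measure_mono fun ω hω h => hω (hST h)
  inter_sets {S T} hS hT := by
    have h := Tendsto.add (show Tendsto _ _ _ from hS) (show Tendsto _ _ _ from hT)
    rw [add_zero] at h
    refine tendsto_of_tendsto_of_tendsto_of_le_of_le tendsto_const_nhds h (fun _ => zero_le)
      fun n => le_trans (measure_mono fun ω hω => ?_) (measure_union_le _ _)
    by_contra hcon
    simp only [Set.mem_union, Set.mem_ofPred_eq, not_or, not_not] at hcon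
    exact hω hcon

variable {P}

theorem eventually_whp {p : ℕ × Ω → Prop} :
    (∀ᶠ q in whp P, p q) ↔ Tendsto (fun n => P {ω | ¬ p (n, ω)}) atTop (𝓝 0) := Iff.rfl

/-- Lets deterministic asymptotics in `n` be combined with events of high probability. -/
theorem tendsto_fst_whp : Tendsto Prod.fst (whp P) atTop := by
  refine tendsto_atTop.2 fun N => eventually_whp.2 ?_
  refine tendsto_const_nhds.congr' ?_
  filter_upwards [eventually_ge_atTop N] with n hn
  simp [hn]

theorem eventually_whp_of_ae {p : Ω → Prop} (h : ∀ᵐ ω ∂P, p ω) : ∀ᶠ q in whp P, p q.2 :=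
  eventually_whp.2 (by simp only [ae_iff.1 h]; exact tendsto_const_nhds)

theorem eventually_whp_of_le {p : ℕ × Ω → Prop} {b : ℕ → ℝ} (hb : Tendsto b atTop (𝓝 0))
    (h : ∀ᶠ n in atTop, P {ω | ¬ p (n, ω)} ≤ ENNReal.ofReal (b n)) : ∀ᶠ q in whp P, p q := by
  have h0 := ENNReal.tendsto_ofReal hb
  rw [ENNReal.ofReal_zero] at h0
  exact eventually_whp.2 (tendsto_of_tendsto_of_tendsto_of_le_of_le' tendsto_const_nhds h0
    (Eventually.of_forall fun _ => zero_le) h)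

/-- Convergence in probability to zero from convergence of the means. -/
theorem tendsto_whp_zero_of_lintegral {Z : ℕ → Ω → ℝ} (hZ : ∀ n, AEMeasurable (Z n) P)
    (h0 : ∀ n ω, 0 ≤ Z n ω) {b : ℕ → ℝ} (hb : Tendsto b atTop (𝓝 0))
    (h : ∀ᶠ n in atTop, ∫⁻ ω, ENNReal.ofReal (Z n ω) ∂P ≤ ENNReal.ofReal (b n)) :
    Tendsto (fun q : ℕ × Ω => Z q.1 q.2) (whp P) (𝓝 0) := by
  refine Metric.tendsto_nhds.2 fun ε hε => ?_
  have hb' := hb.div_const ε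
  rw [zero_div] at hb'
  refine eventually_whp_of_le hb' ?_
  filter_upwards [h] with n hn
  have hm := mul_meas_ge_le_lintegral₀ (hZ n).ennreal_ofReal (ENNReal.ofReal ε)
  have hsub : {ω | ¬ dist (Z n ω) 0 < ε} ⊆ {ω | ENNReal.ofReal ε ≤ ENNReal.ofReal (Z n ω)} := by
    intro ω hω
    have : ¬ dist (Z n ω) 0 < ε := hω
    rw [Real.dist_eq, sub_zero, abs_of_nonneg (h0 n ω), not_lt] at this
    exact ENNReal.ofReal_le_ofReal this
  refine (measure_mono hsub).trans ?_
  rw [ENNReal.ofReal_div_of_pos hε, ENNReal.le_div_iff_mul_le (by simp [hε]) (by simp), mul_comm]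
  exact hm.trans hn

theorem tendsto_whp_zero_of_lintegral_sq {Z : ℕ → Ω → ℝ} (hZ : ∀ n, AEMeasurable (Z n) P)
    {b : ℕ → ℝ} (hb : Tendsto b atTop (𝓝 0))
    (h : ∀ᶠ n in atTop, ∫⁻ ω, ENNReal.ofReal (Z n ω ^ 2) ∂P ≤ ENNReal.ofReal (b n)) :
    Tendsto (fun q : ℕ × Ω => Z q.1 q.2) (whp P) (𝓝 0) := by
  have h1 := (tendsto_whp_zero_of_lintegral (Z := fun n ω => Z n ω ^ 2)
    (fun n => (hZ n).pow_const 2) (fun n ω => sq_nonneg _) hb h).sqrt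
  simp only [Real.sqrt_sq_eq_abs, Real.sqrt_zero] at h1
  exact (tendsto_zero_iff_abs_tendsto_zero _).2 h1

/-- The product of a sequence bounded in second moment and a sequence tending to zero in
probability tends to zero in probability. -/
theorem tendsto_whp_mul_zero {s : ℕ → Ω → ℝ} (hs : ∀ n, AEMeasurable (s n) P) {C : ℝ}
    (h : ∀ n, ∫⁻ ω, ENNReal.ofReal (s n ω ^ 2) ∂P ≤ ENNReal.ofReal C) {Z : ℕ × Ω → ℝ}
    (hZ : Tendsto Z (whp P) (𝓝 0)) :
    Tendsto (fun q : ℕ × Ω => s q.1 q.2 * Z q) (whp P) (𝓝 0) := by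
  refine Metric.tendsto_nhds.2 fun ε hε => eventually_whp.2 ?_
  rw [ENNReal.tendsto_nhds_zero]
  intro η hη
  -- Tightness: Chebyshev's inequality gives a truncation level valid for all `n`.
  obtain ⟨M, hM0, hM⟩ : ∃ M : ℝ, 0 < M ∧ ∀ n, P {ω | M ≤ |s n ω|} ≤ η / 2 := by
    have h1 : Tendsto (fun M : ℝ => ENNReal.ofReal (C / M ^ 2)) atTop (𝓝 0) := by
      rw [← ENNReal.ofReal_zero]
      exact ENNReal.tendsto_ofReal (tendsto_const_nhds.div_atTop (tendsto_pow_atTop (by norm_num)))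
    obtain ⟨M, hM1, hM0⟩ := (((ENNReal.tendsto_nhds_zero.1 h1) (η / 2)
      (ENNReal.half_pos hη.ne')).and (eventually_gt_atTop 0)).exists
    refine ⟨M, hM0, fun n => le_trans ?_ hM1⟩
    have hsq : 0 < M ^ 2 := by positivity
    have hm := mul_meas_ge_le_lintegral₀ ((hs n).pow_const 2).ennreal_ofReal (ENNReal.ofReal (M ^ 2))
    rw [ENNReal.ofReal_div_of_pos hsq, ENNReal.le_div_iff_mul_le (by simp [hM0.ne']) (by simp),
      mul_comm]
    refine le_trans ?_ (hm.trans (h n))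
    refine mul_le_mul_right (measure_mono fun ω hω => ENNReal.ofReal_le_ofReal ?_) _
    rw [← sq_abs (s n ω)]
    exact pow_le_pow_left₀ hM0.le hω 2
  have h2 := eventually_whp.1 (Metric.tendsto_nhds.1 hZ (ε / M) (by positivity))
  filter_upwards [(ENNReal.tendsto_nhds_zero.1 h2) (η / 2) (ENNReal.half_pos hη.ne')] with n hn
  have hsub : {ω | ¬ dist (s n ω * Z (n, ω)) 0 < ε} ⊆
      {ω | M ≤ |s n ω|} ∪ {ω | ¬ dist (Z (n, ω)) 0 < ε / M} := by
    intro ω hω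
    by_contra hcon
    simp only [Set.mem_union, Set.mem_ofPred_eq, not_or, not_not, not_le, Real.dist_eq,
      sub_zero] at hcon
    refine hω ?_
    simp only [Real.dist_eq, sub_zero, abs_mul]
    have := mul_lt_mul'' hcon.1 hcon.2 (abs_nonneg _) (abs_nonneg _)
    rwa [mul_div_cancel₀ _ hM0.ne'] at this
  calc _ ≤ _ := measure_mono hsub
    _ ≤ _ := measure_union_le _ _
    _ ≤ η / 2 + η / 2 := add_le_add (hM n) hn
    _ = η := ENNReal.add_halves η

variable [IsProbabilityMeasure P] {Ω' : Type*} [MeasurableSpace Ω'] {P' : Measure Ω'}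
  [IsProbabilityMeasure P']

/-- Sequences that agree with probability tending to one have the same limit in distribution. -/
theorem tendstoInDistribution_of_eventually_whp_eq {E : Type*} [TopologicalSpace E]
    [MeasurableSpace E] [OpensMeasurableSpace E] {X Y : ℕ → Ω → E} {Z : Ω' → E}
    (hX : TendstoInDistribution X atTop Z (fun _ => P) P') (hY : ∀ n, AEMeasurable (Y n) P)
    (hXY : ∀ᶠ q in whp P, X q.1 q.2 = Y q.1 q.2) :
    TendstoInDistribution Y atTop Z (fun _ => P) P' := by
  refine ⟨hY, hX.aemeasurable_limit, ?_⟩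
  have hXt := ProbabilityMeasure.tendsto_iff_forall_integral_tendsto.1 hX.tendsto
  refine ProbabilityMeasure.tendsto_iff_forall_integral_tendsto.2 ?_
  intro f
  have hd : Tendsto (fun n => ∫ ω, f (Y n ω) ∂P - ∫ ω, f (X n ω) ∂P) atTop (𝓝 0) := by
    have h1 := eventually_whp.1 hXY
    have h2 : Tendsto (fun n => 2 * ‖f‖ * (P {ω | ¬ X n ω = Y n ω}).toReal) atTop (𝓝 0) := by
      have := ((ENNReal.tendsto_toReal ENNReal.zero_ne_top).comp h1).const_mul (2 * ‖f‖)
      simpa using this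
    refine squeeze_zero_norm (fun n => ?_) h2
    have hfm : Measurable f := f.continuous.measurable
    have hint : ∀ {T : Ω → E}, AEMeasurable T P → Integrable (fun ω => f (T ω)) P := fun hT =>
      Integrable.of_bound (hfm.comp_aemeasurable hT).aestronglyMeasurable ‖f‖
        (Eventually.of_forall fun ω => f.norm_coe_le_norm _)
    -- The disagreement event need not be measurable, so it is replaced by a measurable hull of the
    -- same measure.
    rw [← integral_sub (hint (hY n)) (hint (hX.forall_aemeasurable n)),
      ← measure_toMeasurable {ω | ¬ X n ω = Y n ω}]
    set S := toMeasurable P {ω | ¬ X n ω = Y n ω} with hS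
    have hSm : MeasurableSet S := measurableSet_toMeasurable _ _
    have hb : ∀ ω, ‖f (Y n ω) - f (X n ω)‖ ≤ S.indicator (fun _ => 2 * ‖f‖) ω := by
      intro ω
      by_cases hω : ω ∈ S
      · rw [Set.indicator_of_mem hω]
        refine (norm_sub_le _ _).trans ?_
        linarith [f.norm_coe_le_norm (Y n ω), f.norm_coe_le_norm (X n ω)]
      · have : X n ω = Y n ω := by
          by_contra hne
          exact hω (subset_toMeasurable P _ hne)
        rw [Set.indicator_of_notMem hω, this, sub_self, norm_zero]
    refine (norm_integral_le_of_norm_le ((integrable_const _).indicator hSm)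
      (Eventually.of_forall hb)).trans (le_of_eq ?_)
    rw [integral_indicator hSm, setIntegral_const, smul_eq_mul, mul_comm, measureReal_def]
  have hsum := hd.add (hXt f)
  rw [zero_add] at hsum
  have hm : ∀ {T : Ω → E}, AEMeasurable T P →
      ∫ x, f x ∂(P.map T) = ∫ ω, f (T ω) ∂P := fun hT =>
    integral_map hT f.continuous.measurable.aestronglyMeasurable
  refine hsum.congr fun n => ?_
  simp only [ProbabilityMeasure.coe_mk, hm (hY n), hm (hX.forall_aemeasurable n)]
  ring

/-- Slutsky's lemma for extended-real statistics that are finite with probability tending to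
one. -/
theorem tendstoInDistribution_coe_ereal {L : ℕ → Ω → EReal} {T : ℕ → Ω → ℝ} {W : Ω' → ℝ}
    (hT : TendstoInDistribution T atTop W (fun _ => P) P') (hL : ∀ n, AEMeasurable (L n) P)
    (hfin : ∀ᶠ q in whp P, L q.1 q.2 = ((L q.1 q.2).toReal : EReal))
    (hLT : Tendsto (fun q : ℕ × Ω => (L q.1 q.2).toReal - T q.1 q.2) (whp P) (𝓝 0)) :
    TendstoInDistribution L atTop (fun ω => (W ω : EReal)) (fun _ => P) P' := by
  have hLr : ∀ n, AEMeasurable (fun ω => (L n ω).toReal) P := fun n =>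
    measurable_ereal_toReal.comp_aemeasurable (hL n)
  have h1 : TendstoInDistribution (fun n ω => (L n ω).toReal) atTop W (fun _ => P) P' := by
    refine tendstoInDistribution_of_tendstoInMeasure_sub _ _ hT ?_ hLr
    refine tendstoInMeasure_iff_norm.2 fun ε hε => ?_
    refine (eventually_whp.1 (Metric.tendsto_nhds.1 hLT ε hε)).congr fun n => ?_
    simp
  have h2 := h1.continuous_comp continuous_coe_real_ereal
  exact tendstoInDistribution_of_eventually_whp_eq h2 hL
    (hfin.mono fun q hq => hq.symm)

end WithHighProbability

/-! ### The statistic as a perturbed quadratic form. -/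

section QuadraticApproximation

/-- The quadratic approximation of the statistic along a filter, for data `γ (e + d)` with
negligible perturbations `d`. -/
theorem tendsto_logLikRatio_sub_sq {α : Type*} {F : Filter α} {r : ℕ} (hr : 1 ≤ r) {γ : ℝ}
    (hγ : 0 < γ) {κ : α → ℕ} (hκ : Tendsto κ F atTop) (e d : ∀ q, Fin (κ q) × Fin r → ℝ)
    (z : ∀ q, Fin (κ q) × Fin r → ℝ) (hz : ∀ q i, z q i = γ * (e q i + d q i))
    (hd1 : Tendsto (fun q => (∑ i, d q i) / √(κ q)) F (𝓝 0))
    (hd2 : Tendsto (fun q => (∑ i, d q i ^ 2) / κ q) F (𝓝 0))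
    (he2 : Tendsto (fun q => (∑ i, e q i ^ 2) / κ q) F (𝓝 r))
    (he4 : Tendsto (fun q => (∑ i, e q i ^ 4) / (κ q : ℝ) ^ 2) F (𝓝 0))
    {s : α → ℝ} (hs : ∀ q, ∑ i, e q i = √(κ q) * (√r * s q))
    (hst : ∀ Z : α → ℝ, Tendsto Z F (𝓝 0) → Tendsto (fun q => s q * Z q) F (𝓝 0)) :
    (∀ᶠ q in F, logLikRatio (z q) = ((logLikRatio (z q)).toReal : EReal)) ∧
      Tendsto (fun q => (logLikRatio (z q)).toReal - s q ^ 2) F (𝓝 0) := by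
  have hr0 : (0 : ℝ) < r := by exact_mod_cast hr
  set D1 : α → ℝ := fun q => (∑ i, d q i) / √(κ q) with hD1
  set D2 : α → ℝ := fun q => (∑ i, d q i ^ 2) / κ q with hD2
  set E2 : α → ℝ := fun q => (∑ i, e q i ^ 2) / κ q with hE2
  set E4 : α → ℝ := fun q => (∑ i, e q i ^ 4) / (κ q : ℝ) ^ 2 with hE4
  set w : α → ℝ := fun q => √r * s q + D1 q with hw
  -- Bounds `max |e + d| / √κ`: the maximum of `|e|` is at most the `ℓ⁴` norm, that of `|d|` at most
  -- the `ℓ²` norm.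
  set η : α → ℝ := fun q => √(√(E4 q)) + √(D2 q) with hη
  set v : α → ℝ := fun q => (∑ i, (e q i + d q i) ^ 2) / κ q with hv
  have hκ0 : ∀ᶠ q in F, (0 : ℝ) < κ q :=
    (hκ.eventually (eventually_gt_atTop 0)).mono fun q hq => by exact_mod_cast hq
  have hηlim : Tendsto η F (𝓝 0) := by simpa using he4.sqrt.sqrt.add hd2.sqrt
  have hvlim : Tendsto v F (𝓝 r) := by
    have hb : Tendsto (fun q => 2 * √(E2 q * D2 q) + D2 q) F (𝓝 0) := by
      simpa using ((he2.mul hd2).sqrt.const_mul 2).add hd2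
    have hdiff : Tendsto (fun q => v q - E2 q) F (𝓝 0) := by
      refine squeeze_zero_norm' ?_ hb
      filter_upwards [hκ0] with q hq
      -- Cauchy–Schwarz removes the cross term of `∑ (e + d)²`.
      have hcs := Real.sum_mul_le_sqrt_mul_sqrt Finset.univ (fun i => |e q i|) fun i => |d q i|
      simp only [sq_abs] at hcs
      have hx : |(∑ i, e q i * d q i) / κ q| ≤ √(E2 q * D2 q) := by
        rw [abs_div, abs_of_pos hq, div_le_iff₀ hq]
        have h1 : √(E2 q * D2 q) * κ q = √(∑ i, e q i ^ 2) * √(∑ i, d q i ^ 2) := by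
          rw [← Real.sqrt_mul (Finset.sum_nonneg fun i _ => sq_nonneg _), hE2, hD2]
          simp only
          rw [div_mul_div_comm, Real.sqrt_div' _ (by positivity), Real.sqrt_mul_self hq.le,
            div_mul_cancel₀ _ hq.ne']
        rw [h1]
        refine ((Finset.abs_sum_le_sum_abs _ _).trans (le_of_eq ?_)).trans hcs
        exact Finset.sum_congr rfl fun i _ => abs_mul _ _
      have hD0 : 0 ≤ D2 q := div_nonneg (Finset.sum_nonneg fun i _ => sq_nonneg _) hq.le
      have : v q - E2 q = 2 * ((∑ i, e q i * d q i) / κ q) + D2 q := by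
        simp only [hv, hE2, hD2]
        rw [← sub_div, ← mul_div_assoc, ← add_div, ← Finset.sum_sub_distrib, Finset.mul_sum,
          ← Finset.sum_add_distrib]
        congr 1
        exact Finset.sum_congr rfl fun i _ => by ring
      rw [this, Real.norm_eq_abs]
      refine (abs_add_le _ _).trans ?_
      rw [abs_mul, abs_two, abs_of_nonneg hD0]
      linarith
    have := hdiff.add he2
    simpa using this
  -- Boundedness in probability of `s` enters only as the property of preserving null families under
  -- multiplication. It passes to `w`, and iterating it handles `w³ η`.
  have hwt : ∀ Z : α → ℝ, Tendsto Z F (𝓝 0) → Tendsto (fun q => w q * Z q) F (𝓝 0) := by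
    intro Z hZ
    have := ((hst Z hZ).const_mul √r).add (hd1.mul hZ)
    simp only [mul_zero, add_zero] at this
    refine this.congr fun q => ?_
    simp only [hw]; ring
  have hwη := hwt η hηlim
  have hw3 := hwt _ (hwt _ hwη)
  have hδ : Tendsto (fun q => |w q * η q| / v q) F (𝓝 0) := by
    have := hwη.abs.div hvlim hr0.ne'
    rw [abs_zero, zero_div] at this
    exact this
  have hTδ : Tendsto (fun q => 48 * (w q ^ 2 / v q) * (|w q * η q| / v q)) F (𝓝 0) := by
    have := (hw3.abs.div (hvlim.mul hvlim) (mul_pos hr0 hr0).ne').const_mul 48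
    simp only [abs_zero, zero_div, mul_zero] at this
    refine this.congr fun q => ?_
    simp only [Pi.div_apply]
    rw [abs_mul, abs_mul (w q), ← mul_assoc |w q|, abs_mul_abs_self, mul_assoc 48,
      div_mul_div_comm (w q ^ 2), sq]
  have hTs : Tendsto (fun q => w q ^ 2 / v q - s q ^ 2) F (𝓝 0) := by
    have h1 : Tendsto (fun q => (r : ℝ) - v q) F (𝓝 0) := by
      simpa using (tendsto_const_nhds (x := (r : ℝ))).sub hvlim
    have h2 := (((hst _ (hst _ h1)).add ((hst _ hd1).const_mul (2 * √r))).add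
      (hd1.mul hd1)).div hvlim hr0.ne'
    simp only [mul_zero, add_zero, zero_div] at h2
    refine h2.congr' ?_
    filter_upwards [hvlim.eventually_ne hr0.ne'] with q hq
    simp only [Pi.div_apply, hw]
    rw [eq_sub_iff_add_eq, div_add' _ _ _ hq]
    congr 1
    have := Real.sq_sqrt hr0.le
    linear_combination (-(s q) ^ 2) * this
  have key : ∀ᶠ q in F, ∃ L : ℝ, logLikRatio (z q) = (L : EReal) ∧
      |L - w q ^ 2 / v q| ≤ 48 * (w q ^ 2 / v q) * (|w q * η q| / v q) := by
    filter_upwards [hκ0, hvlim.eventually (eventually_gt_nhds hr0),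
      hδ.eventually (eventually_le_nhds (by norm_num : (0 : ℝ) < 1 / 4))] with q hq hvq hδq
    have hsq : 0 < √(κ q : ℝ) := Real.sqrt_pos.2 hq
    have hsqq : √(κ q : ℝ) * √(κ q : ℝ) = κ q := Real.mul_self_sqrt hq.le
    have hS : ∑ i, z q i = γ * (√(κ q) * w q) := by
      simp only [hz, ← Finset.mul_sum, Finset.sum_add_distrib, hs, hw, hD1]
      field_simp
    have hV : ∑ i, z q i ^ 2 = γ ^ 2 * (κ q * v q) := by
      simp only [hz, mul_pow, ← Finset.mul_sum, hv]
      field_simp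
    have hVpos : 0 < ∑ i, z q i ^ 2 := by rw [hV]; positivity
    have hη0 : 0 ≤ η q := by positivity
    have hM : ∀ i, |z q i| ≤ γ * (√(κ q) * η q) := by
      intro i
      rw [hz, abs_mul, abs_of_pos hγ]
      refine mul_le_mul_of_nonneg_left ((abs_add_le _ _).trans ?_) hγ.le
      rw [hη, mul_add]
      refine add_le_add ?_ ?_
      · have h4 : e q i ^ 4 ≤ ∑ i, e q i ^ 4 :=
          Finset.single_le_sum (f := fun i => e q i ^ 4) (fun j _ => by positivity)
            (Finset.mem_univ i)
        have h5 : |e q i| ^ 2 ≤ κ q * √(E4 q) := by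
          rw [sq_abs]
          refine abs_le_of_sq_le_sq' ?_ (by positivity) |>.2
          rw [mul_pow, Real.sq_sqrt (by positivity)]
          simp only [hE4]
          rw [mul_div_cancel₀ _ (by positivity)]
          nlinarith
        refine abs_le_of_sq_le_sq' ?_ (by positivity) |>.2
        rw [mul_pow, Real.sq_sqrt hq.le, Real.sq_sqrt (by positivity)]
        exact h5
      · have h4 : d q i ^ 2 ≤ ∑ i, d q i ^ 2 :=
          Finset.single_le_sum (f := fun i => d q i ^ 2) (fun j _ => by positivity)
            (Finset.mem_univ i)
        refine abs_le_of_sq_le_sq' ?_ (by positivity) |>.2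
        rw [mul_pow, Real.sq_sqrt hq.le, Real.sq_sqrt (by positivity), sq_abs]
        simp only [hD2]
        rw [mul_div_cancel₀ _ hq.ne']
        exact h4
    have hMS : γ * (√(κ q) * η q) * |∑ i, z q i| / ∑ i, z q i ^ 2 = |w q * η q| / v q := by
      rw [hS, hV, abs_mul, abs_mul, abs_of_pos hγ, abs_of_pos hsq, abs_mul, abs_of_nonneg hη0]
      rw [show γ * (√(κ q) * η q) * (γ * (√(κ q) * |w q|))
        = (γ ^ 2 * (√(κ q : ℝ) * √(κ q : ℝ))) * (|w q| * η q) by ring, hsqq, ← mul_assoc (γ ^ 2),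
        mul_div_mul_left _ _ (by positivity)]
    have hSV : (∑ i, z q i) ^ 2 / ∑ i, z q i ^ 2 = w q ^ 2 / v q := by
      rw [hS, hV]
      rw [show (γ * (√(κ q) * w q)) ^ 2 = (γ ^ 2 * (√(κ q : ℝ) * √(κ q : ℝ))) * w q ^ 2 by ring,
        hsqq, ← mul_assoc (γ ^ 2), mul_div_mul_left _ _ (by positivity)]
    have h4 : 4 * (γ * (√(κ q) * η q)) * |∑ i, z q i| ≤ ∑ i, z q i ^ 2 := by
      rw [← hMS, div_le_iff₀ hVpos] at hδq
      linarith
    have := exists_logLikRatio_eq_abs_sub_le (z q) hM hVpos h4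
    rwa [hSV, hMS] at this
  refine ⟨key.mono fun q ⟨L, hL, _⟩ => by rw [hL, EReal.toReal_coe], ?_⟩
  have h1 : Tendsto (fun q => (logLikRatio (z q)).toReal - w q ^ 2 / v q) F (𝓝 0) := by
    refine squeeze_zero_norm' ?_ hTδ
    filter_upwards [key] with q ⟨L, hL, hb⟩
    rw [hL, EReal.toReal_coe, Real.norm_eq_abs]
    exact hb
  have := h1.add hTs
  simpa using this

end QuadraticApproximation

/-! ### Moments and Laplace transform of the exponential law. -/

section ExponentialMoments

instance isProbabilityMeasure_expMeasure_one : IsProbabilityMeasure (expMeasure 1) :=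
  isProbabilityMeasure_expMeasure zero_lt_one

theorem expMeasure_one_eq_withDensity :
    expMeasure 1 = ((volume : Measure ℝ).restrict (Set.Ioi 0)).withDensity
      fun x => ENNReal.ofReal (Real.exp (-x)) := by
  have h1 : expMeasure 1 = (volume : Measure ℝ).withDensity
      ((Set.Ici 0).indicator fun x => ENNReal.ofReal (Real.exp (-x))) := by
    change volume.withDensity (exponentialPDF 1) = _
    congr 1
    ext x
    rw [exponentialPDF_eq, Set.indicator_apply]
    simp only [one_mul, Set.mem_Ici]
    split_ifs <;> simp
  rw [h1, withDensity_indicator measurableSet_Ici, Measure.restrict_congr_set Ioi_ae_eq_Ici]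

theorem integrable_expMeasure_iff {f : ℝ → ℝ} :
    Integrable f (expMeasure 1) ↔ IntegrableOn (fun x => Real.exp (-x) * f x) (Set.Ioi 0) := by
  rw [expMeasure_one_eq_withDensity, integrable_withDensity_iff_integrable_smul' (by fun_prop)
    (Eventually.of_forall fun _ => ENNReal.ofReal_lt_top)]
  simp [IntegrableOn, ENNReal.toReal_ofReal (Real.exp_pos _).le]

theorem integral_expMeasure (f : ℝ → ℝ) :
    ∫ x, f x ∂(expMeasure 1) = ∫ x in Set.Ioi 0, Real.exp (-x) * f x := by
  rw [expMeasure_one_eq_withDensity, integral_withDensity_eq_integral_toReal_smul (by fun_prop)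
    (Eventually.of_forall fun _ => ENNReal.ofReal_lt_top)]
  simp [ENNReal.toReal_ofReal (Real.exp_pos _).le]

theorem integrable_pow_expMeasure (n : ℕ) : Integrable (fun x => x ^ n) (expMeasure 1) := by
  rw [integrable_expMeasure_iff]
  have := Real.GammaIntegral_convergent (s := n + 1) (by positivity)
  simpa using this

theorem integral_pow_expMeasure (n : ℕ) : ∫ x, x ^ n ∂(expMeasure 1) = n.factorial := by
  rw [integral_expMeasure, ← Real.Gamma_nat_eq_factorial, Real.Gamma_eq_integral (by positivity)]
  simp

theorem integrable_sub_one_pow_expMeasure (n : ℕ) :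
    Integrable (fun x => (x - 1) ^ n) (expMeasure 1) := by
  simp_rw [sub_eq_add_neg, add_pow]
  exact integrable_finsetSum _ fun i _ => ((integrable_pow_expMeasure i).mul_const _).mul_const _

theorem integral_sub_one_expMeasure : ∫ x, (x - 1) ∂(expMeasure 1) = 0 := by
  have h1 := integral_pow_expMeasure 1
  have i1 := integrable_pow_expMeasure 1
  simp only [pow_one, Nat.factorial_one, Nat.cast_one] at h1 i1
  rw [integral_sub i1 (integrable_const 1), h1]
  simp

theorem integral_sub_one_sq_expMeasure : ∫ x, (x - 1) ^ 2 ∂(expMeasure 1) = 1 := by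
  have h1 := integral_pow_expMeasure 1
  have i1 := integrable_pow_expMeasure 1
  have h2 := integral_pow_expMeasure 2
  have i2 := integrable_pow_expMeasure 2
  simp only [pow_one, Nat.factorial_one, Nat.cast_one] at h1 i1
  have : ∀ x : ℝ, (x - 1) ^ 2 = x ^ 2 - 2 * x + 1 := fun x => by ring
  simp_rw [this]
  have i3 : Integrable (fun x : ℝ => x ^ 2 - 2 * x) (expMeasure 1) := i2.sub (i1.const_mul 2)
  rw [integral_add i3 (integrable_const 1), integral_sub i2 (i1.const_mul 2),
    integral_const_mul, h1, h2]
  simp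

theorem lintegral_exp_neg_mul_expMeasure {t : ℝ} (ht : 0 ≤ t) :
    ∫⁻ x, ENNReal.ofReal (Real.exp (-(t * x))) ∂(expMeasure 1) = ENNReal.ofReal (1 / (1 + t)) := by
  have he : ∀ x : ℝ, Real.exp (-x) * Real.exp (-(t * x)) = Real.exp (-(1 + t) * x) := fun x => by
    rw [← Real.exp_add]; ring_nf
  have hneg : -(1 + t) < 0 := by linarith
  have hint : Integrable (fun x => Real.exp (-(t * x))) (expMeasure 1) := by
    rw [integrable_expMeasure_iff]
    simp_rw [he]
    exact integrableOn_exp_mul_Ioi hneg 0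
  rw [← ofReal_integral_eq_lintegral_ofReal hint (Eventually.of_forall fun x => (Real.exp_pos _).le),
    integral_expMeasure]
  simp_rw [he]
  rw [integral_exp_mul_Ioi hneg, mul_zero, Real.exp_zero, neg_div_neg_eq]

end ExponentialMoments

/-! ### Moments of independent sums and inverse moments of order statistics. -/

section IndependentSums

variable {Ω ι : Type*} [MeasurableSpace Ω] {Q : Measure Ω} {ν : Measure ℝ}

/-- The second moment of a linear combination of centered i.i.d. variables. -/
theorem lintegral_sum_sq [IsProbabilityMeasure Q] {Y : ι → Ω → ℝ}
    (hY : ∀ i, HasLaw (Y i) ν Q) (hYi : iIndepFun Y Q) {f : ℝ → ℝ} (hf : Measurable f)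
    (hf2 : Integrable (fun x => f x ^ 2) ν) (hf0 : ∫ x, f x ∂ν = 0) (s : Finset ι) (c : ι → ℝ) :
    ∫⁻ ω, ENNReal.ofReal ((∑ i ∈ s, c i * f (Y i ω)) ^ 2) ∂Q
      = ENNReal.ofReal ((∑ i ∈ s, c i ^ 2) * ∫ x, f x ^ 2 ∂ν) := by
  have hfY : ∀ i, MemLp (fun ω => f (Y i ω)) 2 Q := by
    intro i
    have hae : AEStronglyMeasurable (fun ω => f (Y i ω)) Q :=
      (hf.comp_aemeasurable (hY i).aemeasurable).aestronglyMeasurable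
    rw [memLp_two_iff_integrable_sq hae]
    rw [← (hY i).map_eq] at hf2
    exact hf2.comp_aemeasurable (hY i).aemeasurable
  have hcfY : ∀ i, MemLp (fun ω => c i * f (Y i ω)) 2 Q := fun i => (hfY i).const_mul (c i)
  have hint : ∀ i, ∫ ω, f (Y i ω) ∂Q = 0 := fun i => by
    rw [← hf0]
    exact (hY i).integral_comp hf.aestronglyMeasurable
  have hvar : ∀ i, Var[fun ω => f (Y i ω); Q] = ∫ x, f x ^ 2 ∂ν := fun i => by
    rw [variance_of_integral_eq_zero (hfY i).aestronglyMeasurable.aemeasurable (hint i)]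
    exact (hY i).integral_comp (f := fun x => f x ^ 2) (hf.pow_const 2).aestronglyMeasurable
  have hsum : MemLp (∑ i ∈ s, fun ω => c i * f (Y i ω)) 2 Q := memLp_finsetSum' s fun i _ => hcfY i
  have hind : Set.Pairwise (s : Set ι) fun i j =>
      (fun ω => c i * f (Y i ω)) ⟂ᵢ[Q] fun ω => c j * f (Y j ω) := fun i _ j _ hij =>
    (hYi.indepFun hij).comp (φ := fun x => c i * f x) (ψ := fun x => c j * f x)
      (hf.const_mul _) (hf.const_mul _)
  have hV := IndepFun.variance_sum (fun i _ => hcfY i) hind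
  simp only [variance_const_mul, hvar, ← Finset.sum_mul] at hV
  have h0 : ∫ ω, (∑ i ∈ s, fun ω => c i * f (Y i ω)) ω ∂Q = 0 := by
    simp only [Finset.sum_apply]
    rw [integral_finsetSum _ fun i _ => (hcfY i).integrable (by norm_num)]
    simp [integral_const_mul, hint]
  rw [variance_of_integral_eq_zero hsum.aestronglyMeasurable.aemeasurable h0] at hV
  rw [← hV, ofReal_integral_eq_lintegral_ofReal hsum.integrable_sq
    (Eventually.of_forall fun ω => sq_nonneg _)]
  simp only [Finset.sum_apply]

theorem prod_div_add_mul_factorial (r K : ℕ) {m : ℕ} (hm : r ≤ m) :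
    (∏ q ∈ Finset.Ioc r m, ((q : ℝ) / (q + K))) * ((m + K).factorial * r.factorial) =
      m.factorial * (r + K).factorial := by
  induction m, hm using Nat.le_induction with
  | base => simp; ring
  | succ m hm ih =>
    rw [Finset.prod_Ioc_succ_top (by omega), show m + 1 + K = (m + K) + 1 by ring,
      Nat.factorial_succ (m + K), Nat.factorial_succ m]
    push_cast
    have : ((m : ℝ) + 1 + K) ≠ 0 := by positivity
    field_simp
    linear_combination ((m : ℝ) + 1 + K) * ih

/-- The product telescopes to `m! (r+K)! / ((m+K)! r!)`, and `m! m^K ≤ (m+K)!` gives a bound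
independent of `m`. -/
theorem pow_mul_prod_div_add_le (r K : ℕ) {m : ℕ} (hm : r ≤ m) :
    (m : ℝ) ^ K * ∏ q ∈ Finset.Ioc r m, ((q : ℝ) / (q + K)) ≤ (r + K).factorial := by
  have h := prod_div_add_mul_factorial r K hm
  have h1 : (m.factorial : ℝ) * (m : ℝ) ^ K ≤ (m + K).factorial := by
    have h2 : m.factorial * (m + 1) ^ K ≤ (m + K).factorial := Nat.factorial_mul_pow_le_factorial
    have h3 : m.factorial * m ^ K ≤ m.factorial * (m + 1) ^ K :=
      Nat.mul_le_mul_left _ (Nat.pow_le_pow_left (Nat.le_succ m) K)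
    exact_mod_cast h3.trans h2
  have hr1 : (1 : ℝ) ≤ r.factorial := by exact_mod_cast Nat.succ_le_of_lt r.factorial_pos
  have hm0 : (0 : ℝ) < m.factorial := by exact_mod_cast m.factorial_pos
  have hP : 0 ≤ ∏ q ∈ Finset.Ioc r m, ((q : ℝ) / (q + K)) :=
    Finset.prod_nonneg fun q _ => by positivity
  set Pm := ∏ q ∈ Finset.Ioc r m, ((q : ℝ) / (q + K))
  refine le_of_mul_le_mul_left ?_ hm0
  calc (m.factorial : ℝ) * ((m : ℝ) ^ K * Pm) = Pm * (m.factorial * (m : ℝ) ^ K * 1) := by ring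
    _ ≤ Pm * ((m + K).factorial * r.factorial) := by gcongr
    _ = _ := h

/-- Inverse moments of the `(r + 1)`-th largest of `m` standard Pareto variables. -/
theorem lintegral_exp_neg_mul_renyiSum_le {ε : ℕ × ℕ → Ω → ℝ} (hm : ∀ q, Measurable (ε q))
    (hε : ∀ q, HasLaw (ε q) (expMeasure 1) Q) (hεi : iIndepFun ε Q) (i r K : ℕ) {m : ℕ}
    (hrm : r ≤ m) :
    ∫⁻ ω, ENNReal.ofReal ((m * Real.exp (-renyiSum (fun q => ε q ω) m i (r + 1))) ^ K) ∂Q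
      ≤ ENNReal.ofReal (r + K).factorial := by
  have hIcc : Finset.Icc (r + 1) m = Finset.Ioc r m := by
    ext; simp
  -- The moment factors by independence into Laplace transforms at `K/q`, each equal to `q/(q + K)`.
  have h1 : ∀ ω, ENNReal.ofReal ((m * Real.exp (-renyiSum (fun q => ε q ω) m i (r + 1))) ^ K)
      = ENNReal.ofReal ((m : ℝ) ^ K) * ∏ q ∈ Finset.Ioc r m,
          ENNReal.ofReal (Real.exp (-(((K : ℝ) / q) * ε (i, q) ω))) := by
    intro ω
    rw [mul_pow, ENNReal.ofReal_mul (by positivity),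
      ← ENNReal.ofReal_prod_of_nonneg fun q _ => (Real.exp_pos _).le, ← Real.exp_sum,
      ← Real.exp_nat_mul]
    congr 3
    rw [renyiSum, hIcc, Finset.sum_neg_distrib, mul_neg, Finset.mul_sum]
    congr 1
    exact Finset.sum_congr rfl fun q _ => by ring
  simp_rw [h1]
  have hinj : Function.Injective fun q : ℕ => (i, q) := fun a b h => (Prod.mk.inj h).2
  have hmeas : ∀ q : ℕ, Measurable fun x : ℝ =>
      ENNReal.ofReal (Real.exp (-(((K : ℝ) / q) * x))) := fun q => by fun_prop
  have hind := (hεi.precomp hinj).comp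
    (fun (q : ℕ) (x : ℝ) => ENNReal.ofReal (Real.exp (-(((K : ℝ) / q) * x)))) hmeas
  have hprod := lintegral_prod_eq_prod_lintegral_of_indepFun (Finset.Ioc r m) _ hind
    fun q => (hmeas q).comp (hm (i, q))
  simp only [Function.comp_apply] at hprod
  have hpm : Measurable fun ω => ∏ q ∈ Finset.Ioc r m,
      ENNReal.ofReal (Real.exp (-(((K : ℝ) / q) * ε (i, q) ω))) :=
    Finset.measurable_fun_prod _ fun q _ => (hmeas q).comp (hm (i, q))
  rw [lintegral_const_mul _ hpm, hprod]
  have hterm : ∀ q ∈ Finset.Ioc r m,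
      ∫⁻ ω, ENNReal.ofReal (Real.exp (-(((K : ℝ) / q) * ε (i, q) ω))) ∂Q
        = ENNReal.ofReal ((q : ℝ) / (q + K)) := by
    intro q hq
    have hq0 : (0 : ℝ) < q := by
      have := (Finset.mem_Ioc.1 hq).1
      exact_mod_cast (by omega : 0 < q)
    rw [(hε (i, q)).lintegral_comp (hmeas q).aemeasurable,
      lintegral_exp_neg_mul_expMeasure (by positivity)]
    congr 1
    field_simp
  rw [Finset.prod_congr rfl hterm, ← ENNReal.ofReal_prod_of_nonneg fun q _ => by positivity,
    ← ENNReal.ofReal_mul (by positivity)]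
  exact ENNReal.ofReal_le_ofReal (pow_mul_prod_div_add_le r K hrm)

theorem sum_Icc_inv_sq_le_one {r : ℕ} (hr : 1 ≤ r) (m : ℕ) :
    ∑ q ∈ Finset.Icc (r + 1) m, ((q : ℝ)⁻¹) ^ 2 ≤ 1 := by
  have hIcc : Finset.Icc (r + 1) m = Finset.Ioc r m := by
    ext; simp
  rw [hIcc]
  rcases le_or_gt r m with h | h
  · have h1 := sum_Ioc_inv_sq_le_sub (α := ℝ) (k := r) (n := m) (by omega) h
    have h2 : ((r : ℝ))⁻¹ ≤ 1 := inv_le_one_of_one_le₀ (by exact_mod_cast hr)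
    have h3 : 0 ≤ (m : ℝ)⁻¹ := by positivity
    simp only [inv_pow]
    linarith
  · rw [Finset.Ioc_eq_empty (by omega)]
    simp

theorem aConst_le {m r : ℕ} (hm : 1 ≤ m) {p : ℝ} (hp : 0 < p) :
    aConst m r p ≤ 1 + Real.log (m * p) := by
  have h1 : ∑ j ∈ Finset.Icc (r + 1) m, (1 : ℝ) / j ≤ 1 + Real.log m := by
    have h2 := harmonic_le_one_add_log m
    rw [harmonic_eq_sum_Icc] at h2
    push_cast at h2
    refine le_trans ?_ h2
    simp_rw [one_div]
    refine Finset.sum_le_sum_of_subset_of_nonneg (Finset.Icc_subset_Icc_left (by omega)) ?_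
    intro q _ _
    positivity
  have hm0 : (m : ℝ) ≠ 0 := by positivity
  rw [aConst, Real.log_mul hm0 hp.ne']
  linarith

end IndependentSums

/-! ### Deterministic decomposition of one data point. -/

section ModelDecomposition

theorem renyiSum_eq_add (e : ℕ × ℕ → ℝ) {m j : ℕ} (i : ℕ) (hjm : j ≤ m) :
    renyiSum e m i j = e (i, j) / j + renyiSum e m i (j + 1) := by
  have : Finset.Icc j m = insert j (Finset.Icc (j + 1) m) := by
    ext q
    simp only [Finset.mem_insert, Finset.mem_Icc]
    omega
  rw [renyiSum, this, Finset.sum_insert (by simp)]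
  rfl

theorem renyiSum_le_renyiSum {e : ℕ × ℕ → ℝ} (he : ∀ q, 0 ≤ e q) (m i : ℕ) {j j' : ℕ}
    (h : j ≤ j') : renyiSum e m i j' ≤ renyiSum e m i j :=
  Finset.sum_le_sum_of_subset_of_nonneg (Finset.Icc_subset_Icc_left h) fun q _ _ =>
    div_nonneg (he _) (Nat.cast_nonneg q)

/-- The data points are `γ (e - 1)` up to a centered average and a remainder of the order of
`A(m)`. -/
theorem abs_modelPoint_sub_le {U : ℝ → ℝ} {γ c B t₀ p : ℝ} {K m r : ℕ} (ht₀ : 1 ≤ t₀)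
    (hB : ∀ y ≥ t₀, |Real.log (U y) - γ * Real.log y - c| ≤ B * (1 + (m / y) ^ K))
    {e : ℕ × ℕ → ℝ} (he : ∀ q, 0 ≤ e q) {i j : ℕ} (hj : 1 ≤ j) (hjr : j ≤ r) (hrm : r + 1 ≤ m)
    (hL : t₀ ≤ Real.exp (renyiSum e m i (r + 1))) (hp : 0 < p) (hp1 : t₀ ≤ 1 / p) (hmp : m * p ≤ 1)
    (ha : aConst m r p ≠ 0) (ha1 : |(aConst m r p)⁻¹| ≤ 1) :
    |modelPoint (fun x => U (Real.exp x)) e m r p (Real.log (U (1 / p))) i j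
        - γ * ((e (i, j) - 1)
          - ∑ q ∈ Finset.Icc (r + 1) m, (aConst m r p)⁻¹ * (q : ℝ)⁻¹ * (e (i, q) - 1))|
      ≤ (2 * r + 3) * B * (1 + (m * Real.exp (-renyiSum e m i (r + 1))) ^ K) := by
  set a := aConst m r p with had
  set L := renyiSum e m i (r + 1) with hLd
  set M := (m * Real.exp (-L)) ^ K with hM
  have hM0 : 0 ≤ M := by positivity
  have hB0 : 0 ≤ B := by
    have h1 := (abs_nonneg _).trans (hB t₀ le_rfl)
    exact nonneg_of_mul_nonneg_left h1 (by positivity)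
  have hG : ∀ x, L ≤ x → |Real.log (U (Real.exp x)) - γ * x - c| ≤ B * (1 + M) := by
    intro x hx
    have h1 := hB (Real.exp x) (hL.trans (Real.exp_le_exp.2 hx))
    rw [Real.log_exp] at h1
    refine h1.trans (mul_le_mul_of_nonneg_left ?_ hB0)
    rw [hM, div_eq_mul_inv, ← Real.exp_neg]
    gcongr
  -- At `y = 1/p` the ratio `m/y = mp` is at most 1, so the error factor is at most 2.
  have hGp : |Real.log (U (1 / p)) + γ * Real.log p - c| ≤ 2 * (B * (1 + M)) := by
    have h1 := hB (1 / p) hp1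
    rw [one_div, Real.log_inv, div_inv_eq_mul, mul_neg, sub_neg_eq_add, ← one_div] at h1
    refine h1.trans ?_
    have h2 : (m * p) ^ K ≤ 1 := pow_le_one₀ (by positivity) hmp
    nlinarith [mul_nonneg hB0 hM0]
  have g1 := hG _ (renyiSum_le_renyiSum he m i (by omega : j ≤ r + 1))
  have g2 := hG _ (renyiSum_le_renyiSum he m i (by omega : j + 1 ≤ r + 1))
  have g3 := hG L le_rfl
  set G1 := Real.log (U (Real.exp (renyiSum e m i j))) - γ * renyiSum e m i j - c with hG1
  set G2 := Real.log (U (Real.exp (renyiSum e m i (j + 1)))) - γ * renyiSum e m i (j + 1) - c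
    with hG2
  set G3 := Real.log (U (Real.exp L)) - γ * L - c with hG3
  set G4 := Real.log (U (1 / p)) + γ * Real.log p - c with hG4
  -- The role of `a`: since `L` has mean `a - log p`, the ratio `(L + log p)/a` has mean 1, the mean
  -- of `e (i, j)`.
  have hsum : ∑ q ∈ Finset.Icc (r + 1) m, a⁻¹ * (q : ℝ)⁻¹ * (e (i, q) - 1)
      = a⁻¹ * (L + Real.log p) - 1 := by
    have h1 : ∑ q ∈ Finset.Icc (r + 1) m, a⁻¹ * (q : ℝ)⁻¹ * (e (i, q) - 1)
        = a⁻¹ * (L - ∑ q ∈ Finset.Icc (r + 1) m, (1 : ℝ) / q) := by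
      rw [hLd, renyiSum, ← Finset.sum_sub_distrib, Finset.mul_sum]
      exact Finset.sum_congr rfl fun q _ => by ring
    have h2 : ∑ q ∈ Finset.Icc (r + 1) m, (1 : ℝ) / q = a - Real.log p := by
      rw [had, aConst]; ring
    rw [h1, h2]
    field_simp
    ring
  have hj0 : (j : ℝ) ≠ 0 := by positivity
  -- The constant `c` cancels in both differences. The final factor is `2r` from `j (G1 - G2)` plus
  -- `1 + 2` from `G3` and `G4`.
  have hid : modelPoint (fun x => U (Real.exp x)) e m r p (Real.log (U (1 / p))) i j
        - γ * ((e (i, j) - 1)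
          - ∑ q ∈ Finset.Icc (r + 1) m, a⁻¹ * (q : ℝ)⁻¹ * (e (i, q) - 1))
      = j * (G1 - G2) - a⁻¹ * (G3 - G4) := by
    have h1 : (j : ℝ) * (renyiSum e m i j - renyiSum e m i (j + 1)) = e (i, j) := by
      rw [renyiSum_eq_add e i (by omega : j ≤ m)]
      field_simp
      ring
    rw [hsum, modelPoint, hG1, hG2, hG3, hG4]
    linear_combination γ * h1
  rw [hid]
  have hjr' : (j : ℝ) ≤ r := by exact_mod_cast hjr
  have b1 : |(j : ℝ) * (G1 - G2)| ≤ r * (2 * (B * (1 + M))) := by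
    rw [abs_mul, Nat.abs_cast]
    refine mul_le_mul hjr' ((abs_sub _ _).trans (by linarith)) (abs_nonneg _) (by positivity)
  have b2 : |a⁻¹ * (G3 - G4)| ≤ 3 * (B * (1 + M)) := by
    rw [abs_mul]
    refine (mul_le_of_le_one_left (abs_nonneg _) ha1).trans ((abs_sub _ _).trans (by linarith))
  refine (abs_sub _ _).trans ?_
  linarith

end ModelDecomposition

/-! ### Negligibility of the block averages and of the remainder. -/

section ModelAsymptotics

variable {Ω : Type*} [MeasurableSpace Ω] {Q : Measure Ω}

theorem lintegral_mul_sum_le {ι : Type*} {Z : ι → Ω → ℝ} (hZ : ∀ i, AEMeasurable (Z i) Q)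
    (h0 : ∀ i ω, 0 ≤ Z i ω) {B : ℝ}
    (h : ∀ i, ∫⁻ ω, ENNReal.ofReal (Z i ω) ∂Q ≤ ENNReal.ofReal B) {w : ℝ} (hw : 0 ≤ w)
    (s : Finset ι) :
    ∫⁻ ω, ENNReal.ofReal (w * ∑ i ∈ s, Z i ω) ∂Q ≤ ENNReal.ofReal (w * (s.card * B)) := by
  simp_rw [ENNReal.ofReal_mul hw, ENNReal.ofReal_sum_of_nonneg fun i _ => h0 i _]
  rw [lintegral_const_mul' _ _ ENNReal.ofReal_ne_top,
    lintegral_finsetSum' _ fun i _ => (hZ i).ennreal_ofReal]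
  refine mul_le_mul_right ?_ _
  refine (Finset.sum_le_sum fun i _ => h i).trans (le_of_eq ?_)
  rw [Finset.sum_const, nsmul_eq_mul, ENNReal.ofReal_mul (Nat.cast_nonneg _),
    ENNReal.ofReal_natCast]

variable {ε : ℕ × ℕ → Ω → ℝ}

/-- By independence across and within blocks the second moment is at most `b² ∑ l⁻² ≤ b²`, however
large `k` and `m` are. -/
theorem tendsto_centered_average [IsProbabilityMeasure Q] (hm : ∀ q, Measurable (ε q))
    (hε : ∀ q, HasLaw (ε q) (expMeasure 1) Q) (hεi : iIndepFun ε Q)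
    {r : ℕ} (hr : 1 ≤ r) (k m : ℕ → ℕ) {b : ℕ → ℝ}
    (hb : Tendsto b atTop (𝓝 0)) :
    Tendsto (fun q : ℕ × Ω => (∑ i ∈ Finset.range (k q.1), ∑ l ∈ Finset.Icc (r + 1) (m q.1),
      b q.1 * (l : ℝ)⁻¹ * (ε (i, l) q.2 - 1)) / √(k q.1 : ℝ)) (whp Q) (𝓝 0) := by
  have hb2 : Tendsto (fun n => b n ^ 2) atTop (𝓝 0) := by simpa using hb.pow 2
  refine tendsto_whp_zero_of_lintegral_sq (Z := fun n ω => (∑ i ∈ Finset.range (k n),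
    ∑ l ∈ Finset.Icc (r + 1) (m n), b n * (l : ℝ)⁻¹ * (ε (i, l) ω - 1)) / √(k n : ℝ))
    (fun n => ?_) hb2 (Eventually.of_forall fun n => ?_)
  · exact Measurable.aemeasurable (by fun_prop)
  · have h := lintegral_sum_sq hε hεi (f := fun x => x - 1) (by fun_prop)
      (integrable_sub_one_pow_expMeasure 2) integral_sub_one_expMeasure
      (Finset.range (k n) ×ˢ Finset.Icc (r + 1) (m n)) fun il => b n * (il.2 : ℝ)⁻¹ / √(k n : ℝ)
    rw [integral_sub_one_sq_expMeasure, mul_one, Finset.sum_product] at h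
    have h1 : ∀ ω, ∑ il ∈ Finset.range (k n) ×ˢ Finset.Icc (r + 1) (m n),
        b n * (il.2 : ℝ)⁻¹ / √(k n : ℝ) * (ε il ω - 1) = (∑ i ∈ Finset.range (k n),
          ∑ l ∈ Finset.Icc (r + 1) (m n), b n * (l : ℝ)⁻¹ * (ε (i, l) ω - 1)) / √(k n : ℝ) := by
      intro ω
      rw [Finset.sum_product, Finset.sum_div]
      refine Finset.sum_congr rfl fun i _ => ?_
      rw [Finset.sum_div]
      exact Finset.sum_congr rfl fun l _ => by ring
    simp_rw [h1] at h
    rw [h]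
    refine ENNReal.ofReal_le_ofReal ?_
    rw [Finset.sum_const, Finset.card_range, nsmul_eq_mul]
    have h2 : ∀ l : ℕ, (b n * (l : ℝ)⁻¹ / √(k n : ℝ)) ^ 2 = b n ^ 2 / k n * ((l : ℝ)⁻¹) ^ 2 := by
      intro l
      rw [div_pow, mul_pow, Real.sq_sqrt (Nat.cast_nonneg _)]
      ring
    simp_rw [h2]
    rw [← Finset.mul_sum, ← mul_assoc]
    have h3 : (k n : ℝ) * (b n ^ 2 / k n) ≤ b n ^ 2 := by
      rw [← mul_div_assoc, mul_div_right_comm]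
      exact mul_le_of_le_one_left (sq_nonneg _) (div_self_le_one _)
    exact (mul_le_of_le_one_right (by positivity) (sum_Icc_inv_sq_le_one hr _)).trans h3

theorem tendsto_centered_average_sq [IsProbabilityMeasure Q] (hm : ∀ q, Measurable (ε q))
    (hε : ∀ q, HasLaw (ε q) (expMeasure 1) Q) (hεi : iIndepFun ε Q)
    {r : ℕ} (hr : 1 ≤ r) (k m : ℕ → ℕ) {b : ℕ → ℝ}
    (hb : Tendsto b atTop (𝓝 0)) :
    Tendsto (fun q : ℕ × Ω => (k q.1 : ℝ)⁻¹ * ∑ i ∈ Finset.range (k q.1),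
      (∑ l ∈ Finset.Icc (r + 1) (m q.1), b q.1 * (l : ℝ)⁻¹ * (ε (i, l) q.2 - 1)) ^ 2)
      (whp Q) (𝓝 0) := by
  have hb2 : Tendsto (fun n => b n ^ 2) atTop (𝓝 0) := by simpa using hb.pow 2
  refine tendsto_whp_zero_of_lintegral (Z := fun n ω => (k n : ℝ)⁻¹ * ∑ i ∈ Finset.range (k n),
    (∑ l ∈ Finset.Icc (r + 1) (m n), b n * (l : ℝ)⁻¹ * (ε (i, l) ω - 1)) ^ 2)
    (fun n => ?_) (fun n ω => by positivity) hb2 (Eventually.of_forall fun n => ?_)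
  · exact Measurable.aemeasurable (by fun_prop)
  · refine (lintegral_mul_sum_le (Z := fun i ω =>
      (∑ l ∈ Finset.Icc (r + 1) (m n), b n * (l : ℝ)⁻¹ * (ε (i, l) ω - 1)) ^ 2)
      (fun i => Measurable.aemeasurable (by fun_prop)) (fun i ω => sq_nonneg _)
      (B := b n ^ 2) (fun i => ?_) (by positivity) _).trans (ENNReal.ofReal_le_ofReal ?_)
    · have hinj : Function.Injective fun l : ℕ => (i, l) := fun a b h => (Prod.mk.inj h).2
      have h := lintegral_sum_sq (fun l => hε (i, l)) (hεi.precomp hinj) (f := fun x => x - 1)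
        (by fun_prop) (integrable_sub_one_pow_expMeasure 2) integral_sub_one_expMeasure
        (Finset.Icc (r + 1) (m n)) fun l => b n * (l : ℝ)⁻¹
      rw [integral_sub_one_sq_expMeasure, mul_one] at h
      rw [h]
      refine ENNReal.ofReal_le_ofReal ?_
      simp_rw [mul_pow (b n)]
      rw [← Finset.mul_sum]
      exact mul_le_of_le_one_right (sq_nonneg _) (sum_Icc_inv_sq_le_one hr _)
    · rw [Finset.card_range, ← mul_assoc]
      exact mul_le_of_le_one_left (sq_nonneg _) (inv_mul_le_one)

/-- The inverse moments are bounded by `(r + K)!` uniformly in `m`, so the mean is at most `√k b (1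
+ (r + K)!)`. -/
theorem tendsto_remainder_bound [IsProbabilityMeasure Q] (hm : ∀ q, Measurable (ε q))
    (hε : ∀ q, HasLaw (ε q) (expMeasure 1) Q) (hεi : iIndepFun ε Q)
    (r K : ℕ) (k m : ℕ → ℕ) (hmtop : Tendsto m atTop atTop) {b : ℕ → ℝ}
    (hb0 : ∀ n, 0 ≤ b n) (hb : Tendsto (fun n => √(k n : ℝ) * b n) atTop (𝓝 0)) :
    Tendsto (fun q : ℕ × Ω => b q.1 / √(k q.1 : ℝ) * ∑ i ∈ Finset.range (k q.1),
      (1 + (m q.1 * Real.exp (-renyiSum (fun l => ε l q.2) (m q.1) i (r + 1))) ^ K))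
      (whp Q) (𝓝 0) := by
  have hb' := hb.mul_const (1 + ((r + K).factorial : ℝ))
  rw [zero_mul] at hb'
  have hren : ∀ m i, Measurable fun ω => renyiSum (fun l => ε l ω) m i (r + 1) := fun m i => by
    unfold renyiSum
    fun_prop
  refine tendsto_whp_zero_of_lintegral (Z := fun n ω => b n / √(k n : ℝ) *
    ∑ i ∈ Finset.range (k n),
      (1 + (m n * Real.exp (-renyiSum (fun l => ε l ω) (m n) i (r + 1))) ^ K))
    (fun n => Measurable.aemeasurable (by fun_prop)) (fun n ω => ?_) hb' ?_
  · have := hb0 n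
    positivity
  filter_upwards [hmtop.eventually (eventually_ge_atTop r)] with n hn
  refine (lintegral_mul_sum_le (Z := fun i ω =>
    1 + (m n * Real.exp (-renyiSum (fun l => ε l ω) (m n) i (r + 1))) ^ K)
    (fun i => Measurable.aemeasurable (by fun_prop)) (fun i ω => by positivity)
    (B := 1 + (r + K).factorial) (fun i => ?_) (div_nonneg (hb0 n) (by positivity))
    _).trans (ENNReal.ofReal_le_ofReal (le_of_eq ?_))
  · have h0 : ∀ ω, 0 ≤ (m n * Real.exp (-renyiSum (fun l => ε l ω) (m n) i (r + 1))) ^ K :=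
      fun ω => by positivity
    simp_rw [ENNReal.ofReal_add zero_le_one (h0 _)]
    rw [lintegral_add_left measurable_const, ENNReal.ofReal_add zero_le_one (by positivity)]
    simp only [lintegral_const, measure_univ, mul_one]
    gcongr
    exact lintegral_exp_neg_mul_renyiSum_le hm hε hεi i r K hn
  · rw [Finset.card_range, ← mul_assoc]
    congr 1
    rw [div_mul_eq_mul_div, mul_div_assoc, Real.div_sqrt, mul_comm]

/-- With high probability all the upper order statistics are large. -/
theorem eventually_le_exp_renyiSum (hm : ∀ q, Measurable (ε q))
    (hε : ∀ q, HasLaw (ε q) (expMeasure 1) Q) (hεi : iIndepFun ε Q)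
    (r K : ℕ) (k m : ℕ → ℕ) (hmtop : Tendsto m atTop atTop)
    {b : ℕ → ℝ} (hb : Tendsto (fun n => √(k n : ℝ) * b n) atTop (𝓝 0)) {t₀ C : ℝ} (ht₀ : 1 ≤ t₀)
    (hC : ∀ᶠ n in atTop, 1 ≤ C * (m n : ℝ) ^ K * b n) :
    ∀ᶠ q : ℕ × Ω in whp Q, ∀ i < k q.1,
      t₀ ≤ Real.exp (renyiSum (fun l => ε l q.2) (m q.1) i (r + 1)) := by
  have hren : ∀ m i, Measurable fun ω => renyiSum (fun l => ε l ω) m i (r + 1) := fun m i => by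
    unfold renyiSum
    fun_prop
  -- Markov's inequality with the inverse moment of order `2K` and a union bound over blocks give
  -- order `k m^{-2K}`. As `1 ≤ C m^K b`, this is `O((√k b)²)`, so no direct relation between `k`
  -- and `m` is needed.
  have hb' : Tendsto (fun n => (√(k n : ℝ) * b n) ^ 2 *
      (C ^ 2 * t₀ ^ (2 * K) * (r + 2 * K).factorial)) atTop (𝓝 0) := by
    simpa using (hb.pow 2).mul_const (C ^ 2 * t₀ ^ (2 * K) * (r + 2 * K).factorial)
  refine eventually_whp_of_le hb' ?_
  filter_upwards [hmtop.eventually (eventually_ge_atTop r), hC,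
    hmtop.eventually (eventually_gt_atTop 0)] with n hn hCn hm0
  have hm0' : (0 : ℝ) < m n := by exact_mod_cast hm0
  have ht0 : 0 < t₀ := by linarith
  have hone : ∀ i, Q {ω | Real.exp (renyiSum (fun l => ε l ω) (m n) i (r + 1)) < t₀}
      ≤ ENNReal.ofReal ((r + 2 * K).factorial / (m n / t₀) ^ (2 * K)) := by
    intro i
    have hpos : 0 < (m n / t₀) ^ (2 * K) := by positivity
    have hZ : Measurable fun ω =>
        (m n * Real.exp (-renyiSum (fun l => ε l ω) (m n) i (r + 1))) ^ (2 * K) := by fun_prop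
    have hmk := mul_meas_ge_le_lintegral₀ (μ := Q) hZ.aemeasurable.ennreal_ofReal
      (ENNReal.ofReal ((m n / t₀) ^ (2 * K)))
    rw [ENNReal.ofReal_div_of_pos hpos,
      ENNReal.le_div_iff_mul_le (Or.inl (ENNReal.ofReal_pos.2 hpos).ne') (by simp), mul_comm]
    refine le_trans ?_ (hmk.trans (lintegral_exp_neg_mul_renyiSum_le hm hε hεi i r (2 * K) hn))
    refine mul_le_mul_right (measure_mono fun ω hω => ENNReal.ofReal_le_ofReal ?_) _
    have hω' : Real.exp (renyiSum (fun l => ε l ω) (m n) i (r + 1)) < t₀ := hω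
    rw [Real.exp_neg, div_eq_mul_inv]
    gcongr
  have hsub : {ω | ¬ ∀ i < k n, t₀ ≤ Real.exp (renyiSum (fun l => ε l ω) (m n) i (r + 1))}
      ⊆ ⋃ i ∈ Finset.range (k n),
        {ω | Real.exp (renyiSum (fun l => ε l ω) (m n) i (r + 1)) < t₀} := by
    intro ω hω
    have hω' : ¬ ∀ i < k n, t₀ ≤ Real.exp (renyiSum (fun l => ε l ω) (m n) i (r + 1)) := hω
    push Not at hω'
    obtain ⟨i, hi, hlt⟩ := hω'
    exact Set.mem_biUnion (Finset.mem_coe.2 (Finset.mem_range.2 hi)) hlt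
  refine (measure_mono hsub).trans ((measure_biUnion_finset_le _ _).trans ?_)
  refine (Finset.sum_le_sum fun i _ => hone i).trans ?_
  rw [Finset.sum_const, Finset.card_range, nsmul_eq_mul, ← ENNReal.ofReal_natCast,
    ← ENNReal.ofReal_mul (Nat.cast_nonneg _)]
  refine ENNReal.ofReal_le_ofReal ?_
  have h1 : 1 ≤ (C * (m n : ℝ) ^ K * b n) ^ 2 := one_le_pow₀ hCn
  have hmK : (0 : ℝ) < (m n : ℝ) ^ (2 * K) := by positivity
  have hfk : (0 : ℝ) ≤ k n * ((r + 2 * K).factorial * t₀ ^ (2 * K)) := by positivity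
  rw [div_pow, div_div_eq_mul_div, ← mul_div_assoc, div_le_iff₀ hmK, mul_pow (√(k n : ℝ)),
    Real.sq_sqrt (Nat.cast_nonneg _)]
  calc (k n : ℝ) * ((r + 2 * K).factorial * t₀ ^ (2 * K))
      ≤ k n * ((r + 2 * K).factorial * t₀ ^ (2 * K)) * (C * (m n : ℝ) ^ K * b n) ^ 2 :=
        le_mul_of_one_le_right hfk h1
    _ = _ := by ring

end ModelAsymptotics

/-! ### Limit theorems for the upper spacings and for the model statistic. -/

section ModelLimit

theorem sum_fin_prod_fst (k r : ℕ) (G : ℕ → ℝ) :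
    ∑ ij : Fin k × Fin r, G ij.1 = r * ∑ i ∈ Finset.range k, G i := by
  rw [Fintype.sum_prod_type]
  simp only [Finset.sum_const, Finset.card_univ, Fintype.card_fin, nsmul_eq_mul]
  rw [← Finset.mul_sum, Fin.sum_univ_eq_sum_range]

theorem sum_fin_prod_eq_sum_range (k r : ℕ) (f : ℕ → ℕ → ℝ) :
    ∑ ij : Fin k × Fin r, f ij.1 ij.2 = ∑ l ∈ Finset.range (k * r), f (l / r) (l % r) := by
  rw [← Fin.sum_univ_eq_sum_range (fun l => f (l / r) (l % r))]
  refine Fintype.sum_equiv finProdFinEquiv _ _ fun ij => ?_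
  have hr : 0 < r := lt_of_le_of_lt (Nat.zero_le _) ij.2.2
  simp only [finProdFinEquiv_apply_val]
  rw [Nat.add_mul_div_left _ _ hr, Nat.div_eq_of_lt ij.2.2, zero_add, Nat.add_mul_mod_self_left,
    Nat.mod_eq_of_lt ij.2.2]

theorem injective_fin_prod (k r : ℕ) :
    Function.Injective fun ij : Fin k × Fin r => ((ij.1 : ℕ), (ij.2 : ℕ) + 1) := by
  rintro ⟨i, j⟩ ⟨i', j'⟩ h
  simp only [Prod.mk.injEq] at h
  rw [Prod.mk.injEq, Fin.ext_iff, Fin.ext_iff]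
  exact ⟨h.1, by omega⟩

/-- The normalized sum of the upper spacings of `k` blocks. -/
def spacingSum {Ω : Type*} (ε : ℕ × ℕ → Ω → ℝ) (k r : ℕ) (ω : Ω) : ℝ :=
  (√((k * r : ℕ) : ℝ))⁻¹ * ∑ ij : Fin k × Fin r, (ε (ij.1, ij.2 + 1) ω - 1)

theorem sum_eq_sqrt_mul_spacingSum {Ω : Type*} {ε : ℕ × ℕ → Ω → ℝ} {r : ℕ} (hr : 1 ≤ r) (k : ℕ) (ω : Ω) :
    ∑ ij : Fin k × Fin r, (ε (ij.1, ij.2 + 1) ω - 1) =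
      √(k : ℝ) * (√(r : ℝ) * spacingSum ε k r ω) := by
  rw [spacingSum, Nat.cast_mul, Real.sqrt_mul (Nat.cast_nonneg k), ← mul_assoc, ← mul_assoc]
  rcases Nat.eq_zero_or_pos k with rfl | hk
  · simp
  · have h1 : √(k : ℝ) * √(r : ℝ) ≠ 0 := by positivity
    rw [mul_inv_cancel₀ h1, one_mul]

variable {Ω : Type*} [MeasurableSpace Ω] {Q : Measure Ω} {ε : ℕ × ℕ → Ω → ℝ}

/-- The central limit theorem for the upper spacings. -/
theorem tendstoInDistribution_spacingSum [IsProbabilityMeasure Q]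
    (hε : ∀ q, HasLaw (ε q) (expMeasure 1) Q) (hεi : iIndepFun ε Q) {r : ℕ} (hr : 1 ≤ r)
    {k : ℕ → ℕ} (hk : Tendsto k atTop atTop) :
    TendstoInDistribution (fun n ω => spacingSum ε (k n) r ω) atTop id (fun _ => Q)
      (gaussianReal 0 1) := by
  -- Enumerating the spacings block by block does not depend on `n`, so the sums are partial sums of
  -- one i.i.d. sequence, taken along the lengths `k n * r`.
  have hinj : Function.Injective fun l : ℕ => (l / r, l % r + 1) := by
    intro a b h
    simp only [Prod.mk.injEq, add_left_inj] at h
    rw [← Nat.div_add_mod a r, ← Nat.div_add_mod b r, h.1, h.2]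
  have hind := (hεi.precomp hinj).comp (fun _ x => x - 1) fun _ => measurable_id.sub_const 1
  have hlaw : ∀ l : ℕ, HasLaw ((fun x : ℝ => x - 1) ∘ ε (l / r, l % r + 1))
      ((expMeasure 1).map fun x => x - 1) Q := fun l =>
    HasLaw.comp ⟨(measurable_id.sub_const 1).aemeasurable, rfl⟩ (hε _)
  have hcl := tendstoInDistribution_inv_sqrt_mul_sum (P := Q)
    (X := fun l => (fun x : ℝ => x - 1) ∘ ε (l / r, l % r + 1)) (HasLaw.id (μ := gaussianReal 0 1))
    (by
      exact ((hε (0 / r, 0 % r + 1)).integral_comp (f := fun x => x - 1)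
        (measurable_id.sub_const 1).aestronglyMeasurable).trans integral_sub_one_expMeasure)
    (by
      exact ((hε (0 / r, 0 % r + 1)).integral_comp (f := fun x => (x - 1) ^ 2)
        ((measurable_id.sub_const 1).pow_const 2).aestronglyMeasurable).trans
        integral_sub_one_sq_expMeasure)
    hind fun l => ⟨(hlaw l).aemeasurable, (hlaw 0).aemeasurable, by
      rw [(hlaw l).map_eq, (hlaw 0).map_eq]⟩
  have hN : Tendsto (fun n => k n * r) atTop atTop := hk.atTop_mul_const' hr
  have heq : ∀ n ω, spacingSum ε (k n) r ω = (√((k n * r : ℕ) : ℝ))⁻¹ *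
      ∑ l ∈ Finset.range (k n * r), ((fun x : ℝ => x - 1) ∘ ε (l / r, l % r + 1)) ω := fun n ω => by
    rw [spacingSum, sum_fin_prod_eq_sum_range (k n) r fun i j => ε (i, j + 1) ω - 1]
    rfl
  refine ⟨fun n => ?_, hcl.aemeasurable_limit, ?_⟩
  · simp_rw [heq]
    exact hcl.forall_aemeasurable (k n * r)
  · simp_rw [heq]
    exact hcl.tendsto.comp hN

theorem lintegral_spacingSum_sq_le [IsProbabilityMeasure Q]
    (hε : ∀ q, HasLaw (ε q) (expMeasure 1) Q) (hεi : iIndepFun ε Q) (k r : ℕ) :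
    ∫⁻ ω, ENNReal.ofReal (spacingSum ε k r ω ^ 2) ∂Q ≤ ENNReal.ofReal 1 := by
  have h := lintegral_sum_sq (fun ij : Fin k × Fin r => hε (ij.1, ij.2 + 1))
    (hεi.precomp (injective_fin_prod k r)) (f := fun x => x - 1) (by fun_prop)
    (integrable_sub_one_pow_expMeasure 2) integral_sub_one_expMeasure Finset.univ
    fun _ => (√((k * r : ℕ) : ℝ))⁻¹
  simp_rw [← Finset.mul_sum] at h
  rw [integral_sub_one_sq_expMeasure, mul_one, Finset.sum_const, Finset.card_univ,
    Fintype.card_prod, Fintype.card_fin, Fintype.card_fin, nsmul_eq_mul, inv_pow,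
    Real.sq_sqrt (Nat.cast_nonneg _)] at h
  unfold spacingSum
  rw [h]
  exact ENNReal.ofReal_le_ofReal (mul_inv_le_one)

theorem tendsto_sum_spacing_sq [IsProbabilityMeasure Q] (hm : ∀ q, Measurable (ε q))
    (hε : ∀ q, HasLaw (ε q) (expMeasure 1) Q) (hεi : iIndepFun ε Q) (r : ℕ)
    {k : ℕ → ℕ} (hk : Tendsto k atTop atTop) :
    Tendsto (fun q : ℕ × Ω => (∑ ij : Fin (k q.1) × Fin r, (ε (ij.1, ij.2 + 1) q.2 - 1) ^ 2)
      / (k q.1 : ℝ)) (whp Q) (𝓝 r) := by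
  set v := ∫ x, ((x - 1) ^ 2 - 1) ^ 2 ∂(expMeasure 1) with hv
  have hk' : Tendsto (fun n => (k n : ℝ)) atTop atTop := tendsto_natCast_atTop_atTop.comp hk
  have hb : Tendsto (fun n => (r * v) / (k n : ℝ)) atTop (𝓝 0) := tendsto_const_nhds.div_atTop hk'
  have hi2 := integrable_sub_one_pow_expMeasure 2
  have hi4 : Integrable (fun x : ℝ => ((x - 1) ^ 2 - 1) ^ 2) (expMeasure 1) := by
    have h1 : ∀ x : ℝ, ((x - 1) ^ 2 - 1) ^ 2 = (x - 1) ^ 4 - 2 * (x - 1) ^ 2 + 1 := fun x => by ring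
    simp_rw [h1]
    exact ((integrable_sub_one_pow_expMeasure 4).sub (hi2.const_mul 2)).add (integrable_const 1)
  have hz : Tendsto (fun q : ℕ × Ω => ∑ ij : Fin (k q.1) × Fin r,
      (k q.1 : ℝ)⁻¹ * ((ε (ij.1, ij.2 + 1) q.2 - 1) ^ 2 - 1)) (whp Q) (𝓝 0) := by
    refine tendsto_whp_zero_of_lintegral_sq (Z := fun n ω => ∑ ij : Fin (k n) × Fin r,
      (k n : ℝ)⁻¹ * ((ε (ij.1, ij.2 + 1) ω - 1) ^ 2 - 1)) (fun n => ?_) hb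
      (Eventually.of_forall fun n => ?_)
    · exact Measurable.aemeasurable (by fun_prop)
    · have h := lintegral_sum_sq (fun ij : Fin (k n) × Fin r => hε (ij.1, ij.2 + 1))
        (hεi.precomp (injective_fin_prod (k n) r)) (f := fun x => (x - 1) ^ 2 - 1) (by fun_prop)
        hi4 (by
          rw [integral_sub hi2 (integrable_const 1), integral_sub_one_sq_expMeasure]
          simp) Finset.univ fun _ => (k n : ℝ)⁻¹
      rw [h]
      refine ENNReal.ofReal_le_ofReal ?_
      rw [Finset.sum_const, Finset.card_univ, Fintype.card_prod, Fintype.card_fin,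
        Fintype.card_fin, nsmul_eq_mul, Nat.cast_mul, ← hv]
      rcases Nat.eq_zero_or_pos (k n) with h0 | h0
      · simp [h0]
      · have : (k n : ℝ) ≠ 0 := by positivity
        refine le_of_eq ?_
        field_simp
  have h2 := hz.add_const (r : ℝ)
  rw [zero_add] at h2
  refine h2.congr' ?_
  filter_upwards [tendsto_fst_whp.eventually (hk.eventually (eventually_gt_atTop 0))] with q hq
  have : (k q.1 : ℝ) ≠ 0 := by positivity
  rw [← Finset.mul_sum, Finset.sum_sub_distrib, Finset.sum_const, Finset.card_univ,
    Fintype.card_prod, Fintype.card_fin, Fintype.card_fin, nsmul_eq_mul, Nat.cast_mul]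
  field_simp
  ring

/-- The expected sum is of order `k`. The normalization by `k²` is what makes the largest spacing
`o(√k)`. -/
theorem tendsto_sum_spacing_pow_four (hm : ∀ q, Measurable (ε q))
    (hε : ∀ q, HasLaw (ε q) (expMeasure 1) Q) (r : ℕ) {k : ℕ → ℕ} (hk : Tendsto k atTop atTop) :
    Tendsto (fun q : ℕ × Ω => (∑ ij : Fin (k q.1) × Fin r, (ε (ij.1, ij.2 + 1) q.2 - 1) ^ 4)
      / (k q.1 : ℝ) ^ 2) (whp Q) (𝓝 0) := by
  set v := ∫ x, (x - 1) ^ 4 ∂(expMeasure 1) with hv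
  have hk' : Tendsto (fun n => (k n : ℝ)) atTop atTop := tendsto_natCast_atTop_atTop.comp hk
  have hb : Tendsto (fun n => (r * v) / (k n : ℝ)) atTop (𝓝 0) := tendsto_const_nhds.div_atTop hk'
  simp_rw [div_eq_inv_mul _ ((_ : ℝ) ^ 2)]
  refine tendsto_whp_zero_of_lintegral (Z := fun n ω => ((k n : ℝ) ^ 2)⁻¹ *
    ∑ ij : Fin (k n) × Fin r, (ε (ij.1, ij.2 + 1) ω - 1) ^ 4)
    (fun n => Measurable.aemeasurable (by fun_prop)) (fun n ω => by positivity) hb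
    (Eventually.of_forall fun n => ?_)
  refine (lintegral_mul_sum_le (Z := fun (ij : Fin (k n) × Fin r) ω =>
    (ε (ij.1, ij.2 + 1) ω - 1) ^ 4) (fun i => Measurable.aemeasurable (by fun_prop))
    (fun i ω => by positivity) (B := v) (fun i => ?_) (by positivity) _).trans
    (ENNReal.ofReal_le_ofReal ?_)
  · rw [hv, ofReal_integral_eq_lintegral_ofReal (integrable_sub_one_pow_expMeasure 4)
      (Eventually.of_forall fun x => by positivity)]
    exact le_of_eq ((hε _).lintegral_comp (f := fun x => ENNReal.ofReal ((x - 1) ^ 4))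
      (by fun_prop))
  · rw [Finset.card_univ, Fintype.card_prod, Fintype.card_fin, Fintype.card_fin, Nat.cast_mul]
    rcases Nat.eq_zero_or_pos (k n) with h0 | h0
    · simp [h0]
    · have : (k n : ℝ) ≠ 0 := by positivity
      refine le_of_eq ?_
      field_simp

/-- Here `d` is `-u`, constant on blocks, plus a remainder small in `ℓ¹`; its `ℓ²` smallness follows
from `∑ x² ≤ (∑ |x|)²`. The block averages `u` need separate bounds because their sum is small only
through cancellation. -/
theorem tendsto_sum_of_sum_abs_add_le {α : Type*} {F : Filter α} {r : ℕ} {κ : α → ℕ}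
    (hκ : ∀ᶠ q in F, 0 < κ q) {d : ∀ q, Fin (κ q) × Fin r → ℝ} {u : α → ℕ → ℝ} {R : α → ℝ}
    (hdu : ∀ᶠ q in F, ∑ ij, |d q ij + u q ij.1| ≤ √(κ q : ℝ) * R q) (hR : Tendsto R F (𝓝 0))
    (hu1 : Tendsto (fun q => (∑ i ∈ Finset.range (κ q), u q i) / √(κ q : ℝ)) F (𝓝 0))
    (hu2 : Tendsto (fun q => (κ q : ℝ)⁻¹ * ∑ i ∈ Finset.range (κ q), u q i ^ 2) F (𝓝 0)) :
    Tendsto (fun q => (∑ ij, d q ij) / √(κ q : ℝ)) F (𝓝 0) ∧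
      Tendsto (fun q => (∑ ij, d q ij ^ 2) / (κ q : ℝ)) F (𝓝 0) := by
  constructor
  · have h1 : Tendsto (fun q => (∑ ij, d q ij) / √(κ q : ℝ)
        + r * ((∑ i ∈ Finset.range (κ q), u q i) / √(κ q : ℝ))) F (𝓝 0) := by
      refine squeeze_zero_norm' ?_ hR
      filter_upwards [hdu, hκ] with q hq hkq
      have hs : 0 < √(κ q : ℝ) := by positivity
      rw [← mul_div_assoc, ← add_div, ← sum_fin_prod_fst, ← Finset.sum_add_distrib,
        Real.norm_eq_abs, abs_div, abs_of_pos hs, div_le_iff₀ hs]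
      exact (Finset.abs_sum_le_sum_abs _ _).trans (hq.trans (le_of_eq (mul_comm _ _)))
    have h2 := h1.sub (hu1.const_mul (r : ℝ))
    simp only [mul_zero, sub_zero] at h2
    exact h2.congr fun q => by ring
  · have h1 : Tendsto (fun q => 2 * R q ^ 2
        + 2 * (r * ((κ q : ℝ)⁻¹ * ∑ i ∈ Finset.range (κ q), u q i ^ 2))) F (𝓝 0) := by
      simpa using ((hR.pow 2).const_mul 2).add ((hu2.const_mul (r : ℝ)).const_mul 2)
    refine squeeze_zero_norm' ?_ h1
    filter_upwards [hdu, hκ] with q hq hkq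
    have hk0 : (0 : ℝ) < κ q := by positivity
    rw [Real.norm_eq_abs, abs_of_nonneg (by positivity), div_le_iff₀ hk0]
    have h2 : ∑ ij, (d q ij + u q ij.1) ^ 2 ≤ κ q * R q ^ 2 := by
      have h3 := Finset.sum_sq_le_sq_sum_of_nonneg (s := Finset.univ)
        (f := fun ij => |d q ij + u q ij.1|) fun ij _ => abs_nonneg _
      simp only [sq_abs] at h3
      refine h3.trans ((pow_le_pow_left₀ (Finset.sum_nonneg fun ij _ => abs_nonneg _) hq 2).trans
        (le_of_eq ?_))
      rw [mul_pow, Real.sq_sqrt hk0.le]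
    have h4 : ∑ ij, d q ij ^ 2 ≤ 2 * ∑ ij, (d q ij + u q ij.1) ^ 2
        + 2 * ∑ ij : Fin (κ q) × Fin r, u q ij.1 ^ 2 := by
      rw [Finset.mul_sum, Finset.mul_sum, ← Finset.sum_add_distrib]
      refine Finset.sum_le_sum fun ij _ => ?_
      nlinarith [sq_nonneg (d q ij + 2 * u q ij.1)]
    rw [sum_fin_prod_fst (κ q) r fun i => u q i ^ 2] at h4
    have h5 : 2 * ∑ ij, (d q ij + u q ij.1) ^ 2 ≤ 2 * (κ q * R q ^ 2) := by linarith
    refine (h4.trans (add_le_add h5 le_rfl)).trans (le_of_eq ?_)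
    field_simp

theorem tendsto_aConst_atBot {r : ℕ} {m : ℕ → ℕ} {p : ℕ → ℝ} (hmtop : Tendsto m atTop atTop)
    (hp : ∀ n, 0 < p n) (hmp : Tendsto (fun n => (m n : ℝ) * p n) atTop (𝓝 0)) :
    Tendsto (fun n => aConst (m n) r (p n)) atTop atBot := by
  have h1 : Tendsto (fun n => (m n : ℝ) * p n) atTop (𝓝[>] 0) := by
    refine tendsto_nhdsWithin_iff.2 ⟨hmp, ?_⟩
    filter_upwards [hmtop.eventually (eventually_gt_atTop 0)] with n hn
    exact mul_pos (Nat.cast_pos.2 hn) (hp n)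
  have h2 := tendsto_atBot_add_const_left atTop (1 : ℝ) (Real.tendsto_log_nhdsGT_zero.comp h1)
  refine tendsto_atBot_mono' _ ?_ h2
  filter_upwards [hmtop.eventually (eventually_ge_atTop 1)] with n hn
  exact aConst_le hn (hp n)

/-- With high probability all data points are `γ (ε - 1)` up to a centered average of the block and
a remainder of the order of `A(m)`. -/
theorem eventually_abs_modelPoint_sub_le [IsProbabilityMeasure Q] (hm : ∀ q, Measurable (ε q))
    (hε : ∀ q, HasLaw (ε q) (expMeasure 1) Q) (hεi : iIndepFun ε Q) {U A : ℝ → ℝ}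
    {γ c C t₀ : ℝ} {K : ℕ} (ht₀ : 1 ≤ t₀)
    (hU : ∀ m ≥ t₀, ∀ y ≥ t₀,
        |Real.log (U y) - γ * Real.log y - c| ≤ C * |A m| * (1 + (m / y) ^ K))
    (hA : ∀ m ≥ t₀, 1 ≤ C * m ^ K * |A m|) {r : ℕ} {k m : ℕ → ℕ} {p : ℕ → ℝ}
    (hmtop : Tendsto m atTop atTop)
    (hbk : Tendsto (fun n => √(k n : ℝ) * (C * |A (m n)|)) atTop (𝓝 0)) (hp : ∀ n, 0 < p n)
    (hmp : Tendsto (fun n => (m n : ℝ) * p n) atTop (𝓝 0)) :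
    ∀ᶠ q : ℕ × Ω in whp Q, ∀ ij : Fin (k q.1) × Fin r,
      |modelPoint (fun x => U (Real.exp x)) (fun l => ε l q.2) (m q.1) r (p q.1)
          (Real.log (U (1 / p q.1))) ij.1 (ij.2 + 1)
        - γ * ((ε (ij.1, ij.2 + 1) q.2 - 1) - ∑ l ∈ Finset.Icc (r + 1) (m q.1),
          (aConst (m q.1) r (p q.1))⁻¹ * (l : ℝ)⁻¹ * (ε (ij.1, l) q.2 - 1))|
      ≤ (2 * r + 3) * (C * |A (m q.1)|) *
        (1 + (m q.1 * Real.exp (-renyiSum (fun l => ε l q.2) (m q.1) ij.1 (r + 1))) ^ K) := by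
  have hmR : Tendsto (fun n => (m n : ℝ)) atTop atTop := tendsto_natCast_atTop_atTop.comp hmtop
  have hatop := tendsto_aConst_atBot (r := r) hmtop hp hmp
  have hainv : Tendsto (fun n => (aConst (m n) r (p n))⁻¹) atTop (𝓝 0) :=
    tendsto_inv_atBot_zero.comp hatop
  -- The sequence `b` already contains `C`, hence the constant 1.
  have hbC : ∀ᶠ n in atTop, 1 ≤ 1 * (m n : ℝ) ^ K * (C * |A (m n)|) := by
    filter_upwards [hmR.eventually (eventually_ge_atTop t₀)] with n hn
    exact (hA _ hn).trans (le_of_eq (by ring))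
  have hL := eventually_le_exp_renyiSum hm hε hεi r K k m hmtop hbk ht₀ hbC
  have hpos : ∀ᶠ q in whp Q, ∀ l, 0 ≤ ε l q.2 := by
    have h : ∀ᵐ ω ∂Q, ∀ l, 0 ≤ ε l ω := ae_all_iff.2 fun l => ?_
    · exact eventually_whp_of_ae h
    have := ((hε l).ae_iff (p := fun x => 0 < x) (by fun_prop)).2 ae_expMeasure_pos
    filter_upwards [this] with ω hω using hω.le
  have hev := (hmR.eventually (eventually_ge_atTop t₀)).and
    ((hmtop.eventually (eventually_ge_atTop (r + 1))).and
      ((hmp.eventually (eventually_le_nhds zero_lt_one)).and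
        ((hatop.eventually (eventually_lt_atBot 0)).and
          (hainv.abs.eventually (eventually_le_nhds (by simp : |(0 : ℝ)| < 1))))))
  filter_upwards [tendsto_fst_whp.eventually hev, hL, hpos] with q ⟨h1, h2, h3, h4, h5⟩ hLq hposq
  intro ij
  have hp1 : t₀ ≤ 1 / p q.1 := by
    refine h1.trans ?_
    rwa [le_div_iff₀ (hp _)]
  exact abs_modelPoint_sub_le (U := U) (γ := γ) (c := c) ht₀ (hU _ h1) hposq
    (i := ij.1) (j := ij.2 + 1) (by omega) (by have := ij.2.2; omega) h2 (hLq _ ij.1.2) (hp _) hp1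
    h3 h4.ne h5

/-- In Rényi's representation the statistic is asymptotically the square of the normalized sum of
the upper spacings. -/
theorem modelStat_approx [IsProbabilityMeasure Q] (hm : ∀ q, Measurable (ε q))
    (hε : ∀ q, HasLaw (ε q) (expMeasure 1) Q) (hεi : iIndepFun ε Q) {U A : ℝ → ℝ}
    {γ c C t₀ : ℝ} {K : ℕ} (hγ : 0 < γ) (hC : 1 ≤ C) (ht₀ : 1 ≤ t₀)
    (hU : ∀ m ≥ t₀, ∀ y ≥ t₀,
        |Real.log (U y) - γ * Real.log y - c| ≤ C * |A m| * (1 + (m / y) ^ K))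
    (hA : ∀ m ≥ t₀, 1 ≤ C * m ^ K * |A m|) {r : ℕ} (hr : 1 ≤ r) {k m : ℕ → ℕ} {p : ℕ → ℝ}
    (hk : Tendsto k atTop atTop) (hmtop : Tendsto m atTop atTop)
    (hkA : Tendsto (fun n => √(k n : ℝ) * A (m n)) atTop (𝓝 0)) (hp : ∀ n, 0 < p n)
    (hmp : Tendsto (fun n => (m n : ℝ) * p n) atTop (𝓝 0)) :
    (∀ᶠ q in whp Q, modelStat (fun x => U (Real.exp x)) (fun l => ε l q.2) (k q.1) (m q.1) r (p q.1)
        (Real.log (U (1 / p q.1))) =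
      ((modelStat (fun x => U (Real.exp x)) (fun l => ε l q.2) (k q.1) (m q.1) r (p q.1)
        (Real.log (U (1 / p q.1)))).toReal : EReal)) ∧
    Tendsto (fun q : ℕ × Ω => (modelStat (fun x => U (Real.exp x)) (fun l => ε l q.2) (k q.1)
      (m q.1) r (p q.1) (Real.log (U (1 / p q.1)))).toReal - spacingSum ε (k q.1) r q.2 ^ 2)
      (whp Q) (𝓝 0) := by
  have hainv : Tendsto (fun n => (aConst (m n) r (p n))⁻¹) atTop (𝓝 0) :=
    tendsto_inv_atBot_zero.comp (tendsto_aConst_atBot hmtop hp hmp)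
  have hbk : Tendsto (fun n => √(k n : ℝ) * (C * |A (m n)|)) atTop (𝓝 0) := by
    have := hkA.abs.const_mul C
    rw [abs_zero, mul_zero] at this
    refine this.congr fun n => ?_
    rw [abs_mul, abs_of_nonneg (Real.sqrt_nonneg _)]
    ring
  have hu1 := tendsto_centered_average hm hε hεi hr k m hainv
  have hu2 := tendsto_centered_average_sq hm hε hεi hr k m hainv
  have hR := tendsto_remainder_bound hm hε hεi r K k m hmtop (fun n => by positivity) hbk
  have hdu := eventually_abs_modelPoint_sub_le (k := k) (r := r) hm hε hεi ht₀ hU hA hmtop hbk hp hmp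
  have hkpos : ∀ᶠ q : ℕ × Ω in whp Q, 0 < k q.1 :=
    tendsto_fst_whp.eventually (hk.eventually (eventually_gt_atTop 0))
  -- The pointwise bound is divided by `γ`, and each block's remainder is counted once for each of
  -- its `r` spacings.
  have hDR := hR.const_mul ((2 * r + 3) / γ * r)
  rw [mul_zero] at hDR
  have hd := tendsto_sum_of_sum_abs_add_le (r := r) (κ := fun q : ℕ × Ω => k q.1) hkpos
    (d := fun q ij => modelPoint (fun x => U (Real.exp x)) (fun l => ε l q.2) (m q.1) r (p q.1)
      (Real.log (U (1 / p q.1))) ij.1 (ij.2 + 1) / γ - (ε (ij.1, ij.2 + 1) q.2 - 1))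
    (u := fun q i => ∑ l ∈ Finset.Icc (r + 1) (m q.1),
      (aConst (m q.1) r (p q.1))⁻¹ * (l : ℝ)⁻¹ * (ε (i, l) q.2 - 1)) (by
    filter_upwards [hdu, hkpos] with q hq hkq
    have hs : √(k q.1 : ℝ) ≠ 0 := by positivity
    have h1 : ∀ x y w B : ℝ, |x - γ * (y - w)| ≤ B → |x / γ - y + w| ≤ B / γ := by
      intro x y w B h
      rw [show x / γ - y + w = (x - γ * (y - w)) / γ by field_simp; ring, abs_div, abs_of_pos hγ]
      exact div_le_div_of_nonneg_right h hγ.le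
    refine (Finset.sum_le_sum fun ij _ => h1 _ _ _ _ (hq ij)).trans (le_of_eq ?_)
    rw [← Finset.sum_div, ← Finset.mul_sum, sum_fin_prod_fst (k q.1) r fun i =>
      1 + (m q.1 * Real.exp (-renyiSum (fun l => ε l q.2) (m q.1) i (r + 1))) ^ K]
    generalize ∑ i ∈ Finset.range (k q.1),
      (1 + (m q.1 * Real.exp (-renyiSum (fun l => ε l q.2) (m q.1) i (r + 1))) ^ K) = S
    field_simp) hDR hu1 hu2
  have hmain := tendsto_logLikRatio_sub_sq hr hγ (κ := fun q : ℕ × Ω => k q.1)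
    (hk.comp tendsto_fst_whp) (fun q ij => ε (ij.1, ij.2 + 1) q.2 - 1) _
    (fun q ij => modelPoint (fun x => U (Real.exp x)) (fun l => ε l q.2) (m q.1) r (p q.1)
      (Real.log (U (1 / p q.1))) ij.1 (ij.2 + 1))
    (fun q ij => by rw [add_sub_cancel, mul_div_cancel₀ _ hγ.ne']) hd.1 hd.2
    (tendsto_sum_spacing_sq hm hε hεi r hk) (tendsto_sum_spacing_pow_four hm hε r hk)
    (s := fun q => spacingSum ε (k q.1) r q.2)
    (fun q => sum_eq_sqrt_mul_spacingSum hr (k q.1) q.2)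
    fun Z hZ => tendsto_whp_mul_zero (s := fun n ω => spacingSum ε (k n) r ω)
      (fun n => Measurable.aemeasurable (by unfold spacingSum; fun_prop))
      (fun n => lintegral_spacingSum_sq_le hε hεi (k n) r) hZ
  exact hmain

theorem measurable_modelStat {V : ℝ → ℝ} (hV : Measurable V) (hm : ∀ q, Measurable (ε q))
    (k m r : ℕ) (p y : ℝ) :
    Measurable fun ω => modelStat V (fun l => ε l ω) k m r p y := by
  refine measurable_logLikRatio.comp (measurable_pi_lambda _ fun ij => ?_)
  unfold modelPoint renyiSum
  fun_prop

end ModelLimit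

end BlockQuantile

end

/-! ### Transfer of the limit from the exponential model to the sample. -/

theorem theorem5
    {Ω : Type*} [MeasurableSpace Ω] (P : Measure Ω) [IsProbabilityMeasure P]
    {Ω' : Type*} [MeasurableSpace Ω'] (P' : Measure Ω') [IsProbabilityMeasure P']
    -- an i.i.d. sample from the law `μ` (distribution function `F`), with values in `[1, ∞)`
    (μ : Measure ℝ) [IsProbabilityMeasure μ] (hμ : ∀ᵐ x ∂μ, 1 ≤ x)
    (X : ℕ → Ω → ℝ) (hlaw : ∀ i, HasLaw (X i) μ P) (hindep : iIndepFun X P)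
    -- the second-order condition on `U`
    (γ ρ : ℝ) (hγ : 0 < γ) (hρ : ρ < 0)
    (A : ℝ → ℝ) (hAmeas : Measurable A) (hA : Tendsto A atTop (𝓝 0))
    (hU : BlockQuantile.SecondOrder μ γ ρ A)
    -- `k n` blocks of length `m_n = ⌊n / k n⌋`, of which the `r + 1` largest values are observed
    (r : ℕ) (hr : 1 ≤ r) (k : ℕ → ℕ)
    (hk : Tendsto k atTop atTop) (hm : Tendsto (fun n => n / k n) atTop atTop)
    (hkA : Tendsto (fun n => √(k n : ℝ) * A ((n / k n : ℕ) : ℝ)) atTop (𝓝 0))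
    -- the level `p_n`
    (p : ℕ → ℝ) (hp : ∀ n, 0 < p n ∧ p n < 1)
    (hmp : Tendsto (fun n => ((n / k n : ℕ) : ℝ) * p n) atTop (𝓝 0))
    (hlog : (fun n => Real.log (((n / k n : ℕ) : ℝ) * p n)) =o[atTop] fun n => √(k n : ℝ))
    -- a chi-squared variable with one degree of freedom
    (W : Ω' → ℝ) (hW : HasLaw W BlockQuantile.chiSqOne P') :
    TendstoInDistribution
      (fun (n : ℕ) (ω : Ω) =>
        BlockQuantile.elStat (fun l => X l ω) (k n) (n / k n) r (p n)
          (Real.log (BlockQuantile.highQuantile μ (p n))))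
      atTop (fun ω => (W ω : EReal)) (fun _ => P) P' := by
  obtain ⟨c, C, t₀, K, hC, ht₀, hUb, hAb⟩ := BlockQuantile.exists_abs_log_sub_le
    (U := BlockQuantile.tailU μ) hρ
    (fun t ht => zero_lt_one.trans_le (BlockQuantile.one_le_tailU μ hμ ht)) hAmeas hA hU
  -- A single family of exponentials serves all `n`. It lives on a separate space, since only the
  -- law of the statistic matters.
  obtain ⟨_, _, Q, ε, hεm, hε, hεi, hQ⟩ := exists_iid (ℕ × ℕ) (expMeasure 1)
  have hquant : ∀ n, BlockQuantile.highQuantile μ (p n) = BlockQuantile.tailU μ (1 / p n) :=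
    fun n => by
      rw [BlockQuantile.tailU, BlockQuantile.highQuantile, one_div_one_div]
  simp_rw [hquant]
  have happ := BlockQuantile.modelStat_approx hεm hε hεi hγ hC ht₀ hUb hAb hr hk hm hkA
    (fun n => (hp n).1) hmp
  have hclt : TendstoInDistribution (fun n ω => BlockQuantile.spacingSum ε (k n) r ω ^ 2) atTop
      (fun x : ℝ => x ^ 2) (fun _ => Q) (gaussianReal 0 1) :=
    (BlockQuantile.tendstoInDistribution_spacingSum hε hεi hr hk).continuous_comp
      (continuous_pow 2)
  have hmeas : ∀ n, AEMeasurable (fun ω => BlockQuantile.modelStat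
      (fun x => BlockQuantile.tailU μ (Real.exp x)) (fun l => ε l ω) (k n) (n / k n) r (p n)
      (Real.log (BlockQuantile.tailU μ (1 / p n)))) Q := fun n =>
    (BlockQuantile.measurable_modelStat (BlockQuantile.monotone_tailU_exp μ hμ).measurable hεm
      _ _ _ _ _).aemeasurable
  have hmodel := BlockQuantile.tendstoInDistribution_coe_ereal hclt hmeas happ.1 happ.2
  have hWc : AEMeasurable (fun ω => (W ω : EReal)) P' :=
    measurable_coe_real_ereal.comp_aemeasurable hW.aemeasurable
  refine ⟨fun n => BlockQuantile.aemeasurable_elStat hlaw _ _ _ _ _, hWc, ?_⟩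
  have hlim : P'.map (fun ω => (W ω : EReal)) =
      (gaussianReal 0 1).map (fun x : ℝ => ((x ^ 2 : ℝ) : EReal)) := by
    have h1 := AEMeasurable.map_map_of_aemeasurable (g := fun x : ℝ => (x : EReal))
      measurable_coe_real_ereal.aemeasurable hW.aemeasurable
    have h2 := Measure.map_map (μ := gaussianReal 0 1) (g := fun x : ℝ => (x : EReal))
      (f := fun x : ℝ => x ^ 2) measurable_coe_real_ereal (measurable_id.pow_const 2)
    rw [hW.map_eq, BlockQuantile.chiSqOne, h2] at h1
    exact h1.symm
  have ht := hmodel.tendsto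
  have hlim' : (⟨P'.map (fun ω => (W ω : EReal)), Measure.isProbabilityMeasure_map hWc⟩ :
      ProbabilityMeasure EReal) =
      ⟨_, Measure.isProbabilityMeasure_map hmodel.aemeasurable_limit⟩ := Subtype.ext hlim
  rw [hlim']
  refine ht.congr' ?_
  -- The two laws are identified only once the blocks contain `r + 1` points, which suffices for the
  -- limit.
  filter_upwards [hm.eventually (eventually_ge_atTop (r + 1))] with n hn
  exact Subtype.ext (BlockQuantile.map_elStat_eq_map_modelStat hμ hlaw hindep hε hεi (k n) hn
    (p n) _).symm
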